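/- **Setting.** Let $K\ge 1$. In round $t=1,2,\dots$ a learner draws an arm $A_t\in[K]$ from a distribution $\pi_t$ on $[K]$ that is a measurable function of $(A_i,X_i)_{i<t}$, and then observes a reward $X_t\in[0,1]$. Let $\mathcal F_t=\sigma((A_i,X_i)_{i\le t})$. For $\mu\in[0,1]^K$, $\mathcal P(\mu)$ is the class of all bandit instances $P$ (arbitrary reward mechanisms, possibly nonstationary and history dependent) with $\mathbb E[X_t\mid A_t=a,\mathcal F_{t-1}]=\mu_a$ for all $t,a$. For a threshold $\xi$ put $\mathcal G_\mu=\{a:\mu_a>\xi\}$ and $G_\mu=|\mathcal G_\mu|$. A GAI algorithm consists of a sampling policy and $\mathcal F_t$-measurable sets $\mathcal G_t,\mathcal B_t\subseteq[K]$ (arms labelled good, bad), $t\ge 0$. It is $\delta$-correct if for every $\mu'\in[0,1]^K$ and every $P\in\mathcal P(\mu')$ the probability that $\mathcal G_t\not\subseteq\mathcal G_{\mu'}$ or $\mathcal B_t\not\subseteq[K]\setminus\mathcal G_{\mu'}$ for some $t$ is at most $\delta$. Let $\tau_{\rm stop}=\inf\{t:\mathcal G_t\cup\mathcal B_t=[K]\}$,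 and let $\tau_{\mathcal G,i}=\inf\{t:|\mathcal G_t|\ge i\}$ be the first time $i$ arms are labelled good ($\inf\emptyset=\infty$). Put $d(x,\xi)=\log\frac{1-x}{1-\xi}+x\log\frac{x(1-\xi)}{\xi(1-x)}$. **Resetting algorithm.** A sampling scheme $\pi$ assigns to each set $S$ of available arms a policy that (for $S\neq\emptyset$) pulls only arms of $S$; its initialized version on $S$ first samples each arm of $S$ once and then follows $\pi$ on $S$. The scheme is *horizon-free regret-minimizing* for $\mu$ if for every nonempty $S\subseteq[K]$, with $a^*_S=\arg\max_{a\in S}\mu_a$, and every $P\in\mathcal P(\mu)$ there is a constant $c>0$ independent of $t$ such that, when the initialized version of $\pi$ on $S$ is run, $\mathbb P(A_t\ne a^*_S)\le c/t$ for all $t\ge1$. (The scheme takes no horizon as input.) Given $\xi,b,\delta$ and a number $m\in[K]$ of desired good arms, the algorithm starts with $\mathcal G_0=\mathcal B_0=\emptyset$ and works in epochs. In an epoch, with $S$ the set of arms not yet labelled, it runs the initialized version of $\pi$ on $S$, fed only with the rounds of that epoch. With $\hat\mu_{i-1}(a)$ the mean of the rewards of arm $a$ in the earlier rounds of the epoch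 (equal to $\xi$ if there are none), $$E_t^-(a)=\prod_{i\le t,\,A_i=a}\bigl(1+\lambda_{i,a}^-(X_i-\xi)\bigr),\qquad E_t^+(a)=\prod_{i\le t,\,A_i=a}\bigl(1+\lambda_{i,a}^+(X_i-\xi)\bigr),$$ $$\lambda^-_{i,a}=\min\Bigl(\tfrac b\xi,\max\bigl(\tfrac{\hat\mu_{i-1}(a)-\xi}{\xi(1-\xi)},0\bigr)\Bigr),\qquad \lambda^+_{i,a}=\min\Bigl(0,\max\bigl(\tfrac{\hat\mu_{i-1}(a)-\xi}{\xi(1-\xi)},\tfrac{-b}{1-\xi}\bigr)\Bigr),$$ the products being over rounds of the current epoch. After each round $t$ of the epoch following the initial samples, $A_t$ is labelled good if $E_t^-(A_t)\ge 2K/\delta$ and bad if $E_t^+(A_t)>2K/\delta$; when $A_t$ is labelled, the epoch ends and everything is reset. The algorithm ends at the first time $\tau_{\rm end}^{(m)}$ at which $|\mathcal G_t|\ge m$ or all arms are labelled, and its labels do not change afterwards. **Theorem.** Let $\xi,b\in(0,1)$, and let $\mu\in[\xi(1-b),\,b(1-\xi)+\xi]^K$ with $\mu_a\ne\xi$ for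 all $a$ and $\mu_a\neq\mu_{a'}$ for $a\ne a'$. Let $\mu_{i^*}$ denote the $i$-th largest of the means. Below, $\inf_{\mathcal A}$ is over all $\delta$-correct GAI algorithms. 1. $\displaystyle\liminf_{\delta\to0}\ \inf_{\mathcal A}\ \sup_{P\in\mathcal P(\mu)}\frac{\mathbb E[\tau_{\rm stop}]}{\log(1/\delta)}\ \ge\ \sum_{a=1}^K\frac1{d(\mu_a,\xi)}$. 2. For $1\le i\le G_\mu$: $\displaystyle\liminf_{\delta\to0}\ \inf_{\mathcal A}\ \sup_{P\in\mathcal P(\mu)}\frac{\mathbb E[\tau_{\mathcal G,i}]}{\log(1/\delta)}\ \ge\ \sum_{a:\mu_a\ge\mu_{i^*}}\frac1{d(\mu_a,\xi)}$. 3. Let $\pi$ be a sampling scheme that is horizon-free regret-minimizing for $\mu$. The resetting algorithm with $\pi$ satisfies, for $m=K$, $$\limsup_{\delta\to0}\ \sup_{P\in\mathcal P(\mu)}\frac{\mathbb E[\tau_{\rm stop}]}{\log(1/\delta)}\ \le\ \sum_{a=1}^K\frac1{d(\mu_a,\xi)};$$ for every $m\in[K]$ with $m\ge G_\mu$, $$\limsup_{\delta\to0}\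 \sup_{P\in\mathcal P(\mu)}\frac{\mathbb E[\min(\tau_{\rm stop},\tau^{(m)}_{\rm end})]}{\log(1/\delta)}\ \le\ \sum_{a=1}^K\frac1{d(\mu_a,\xi)};$$ and for every $m\in[K]$ and $1\le i\le\min(m,G_\mu)$, $$\limsup_{\delta\to0}\ \sup_{P\in\mathcal P(\mu)}\frac{\mathbb E[\min(\tau_{\mathcal G,i},\tau^{(m)}_{\rm end})]}{\log(1/\delta)}\ \le\ \sum_{a:\mu_a\ge\mu_{i^*}}\frac1{d(\mu_a,\xi)}.$$ -/

import Mathlib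

open MeasureTheory Filter Topology
open scoped ENNReal

noncomputable section

namespace GAI

/-! ### Trajectories, policies, bandit instances -/

/-- One round: the arm that is pulled and the reward in `[0,1]` that is observed. -/
abbrev Obs (K : ℕ) : Type := Fin K × unitInterval

/-- A trajectory. Round `t + 1` is stored at index `t`. -/
abbrev Path (K : ℕ) : Type := ℕ → Obs K

/-- The arm pulled at index `t`. -/
def arm {K : ℕ} (t : ℕ) (ω : Path K) : Fin K := (ω t).1

/-- The reward observed at index `t`. -/
def reward {K : ℕ} (t : ℕ) (ω : Path K) : ℝ := ((ω t).2 : ℝ)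

/-- The canonical filtration: the sigma-algebra generated by the first `t` rounds
(indices `0, …, t - 1`); it is trivial for `t = 0`. -/
def past (K t : ℕ) : MeasurableSpace (Path K) :=
  MeasurableSpace.comap (fun (ω : Path K) (i : Fin t) => ω i) inferInstance

/-- A sampling policy: `prob t ω` is the distribution over the arms from which the arm of
index `t` is drawn; it is a point of the probability simplex and a measurable function of the
first `t` rounds only. -/
structure Policy (K : ℕ) where
  prob : ℕ → Path K → Fin K → ℝ
  mem_simplex : ∀ t ω, prob t ω ∈ stdSimplex ℝ (Fin K)
  adapted : ∀ t a, Measurable[past K t] fun ω => prob t ω a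

/-- `P` is the law of the trajectory when the policy `π` interacts with some bandit instance of
the nonparametric, nonstationary class with arm means `μ`: arms are drawn from `π` given the
past, and the conditional mean of the reward given the past and the pulled arm `a` is `μ a`.
Nothing else is imposed on the rewards (they are `[0,1]`-valued by typing). -/
structure IsBanditLaw {K : ℕ} (π : Policy K) (μ : Fin K → ℝ) (P : Measure (Path K)) :
    Prop where
  isProbabilityMeasure : IsProbabilityMeasure P
  arm_law : ∀ t a,
    P[Set.indicator {ω : Path K | arm t ω = a} (fun _ => (1 : ℝ)) | past K t]
      =ᵐ[P] fun ω => π.prob t ω a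
  reward_mean : ∀ t,
    P[reward t | past K t ⊔ MeasurableSpace.comap (arm t) ⊤] =ᵐ[P] fun ω => μ (arm t ω)

/-- The worst-case expectation `sup_{P ∈ 𝒫(μ)} E[τ]` when sampling with `π`. -/
def worstCase {K : ℕ} (π : Policy K) (μ : Fin K → ℝ) (τ : Path K → ℝ≥0∞) : ℝ≥0∞ :=
  ⨆ (P : Measure (Path K)) (_ : IsBanditLaw π μ P), ∫⁻ ω, τ ω ∂P

/-! ### Good arm identification algorithms -/

/-- The true good arms for the threshold `ξ`; the bad arms are the others. -/
def goodArms {K : ℕ} (ξ : ℝ) (μ : Fin K → ℝ) : Finset (Fin K) :=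
  Finset.univ.filter fun a => ξ < μ a

/-- A fixed-confidence GAI algorithm: a sampling policy and, after each number `t` of rounds, the
sets of arms labelled good and bad, which are functions of the first `t` rounds. -/
structure Algorithm (K : ℕ) where
  policy : Policy K
  good : ℕ → Path K → Finset (Fin K)
  bad : ℕ → Path K → Finset (Fin K)
  good_adapted : ∀ t S, MeasurableSet[past K t] {ω | good t ω = S}
  bad_adapted : ∀ t S, MeasurableSet[past K t] {ω | bad t ω = S}

/-- The first time at which `p` holds, `∞` if there is none. -/
def firstTime (p : ℕ → Prop) : ℝ≥0∞ := ⨅ (t : ℕ) (_ : p t), (t : ℝ≥0∞)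

/-- `τ_stop`: the first time at which all arms are labelled. -/
def stopTime {K : ℕ} (A : Algorithm K) (ω : Path K) : ℝ≥0∞ :=
  firstTime fun t => A.good t ω ∪ A.bad t ω = Finset.univ

/-- `τ_{𝒢,i}`: the first time at which `i` arms are labelled good (an algorithm may label
several arms in the same round). -/
def goodTime {K : ℕ} (A : Algorithm K) (i : ℕ) (ω : Path K) : ℝ≥0∞ :=
  firstTime fun t => i ≤ (A.good t ω).card

/-- `δ`-level error control: for all arm means in `[0,1]` and all bandit instances with these
means, the probability that any arm is ever mislabelled is at most `δ`. -/
def IsDeltaCorrect {K : ℕ} (ξ δ : ℝ) (A : Algorithm K) : Prop :=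
  ∀ μ : Fin K → ℝ, (∀ a, μ a ∈ Set.Icc (0 : ℝ) 1) →
    ∀ P : Measure (Path K), IsBanditLaw A.policy μ P →
      P {ω | ∃ t, ¬ A.good t ω ⊆ goodArms ξ μ ∨ ¬ A.bad t ω ⊆ (goodArms ξ μ)ᶜ}
        ≤ ENNReal.ofReal δ

/-- The Bernoulli divergence `d(x, ξ)`. -/
def bernKL (x ξ : ℝ) : ℝ :=
  Real.log ((1 - x) / (1 - ξ)) + x * Real.log (x * (1 - ξ) / (ξ * (1 - x)))

/-! ### Sampling schemes with elimination, regret minimization -/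

/-- A sampling scheme that accommodates elimination of arms: for every set `S` of available arms
a policy which, when `S` is nonempty, only pulls arms of `S`. -/
structure Scheme (K : ℕ) where
  policy : Finset (Fin K) → Policy K
  supported : ∀ S : Finset (Fin K), S.Nonempty → ∀ t ω, ∀ a ∉ S, (policy S).prob t ω a = 0

theorem past_mono {K s t : ℕ} (h : s ≤ t) : past K s ≤ past K t := by
  have : (fun (ω : Path K) (i : Fin s) => ω i) =
      (fun (g : Fin t → Obs K) (i : Fin s) => g (Fin.castLE h i)) ∘
        (fun (ω : Path K) (i : Fin t) => ω i) := rfl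
  unfold past
  rw [this, ← MeasurableSpace.comap_comp]
  apply MeasurableSpace.comap_mono
  rw [← measurable_iff_comap_le]
  fun_prop

theorem past_le (K t : ℕ) : past K t ≤ (inferInstance : MeasurableSpace (Path K)) := by
  unfold past
  rw [← measurable_iff_comap_le]
  fun_prop

theorem measurable_coord {K i t : ℕ} (h : i < t) :
    Measurable[past K t] fun ω : Path K => ω i := by
  have h1 : Measurable[past K t] fun (ω : Path K) (j : Fin t) => ω j :=
    comap_measurable _
  exact (measurable_pi_apply (⟨i, h⟩ : Fin t)).comp h1

theorem measurable_arm {K i t : ℕ} (h : i < t) : Measurable[past K t] (arm (K := K) i) :=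
  measurable_fst.comp (measurable_coord h)

theorem measurable_reward {K i t : ℕ} (h : i < t) :
    Measurable[past K t] (reward (K := K) i) :=
  measurable_subtype_coe.comp (measurable_snd.comp (measurable_coord h))

/-- First sample each arm of `S` once (in increasing order), then follow the scheme on `S`. -/
def Scheme.initialized {K : ℕ} (π : Scheme K) (S : Finset (Fin K)) : Policy K where
  prob t ω := if h : t < S.card then Pi.single (S.orderEmbOfFin rfl ⟨t, h⟩) 1
    else (π.policy S).prob t ω
  mem_simplex t ω := by
    split_ifs with h
    · exact single_mem_stdSimplex ℝ _
    · exact (π.policy S).mem_simplex t ω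
  adapted t a := by
    by_cases h : t < S.card
    · simp only [h, dite_true]
      exact measurable_const
    · simp only [h, dite_false]
      exact (π.policy S).adapted t a

/-- Horizon-free regret minimization (for the arm means `μ`): whatever set `S` of arms is
available and whatever the bandit instance with means `μ`, the arm pulled in round `t + 1`
differs from the best available arm with probability at most `c / (t + 1)`, where `c` does not
depend on `t`. A scheme sees only the past and the available arms, never a horizon. -/
def IsRegretMinimizing {K : ℕ} (π : Scheme K) (μ : Fin K → ℝ) : Prop :=
  ∀ S : Finset (Fin K), ∀ aStar ∈ S, (∀ a ∈ S, μ a ≤ μ aStar) →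
    ∀ P : Measure (Path K), IsBanditLaw (π.initialized S) μ P →
      ∃ c : ℝ, 0 < c ∧ ∀ t : ℕ,
        P {ω | arm t ω ≠ aStar} ≤ ENNReal.ofReal (c / ((t : ℝ) + 1))

/-! ### Predictable plug-in e-processes

All statistics below use only the rounds with indices in `[s, t)`, where `s` is the time of the
last reset. -/

/-- The indices in `[s, t)` at which arm `a` was pulled. -/
def pulls {K : ℕ} (s t : ℕ) (a : Fin K) (ω : Path K) : Finset ℕ :=
  (Finset.Ico s t).filter fun i => arm i ω = a

/-- The empirical mean of arm `a`, equal to `ξ` if there is no observation. -/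
def empMean {K : ℕ} (ξ : ℝ) (s t : ℕ) (a : Fin K) (ω : Path K) : ℝ :=
  if (pulls s t a ω).card = 0 then ξ
  else (∑ i ∈ pulls s t a ω, reward i ω) / (pulls s t a ω).card

/-- The bet `λ⁻` as a function of the current empirical mean `x`. -/
def betMinus (ξ b x : ℝ) : ℝ := min (b / ξ) (max ((x - ξ) / (ξ * (1 - ξ))) 0)

/-- The bet `λ⁺` as a function of the current empirical mean `x`. -/
def betPlus (ξ b x : ℝ) : ℝ := min 0 (max ((x - ξ) / (ξ * (1 - ξ))) (-b / (1 - ξ)))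

/-- The e-process against `μ a ≤ ξ`; the bet in each factor uses the earlier rounds only. -/
def eMinus {K : ℕ} (ξ b : ℝ) (s t : ℕ) (a : Fin K) (ω : Path K) : ℝ :=
  ∏ i ∈ pulls s t a ω, (1 + betMinus ξ b (empMean ξ s i a ω) * (reward i ω - ξ))

/-- The e-process against `μ a > ξ`. -/
def ePlus {K : ℕ} (ξ b : ℝ) (s t : ℕ) (a : Fin K) (ω : Path K) : ℝ :=
  ∏ i ∈ pulls s t a ω, (1 + betPlus ξ b (empMean ξ s i a ω) * (reward i ω - ξ))

/-! ### The resetting algorithm -/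

/-- The state of the algorithm: the time of the last reset and the two label sets. -/
structure State (K : ℕ) where
  start : ℕ
  good : Finset (Fin K)
  bad : Finset (Fin K)

/-- The unlabelled arms. -/
def State.unlabeled {K : ℕ} (σ : State K) : Finset (Fin K) := (σ.good ∪ σ.bad)ᶜ

/-- The loop ends when `m` arms are labelled good or no arm is left. -/
def State.Stopped {K : ℕ} (m : ℕ) (σ : State K) : Prop :=
  m ≤ σ.good.card ∨ σ.unlabeled = ∅

open Classical in
/-- The update after the round of index `t`. Nothing happens once the loop has ended, nor while
each available arm is being sampled once. Otherwise the pulled arm is tested; when it is labelled,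
it is removed, and all statistics are reset (`start` becomes the current time). -/
def step {K : ℕ} (ξ b δ : ℝ) (m t : ℕ) (σ : State K) (ω : Path K) : State K :=
  if σ.Stopped m ∨ t < σ.start + σ.unlabeled.card then σ
  else
    { start :=
        if 2 * (K : ℝ) / δ ≤ eMinus ξ b σ.start (t + 1) (arm t ω) ω ∨
            2 * (K : ℝ) / δ < ePlus ξ b σ.start (t + 1) (arm t ω) ω
        then t + 1 else σ.start
      good :=
        if 2 * (K : ℝ) / δ ≤ eMinus ξ b σ.start (t + 1) (arm t ω) ω
        then insert (arm t ω) σ.good else σ.good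
      bad :=
        if 2 * (K : ℝ) / δ < ePlus ξ b σ.start (t + 1) (arm t ω) ω
        then insert (arm t ω) σ.bad else σ.bad }

/-- The state after `t` rounds. -/
def state {K : ℕ} (ξ b δ : ℝ) (m : ℕ) : ℕ → Path K → State K
  | 0, _ => ⟨0, ∅, ∅⟩
  | t + 1, ω => step ξ b δ m t (state ξ b δ m t ω) ω

/-- The trajectory from index `s` on. -/
def shift {K : ℕ} (s : ℕ) (ω : Path K) : Path K := fun i => ω (s + i)

theorem measurable_shift {K s t : ℕ} (h : s ≤ t) :
    @Measurable _ _ (past K t) (past K (t - s)) (shift (K := K) s) := by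
  unfold past
  rw [measurable_comap_iff]
  rw [@measurable_pi_iff]
  intro i
  exact measurable_coord (K := K) (i := s + i) (t := t) (by omega)

theorem state_start_le {K : ℕ} (ξ b δ : ℝ) (m t : ℕ) (ω : Path K) :
    (state ξ b δ m t ω).start ≤ t := by
  induction t with
  | zero => simp [state]
  | succ t ih =>
    simp only [state, step]
    split_ifs <;> first | exact ih.trans (Nat.le_succ t) | exact le_rfl

instance {K : ℕ} : MeasurableSpace (State K) := ⊤

instance {K : ℕ} : DiscreteMeasurableSpace (State K) := ⟨fun _ => trivial⟩

instance {K : ℕ} : Countable (State K) :=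
  Function.Injective.countable (f := fun σ : State K => (σ.start, σ.good, σ.bad)) (by
    rintro ⟨a, b, c⟩ ⟨a', b', c'⟩ h
    simpa using h)

/-- Selecting among countably many measurable functions. -/
theorem measurable_select {α ι β : Type*} [Countable ι] {mα : MeasurableSpace α}
    [MeasurableSpace β] [MeasurableSpace ι] [DiscreteMeasurableSpace ι] {g : α → ι}
    (hg : Measurable g) {f : ι → α → β} (hf : ∀ i, (∃ x, g x = i) → Measurable (f i)) :
    Measurable fun x => f (g x) x := by
  intro B hB
  have : (fun x => f (g x) x) ⁻¹' B = ⋃ i : ι, (g ⁻¹' {i} ∩ f i ⁻¹' B) := by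
    ext x
    simp
  rw [this]
  refine MeasurableSet.iUnion fun i => ?_
  by_cases hi : ∃ x, g x = i
  · exact (hg (MeasurableSet.of_discrete)).inter (hf i hi hB)
  · have : g ⁻¹' {i} = ∅ := by
      ext x
      simpa using fun h => hi ⟨x, h⟩
    rw [this, Set.empty_inter]
    exact MeasurableSet.empty

theorem measurableSet_arm {K i t : ℕ} (h : i < t) (a : Fin K) :
    MeasurableSet[past K t] {ω : Path K | arm i ω = a} :=
  (measurable_arm h) (MeasurableSet.of_discrete (s := {a}))

theorem measurable_empMean {K : ℕ} (ξ : ℝ) {s i t : ℕ} (h : i ≤ t) (a : Fin K) :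
    Measurable[past K t] (empMean (K := K) ξ s i a) := by
  have hsum : Measurable[past K t] fun ω : Path K => ∑ j ∈ pulls s i a ω, reward j ω := by
    simp only [pulls, Finset.sum_filter]
    refine Finset.measurable_sum _ fun j hj => ?_
    have hj' : j < t := lt_of_lt_of_le (Finset.mem_Ico.1 hj).2 h
    exact Measurable.ite (measurableSet_arm hj' a) (measurable_reward hj') measurable_const
  have hcard : Measurable[past K t] fun ω : Path K => (pulls s i a ω).card := by
    simp only [pulls, Finset.card_filter]
    refine Finset.measurable_sum _ fun j hj => ?_
    have hj' : j < t := lt_of_lt_of_le (Finset.mem_Ico.1 hj).2 h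
    exact Measurable.ite (measurableSet_arm hj' a) measurable_const measurable_const
  unfold empMean
  refine Measurable.ite (hcard (MeasurableSet.of_discrete (s := {0}))) measurable_const ?_
  exact hsum.div (Measurable.comp (g := fun n : ℕ => (n : ℝ)) Measurable.of_discrete hcard)

theorem measurable_eProcess {K : ℕ} (ξ : ℝ) (s t : ℕ) (a : Fin K) {β : ℝ → ℝ}
    (hβ : Measurable β) :
    Measurable[past K t] fun ω : Path K =>
      ∏ i ∈ pulls s t a ω, (1 + β (empMean ξ s i a ω) * (reward i ω - ξ)) := by
  simp only [pulls, Finset.prod_filter]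
  refine Finset.measurable_prod _ fun j hj => ?_
  have hj' : j < t := (Finset.mem_Ico.1 hj).2
  refine Measurable.ite (measurableSet_arm hj' a) ?_ measurable_const
  exact ((hβ.comp (measurable_empMean ξ hj'.le a)).mul
    ((measurable_reward hj').sub_const ξ)).const_add 1

theorem measurable_step {K : ℕ} (ξ b δ : ℝ) (m t : ℕ) (σ : State K) :
    Measurable[past K (t + 1)] (step ξ b δ m t σ) := by
  classical
  have hM : Measurable[past K (t + 1)] fun ω : Path K =>
      eMinus ξ b σ.start (t + 1) (arm t ω) ω := by
    refine @measurable_select _ _ _ _ (past K (t + 1)) _ _ _ _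
      (measurable_arm (Nat.lt_succ_self t))
      (fun a ω => eMinus ξ b σ.start (t + 1) a ω) fun a _ => ?_
    exact measurable_eProcess ξ _ _ a (by unfold betMinus; fun_prop)
  have hP : Measurable[past K (t + 1)] fun ω : Path K =>
      ePlus ξ b σ.start (t + 1) (arm t ω) ω := by
    refine @measurable_select _ _ _ _ (past K (t + 1)) _ _ _ _
      (measurable_arm (Nat.lt_succ_self t))
      (fun a ω => ePlus ξ b σ.start (t + 1) a ω) fun a _ => ?_
    exact measurable_eProcess ξ _ _ a (by unfold betPlus; fun_prop)
  have hMs : MeasurableSet[past K (t + 1)] {ω : Path K |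
      2 * (K : ℝ) / δ ≤ eMinus ξ b σ.start (t + 1) (arm t ω) ω} := hM measurableSet_Ici
  have hPs : MeasurableSet[past K (t + 1)] {ω : Path K |
      2 * (K : ℝ) / δ < ePlus ξ b σ.start (t + 1) (arm t ω) ω} := hP measurableSet_Ioi
  by_cases hc : σ.Stopped m ∨ t < σ.start + σ.unlabeled.card
  · have : step ξ b δ m t σ = fun _ => σ := by
      funext ω
      simp [step, hc]
    rw [this]
    exact measurable_const
  · let F : Fin K × Prop × Prop → State K := fun x =>
      { start := if x.2.1 ∨ x.2.2 then t + 1 else σ.start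
        good := if x.2.1 then insert x.1 σ.good else σ.good
        bad := if x.2.2 then insert x.1 σ.bad else σ.bad }
    have : step ξ b δ m t σ = F ∘ fun ω : Path K =>
        (arm t ω, 2 * (K : ℝ) / δ ≤ eMinus ξ b σ.start (t + 1) (arm t ω) ω,
          2 * (K : ℝ) / δ < ePlus ξ b σ.start (t + 1) (arm t ω) ω) := by
      funext ω
      simp only [step, hc, if_false, F, Function.comp]
    rw [this]
    exact (Measurable.of_discrete (f := F)).comp
      ((measurable_arm (Nat.lt_succ_self t)).prodMk
        (((@measurableSet_setOfPred _ (past K (t + 1)) _).1 hMs).prodMk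
          ((@measurableSet_setOfPred _ (past K (t + 1)) _).1 hPs)))

theorem measurable_state {K : ℕ} (ξ b δ : ℝ) (m t : ℕ) :
    Measurable[past K t] (state (K := K) ξ b δ m t) := by
  induction t with
  | zero => exact measurable_const
  | succ t ih =>
    exact @measurable_select _ _ _ _ (past K (t + 1)) _ _ _ _
      (ih.mono (past_mono (Nat.le_succ t)) le_rfl) (step ξ b δ m t)
      fun σ _ => measurable_step ξ b δ m t σ

/-- The resetting GAI algorithm with sampling scheme `π`, threshold `ξ`, truncation constant `b`,
error parameter `δ` and number `m` of desired good arms. Between two resets it runs the scheme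
on the unlabelled arms, fed with the rounds since the last reset only. (What is sampled after the
loop has ended has no influence on the labels.) -/
def resetGAI {K : ℕ} (π : Scheme K) (ξ b δ : ℝ) (m : ℕ) : Algorithm K where
  policy :=
    { prob := fun t ω =>
        (π.initialized (state ξ b δ m t ω).unlabeled).prob (t - (state ξ b δ m t ω).start)
          (shift (state ξ b δ m t ω).start ω)
      mem_simplex := fun t ω => (π.initialized _).mem_simplex _ _
      adapted := fun t a => by
        refine @measurable_select _ _ _ _ (past K t) _ _ _ _ (measurable_state ξ b δ m t)
          (fun σ ω => (π.initialized σ.unlabeled).prob (t - σ.start) (shift σ.start ω) a) ?_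
        rintro σ ⟨ω, rfl⟩
        exact ((π.initialized _).adapted _ a).comp
          (measurable_shift (state_start_le ξ b δ m t ω)) }
  good t ω := (state ξ b δ m t ω).good
  bad t ω := (state ξ b δ m t ω).bad
  good_adapted t S := measurable_state ξ b δ m t
    (MeasurableSet.of_discrete (s := {σ : State K | σ.good = S}))
  bad_adapted t S := measurable_state ξ b δ m t
    (MeasurableSet.of_discrete (s := {σ : State K | σ.bad = S}))

/-- The time at which the loop of the resetting algorithm ends. -/
def endTime {K : ℕ} (ξ b δ : ℝ) (m : ℕ) (ω : Path K) : ℝ≥0∞ :=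
  firstTime fun t => (state ξ b δ m t ω).Stopped m

end GAI

end

open MeasureTheory Filter Topology
open scoped ENNReal

noncomputable section

namespace GAI

open ProbabilityTheory

/-! ### Finite histories -/

/-! Lower bounds. Bernoulli rewards give one admissible instance with means `μ`. If the mean of an
arm `a` is moved across `ξ`, the label that was correct for `a` becomes an error, so by
δ-correctness the event that `a` carries this label at the time `τ` of interest has probability at
most `δ` under the new law. Comparing the two likelihoods up to `τ` (`information_bound`,
`label_bound`) gives `P(a correctly labelled) * log (1/δ) - 1 ≤ d(μ a, ξ) * E[pulls of a before τ]`.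
Dividing by the divergence and summing over arms bounds `E[τ]` from below (`sum_label_bound`,
`le_worstCase`). When all arms are labelled, each of these probabilities is at least `1 - 2δ`. When
`i` arms are labelled good, only their sum is controlled, from below by `i * (1 - 2δ)`; a small
linear program, solved by the `i` largest means because `d(·, ξ)` increases above `ξ`, yields the
bound (`le_liminf_goodTime`).

One epoch. Each factor of an e-process is a Bernoulli likelihood ratio of the clipped empirical mean
against `ξ`, interpolated affinely in the reward. The bets therefore follow the leader for the log
loss and have logarithmic regret against any constant in the clipping interval, in particular
against the true mean (`log_betProduct_ge`). While nothing is labelled the e-processes stay below `M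
= 2K/δ`, so the expected number of pulls of the best available arm is at most `log M / d` plus lower
order terms (`sum_alive_arm_le`). The duration has exponential tails beyond a multiple of `log M`
(`exists_tail_bound`), hence the other arms cost only a sum of `c / t` up to `O(log M)`, that is
`O(log log M)` rounds. The same scarcity makes it unlikely that another arm is labelled, since this
takes of the order of `log M` pulls, and Markov's inequality excludes a wrong label for the best arm
(`exists_epoch_bound`, `eventually_epoch_bound`).

Two transfers are needed. The regret constant may depend on the instance; mixing a sequence of bad
instances makes it uniform (`exists_uniform_regret`). And an epoch follows the scheme only until it
ends, so its law is continued to a genuine bandit law (`exists_isBanditLaw_eq_on`,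
`exists_epoch_law`).

Assembly. Almost surely a given pair of label sets starts at most one epoch. Outside an event of
small probability the arms are labelled correctly in decreasing order of their means, so the pairs
that occur are indexed injectively by the best remaining arm `a`, each costing about `log (1/δ) /
d(μ a, ξ)`. The remaining finitely many pairs contribute a vanishing multiple of `log (1/δ)`
(`lintegral_active_le`, `limsup_worstCase_le`). -/

/-- The first `t` rounds. -/
def pre {K : ℕ} (t : ℕ) (ω : Path K) : Fin t → Obs K := fun i => ω i

theorem past_eq_comap (K t : ℕ) :
    past K t = MeasurableSpace.comap (pre (K := K) t) inferInstance := rfl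

theorem measurable_pre {K : ℕ} (t : ℕ) : Measurable (pre (K := K) t) := by
  unfold pre; fun_prop

/-- A path with a prescribed beginning. -/
def extend {K : ℕ} [NeZero K] {t : ℕ} (h : Fin t → Obs K) : Path K :=
  fun n => if hn : n < t then h ⟨n, hn⟩ else (0, 0)

theorem measurable_extend {K : ℕ} [NeZero K] {t : ℕ} : Measurable (extend (K := K) (t := t)) := by
  refine measurable_pi_iff.2 fun n => ?_
  unfold extend
  split_ifs <;> fun_prop

theorem pre_extend {K : ℕ} [NeZero K] {t : ℕ} (h : Fin t → Obs K) : pre t (extend h) = h := by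
  funext i
  simp [pre, extend]

theorem eq_of_pre_eq {K t : ℕ} {Z : Type*} [MeasurableSpace Z] [MeasurableSingletonClass Z]
    {f : Path K → Z} (hf : Measurable[past K t] f) {ω ω' : Path K} (h : pre t ω = pre t ω') :
    f ω = f ω' :=
  Measurable.factorsThrough (f := pre t) hf h

theorem apply_extend_pre {K t : ℕ} [NeZero K] {Z : Type*} [MeasurableSpace Z]
    [MeasurableSingletonClass Z] {f : Path K → Z} (hf : Measurable[past K t] f) (ω : Path K) :
    f (extend (pre t ω)) = f ω :=
  eq_of_pre_eq hf (pre_extend _)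

theorem measurable_pre_coord {K : ℕ} (t : ℕ) :
    Measurable fun ω : Path K => (pre t ω, ω t) :=
  (measurable_pre t).prodMk (measurable_pi_apply t)

/-- Events of the first `t + 1` rounds in terms of the first `t` rounds and the last one. -/
theorem past_succ_eq {K : ℕ} (t : ℕ) :
    past K (t + 1) = MeasurableSpace.comap (fun ω : Path K => (pre t ω, ω t)) inferInstance := by
  apply le_antisymm
  · have h : pre (K := K) (t + 1) =
        (fun p : (Fin t → Obs K) × Obs K => (fun i : Fin (t + 1) =>
          if h : (i : ℕ) < t then p.1 ⟨i, h⟩ else p.2)) ∘ fun ω : Path K => (pre t ω, ω t) := by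
      funext ω i
      by_cases hi : (i : ℕ) < t
      · simp [pre, hi]
      · have : (i : ℕ) = t := by omega
        simp [pre, this]
    rw [past_eq_comap, h, ← MeasurableSpace.comap_comp]
    apply MeasurableSpace.comap_mono
    rw [← measurable_iff_comap_le]
    refine measurable_pi_iff.2 fun i => ?_
    split_ifs <;> fun_prop
  · rw [← measurable_iff_comap_le]
    refine Measurable.prodMk ?_ (measurable_coord (Nat.lt_succ_self t))
    exact (comap_measurable (pre (K := K) t)).mono (past_mono (Nat.le_succ t)) le_rfl

/-! ### Laws of trajectories in terms of events -/

/-- The defining identities of a bandit law, tested on events `B` of the past that are contained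
in the events `V t`. -/
structure IsLawOn {K : ℕ} (V : ℕ → Set (Path K)) (π : Policy K) (μ : Fin K → ℝ)
    (P : Measure (Path K)) : Prop where
  arm_law : ∀ t a B, MeasurableSet[past K t] B → B ⊆ V t →
    P (B ∩ {ω | arm t ω = a}) = ∫⁻ ω in B, ENNReal.ofReal (π.prob t ω a) ∂P
  reward_mean : ∀ t a B, MeasurableSet[past K t] B → B ⊆ V t →
    ∫⁻ ω in B ∩ {ω | arm t ω = a}, ENNReal.ofReal (reward t ω) ∂P =
      ENNReal.ofReal (μ a) * P (B ∩ {ω | arm t ω = a})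

theorem reward_nonneg {K : ℕ} (t : ℕ) (ω : Path K) : 0 ≤ reward t ω := (ω t).2.2.1

theorem reward_le_one {K : ℕ} (t : ℕ) (ω : Path K) : reward t ω ≤ 1 := (ω t).2.2.2

theorem measurable_arm' {K : ℕ} (t : ℕ) : Measurable (arm (K := K) t) :=
  (measurable_arm (Nat.lt_succ_self t)).mono (past_le K _) le_rfl

theorem measurable_reward' {K : ℕ} (t : ℕ) : Measurable (reward (K := K) t) :=
  (measurable_reward (Nat.lt_succ_self t)).mono (past_le K _) le_rfl

theorem measurableSet_arm' {K : ℕ} (t : ℕ) (a : Fin K) :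
    MeasurableSet {ω : Path K | arm t ω = a} :=
  past_le K _ _ (measurableSet_arm (Nat.lt_succ_self t) a)

theorem Policy.prob_nonneg {K : ℕ} (π : Policy K) (t : ℕ) (ω : Path K) (a : Fin K) :
    0 ≤ π.prob t ω a := (π.mem_simplex t ω).1 a

theorem Policy.sum_prob {K : ℕ} (π : Policy K) (t : ℕ) (ω : Path K) :
    ∑ a, π.prob t ω a = 1 := (π.mem_simplex t ω).2

theorem Policy.prob_le_one {K : ℕ} (π : Policy K) (t : ℕ) (ω : Path K) (a : Fin K) :
    π.prob t ω a ≤ 1 := by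
  rw [← π.sum_prob t ω]
  exact Finset.single_le_sum (fun b _ => π.prob_nonneg t ω b) (Finset.mem_univ a)

theorem Policy.measurable_prob {K : ℕ} (π : Policy K) (t : ℕ) (a : Fin K) :
    Measurable fun ω => π.prob t ω a := (π.adapted t a).mono (past_le K t) le_rfl

theorem integrable_reward {K : ℕ} (t : ℕ) (P : Measure (Path K)) [IsFiniteMeasure P] :
    Integrable (reward t) P :=
  Integrable.of_bound (measurable_reward' t).aestronglyMeasurable 1
    (Eventually.of_forall fun ω => by
      rw [Real.norm_of_nonneg (reward_nonneg t ω)]; exact reward_le_one t ω)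

theorem integrable_prob {K : ℕ} (π : Policy K) (t : ℕ) (a : Fin K) (P : Measure (Path K))
    [IsFiniteMeasure P] : Integrable (fun ω => π.prob t ω a) P :=
  Integrable.of_bound (π.measurable_prob t a).aestronglyMeasurable 1
    (Eventually.of_forall fun ω => by
      rw [Real.norm_of_nonneg (π.prob_nonneg t ω a)]; exact π.prob_le_one t ω a)

theorem past_sup_arm_le (K t : ℕ) :
    past K t ⊔ MeasurableSpace.comap (arm t) ⊤ ≤ (inferInstance : MeasurableSpace (Path K)) :=
  sup_le (past_le K t) (measurable_arm' t).comap_le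

theorem measurableSet_sup_arm {K t : ℕ} (a : Fin K) :
    MeasurableSet[past K t ⊔ MeasurableSpace.comap (arm t) ⊤] {ω : Path K | arm t ω = a} :=
  (le_sup_right : _ ≤ past K t ⊔ MeasurableSpace.comap (arm t) ⊤) _ ⟨{a}, trivial, rfl⟩

/-- Once the arm is fixed to be `a`, knowing the arm adds nothing to the past. The sets with this
property form a sigma-algebra containing both generators, so it is enough to build that
sigma-algebra. -/
theorem exists_past_inter_arm {K t : ℕ} {s : Set (Path K)}
    (hs : MeasurableSet[past K t ⊔ MeasurableSpace.comap (arm t) ⊤] s) (a : Fin K) :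
    ∃ B, MeasurableSet[past K t] B ∧ s ∩ {ω | arm t ω = a} = B ∩ {ω | arm t ω = a} := by
  let m : MeasurableSpace (Path K) :=
    { MeasurableSet' := fun s => ∃ B, MeasurableSet[past K t] B ∧
        s ∩ {ω | arm t ω = a} = B ∩ {ω | arm t ω = a}
      measurableSet_empty := ⟨∅, @MeasurableSet.empty _ (past K t), rfl⟩
      measurableSet_compl := by
        rintro s ⟨B, hB, h⟩
        refine ⟨Bᶜ, hB.compl, ?_⟩
        ext ω
        have := Set.ext_iff.1 h ω
        simp only [Set.mem_inter_iff, Set.mem_compl_iff, Set.mem_ofPred_eq] at this ⊢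
        tauto
      measurableSet_iUnion := by
        intro f hf
        choose B hB h using hf
        refine ⟨⋃ i, B i, MeasurableSet.iUnion hB, ?_⟩
        rw [Set.iUnion_inter, Set.iUnion_inter]
        exact Set.iUnion_congr h }
  have hle : past K t ⊔ MeasurableSpace.comap (arm t) ⊤ ≤ m := by
    refine sup_le (fun B hB => ⟨B, hB, rfl⟩) ?_
    rintro _ ⟨D, -, rfl⟩
    by_cases ha : a ∈ D
    · refine ⟨Set.univ, @MeasurableSet.univ _ (past K t), ?_⟩
      ext ω
      simp only [Set.mem_inter_iff, Set.mem_preimage, Set.mem_ofPred_eq, Set.mem_univ, true_and,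
        and_iff_right_iff_imp]
      rintro rfl
      exact ha
    · refine ⟨∅, @MeasurableSet.empty _ (past K t), ?_⟩
      ext ω
      simp only [Set.mem_inter_iff, Set.mem_preimage, Set.mem_ofPred_eq, Set.mem_empty_iff_false,
        false_and, iff_false, not_and]
      rintro h rfl
      exact ha h
  exact hle s hs

/-- Conditional expectations are traded for integrals over past events, a form that survives
conditioning, shifting and mixing and that can be localized to the events `V t`. -/
theorem IsBanditLaw.isLawOn {K : ℕ} {π : Policy K} {μ : Fin K → ℝ} {P : Measure (Path K)}
    (hP : IsBanditLaw π μ P) (hμ : ∀ a, 0 ≤ μ a) (V : ℕ → Set (Path K)) :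
    IsLawOn V π μ P := by
  have := hP.isProbabilityMeasure
  constructor
  · intro t a B hB _
    have hB' := past_le K t _ hB
    have hint : Integrable (Set.indicator {ω : Path K | arm t ω = a} fun _ => (1 : ℝ)) P :=
      (integrable_const _).indicator (measurableSet_arm' t a)
    have h1 := setIntegral_condExp (past_le K t) hint hB
    rw [setIntegral_congr_ae hB' ((hP.arm_law t a).mono fun ω h _ => h),
      setIntegral_indicator (measurableSet_arm' t a)] at h1
    simp only [integral_const, smul_eq_mul, mul_one, measureReal_restrict_apply_univ] at h1
    rw [← ofReal_integral_eq_lintegral_ofReal (integrable_prob π t a P).integrableOn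
      (Eventually.of_forall fun ω => π.prob_nonneg t ω a), h1, ofReal_measureReal]
  · intro t a B hB _
    have hB' := past_le K t _ hB
    have hm : MeasurableSet[past K t ⊔ MeasurableSpace.comap (arm t) ⊤]
        (B ∩ {ω : Path K | arm t ω = a}) :=
      ((le_sup_left : _ ≤ past K t ⊔ MeasurableSpace.comap (arm t) ⊤) _ hB).inter
        (measurableSet_sup_arm a)
    have h1 := setIntegral_condExp (past_sup_arm_le K t) (integrable_reward t P) hm
    have h2 : ∫ ω in B ∩ {ω : Path K | arm t ω = a},
        (P[reward t | past K t ⊔ MeasurableSpace.comap (arm t) ⊤]) ω ∂P =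
        ∫ ω in B ∩ {ω : Path K | arm t ω = a}, μ a ∂P := by
      refine setIntegral_congr_ae (hB'.inter (measurableSet_arm' t a)) ?_
      filter_upwards [hP.reward_mean t] with ω h h'
      rw [h, h'.2]
    rw [← ofReal_integral_eq_lintegral_ofReal (integrable_reward t P).integrableOn
      (Eventually.of_forall fun ω => reward_nonneg t ω), ← h1, h2]
    simp only [integral_const, smul_eq_mul, measureReal_restrict_apply_univ]
    rw [mul_comm, ENNReal.ofReal_mul (hμ a), ofReal_measureReal]

/-- The way back, used to certify constructed measures. An event of the past and the current arm is
split according to the arm; on each piece it coincides with a past event, where the hypothesis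
applies. -/
theorem isBanditLaw_of_isLawOn {K : ℕ} {π : Policy K} {μ : Fin K → ℝ} {P : Measure (Path K)}
    [IsProbabilityMeasure P] (hμ : ∀ a, 0 ≤ μ a) (h : IsLawOn (fun _ => Set.univ) π μ P) :
    IsBanditLaw π μ P := by
  refine ⟨inferInstance, fun t a => ?_, fun t => ?_⟩
  · symm
    refine ae_eq_condExp_of_forall_setIntegral_eq (past_le K t)
      ((integrable_const _).indicator (measurableSet_arm' t a))
      (fun s _ _ => (integrable_prob π t a P).integrableOn) ?_
      (π.adapted t a).aestronglyMeasurable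
    intro B hB _
    rw [setIntegral_indicator (measurableSet_arm' t a)]
    simp only [integral_const, smul_eq_mul, mul_one, measureReal_restrict_apply_univ]
    rw [measureReal_def, h.arm_law t a B hB (Set.subset_univ _),
      ← ofReal_integral_eq_lintegral_ofReal (integrable_prob π t a P).integrableOn
      (Eventually.of_forall fun ω => π.prob_nonneg t ω a), ENNReal.toReal_ofReal]
    exact integral_nonneg fun ω => π.prob_nonneg t ω a
  · symm
    have hbd : ∀ᵐ ω ∂P, ‖μ (arm t ω)‖ ≤ ∑ a, μ a := Eventually.of_forall fun ω => by
      rw [Real.norm_of_nonneg (hμ _)]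
      exact Finset.single_le_sum (fun b _ => hμ b) (Finset.mem_univ _)
    have hmeas : Measurable[past K t ⊔ MeasurableSpace.comap (arm t) ⊤]
        fun ω : Path K => μ (arm t ω) := by
      refine Measurable.comp (g := μ) (measurable_from_top) ?_
      exact (comap_measurable (m := ⊤) (arm (K := K) t)).mono le_sup_right le_rfl
    have hint : Integrable (fun ω => μ (arm t ω)) P :=
      Integrable.of_bound (hmeas.mono (past_sup_arm_le K t) le_rfl).aestronglyMeasurable _ hbd
    refine ae_eq_condExp_of_forall_setIntegral_eq (past_sup_arm_le K t) (integrable_reward t P)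
      (fun s _ _ => hint.integrableOn) ?_ hmeas.aestronglyMeasurable
    intro s hs _
    have hs' := past_sup_arm_le K t _ hs
    have hsplit : s = ⋃ a ∈ (Finset.univ : Finset (Fin K)), s ∩ {ω | arm t ω = a} := by
      ext ω; simp
    have hd : Set.Pairwise (↑(Finset.univ : Finset (Fin K)))
        (Function.onFun Disjoint fun a => s ∩ {ω : Path K | arm t ω = a}) := by
      intro a _ b _ hab
      refine Set.disjoint_left.2 ?_
      rintro ω ⟨-, h1⟩ ⟨-, h2⟩
      exact hab (h1.symm.trans h2)
    rw [hsplit, integral_biUnion_finset _ (fun a _ => hs'.inter (measurableSet_arm' t a)) hd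
      (fun a _ => hint.integrableOn),
      integral_biUnion_finset _ (fun a _ => hs'.inter (measurableSet_arm' t a)) hd
      (fun a _ => (integrable_reward t P).integrableOn)]
    refine Finset.sum_congr rfl fun a _ => ?_
    obtain ⟨B, hB, hBs⟩ := exists_past_inter_arm hs a
    have h1 := h.reward_mean t a B hB (Set.subset_univ _)
    rw [← hBs, ← ofReal_integral_eq_lintegral_ofReal (integrable_reward t P).integrableOn
      (Eventually.of_forall fun ω => reward_nonneg t ω)] at h1
    have h2 := congrArg ENNReal.toReal h1
    rw [ENNReal.toReal_ofReal (integral_nonneg fun ω => reward_nonneg t ω),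
      ENNReal.toReal_mul, ENNReal.toReal_ofReal (hμ a), ← measureReal_def] at h2
    rw [h2, setIntegral_congr_fun (g := fun _ => μ a) (hs'.inter (measurableSet_arm' t a))
      (fun ω h' => by
        have : arm t ω = a := h'.2
        simp only [this])]
    simp [mul_comm]

/-! ### Existence of trajectories with given transition kernels -/

/-- The Ionescu-Tulcea theorem for histories indexed by `Fin t`. -/
theorem exists_trajectory_law {K : ℕ} [NeZero K] (κ : (t : ℕ) → Kernel (Fin t → Obs K) (Obs K))
    [∀ t, IsMarkovKernel (κ t)] :
    ∃ P : Measure (Path K), IsProbabilityMeasure P ∧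
      ∀ t, ∀ F : (Fin t → Obs K) × Obs K → ℝ≥0∞, Measurable F →
        ∫⁻ ω, F (pre t ω, ω t) ∂P = ∫⁻ ω, ∫⁻ x, F (pre t ω, x) ∂(κ t (pre t ω)) ∂P := by
  -- `Kernel.traj` starts from a given coordinate `0`. A dummy observation is put there, round `t`
  -- is stored at coordinate `t + 1`, and the dummy is dropped at the end by `T`.
  let dropFirst : (n : ℕ) → ((i : ↥(Finset.Iic n)) → Obs K) → (Fin n → Obs K) :=
    fun n x i => x ⟨(i : ℕ) + 1, Finset.mem_Iic.2 i.2⟩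
  have hdrop : ∀ n, Measurable (dropFirst n) := fun n =>
    measurable_pi_iff.2 fun i => measurable_pi_apply _
  let κ' : (n : ℕ) → Kernel ((i : ↥(Finset.Iic n)) → Obs K) (Obs K) :=
    fun n => (κ n).comap (dropFirst n) (hdrop n)
  let x₀ : (i : ↥(Finset.Iic 0)) → Obs K := fun _ => (0, 0)
  let T : Path K → Path K := fun ω n => ω (n + 1)
  have hT : Measurable T := measurable_pi_iff.2 fun n => measurable_pi_apply _
  let R : Measure (Path K) := Kernel.traj (X := fun _ => Obs K) κ' 0 x₀
  refine ⟨R.map T, Measure.isProbabilityMeasure_map hT.aemeasurable, fun t F hF => ?_⟩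
  have key := Kernel.partialTraj_compProd_eq_map_traj (X := fun _ => Obs K) (κ := κ')
    (Nat.zero_le t) (x₀ := x₀)
  have hfr : Measurable (Preorder.frestrictLe (π := fun _ => Obs K) t) :=
    Preorder.measurable_frestrictLe t
  have hpre : ∀ ω : Path K, pre t (T ω) =
      dropFirst t (Preorder.frestrictLe (π := fun _ => Obs K) t ω) := fun ω => rfl
  have hG : Measurable fun p : ((i : ↥(Finset.Iic t)) → Obs K) × Obs K =>
      F (dropFirst t p.1, p.2) :=
    hF.comp (((hdrop t).comp measurable_fst).prodMk measurable_snd)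
  have h1 := Measure.lintegral_compProd (μ := Kernel.partialTraj (X := fun _ => Obs K) κ' 0 t x₀)
    (κ := κ' t) (f := fun p => F (dropFirst t p.1, p.2)) hG
  rw [key, lintegral_map hG (hfr.prodMk (measurable_pi_apply _)),
    ← Kernel.traj_map_frestrictLe_apply] at h1
  rw [lintegral_map (f := fun ω => F (pre t ω, ω t)) (hF.comp (measurable_pre_coord t)) hT]
  have hin : Measurable fun h : Fin t → Obs K => ∫⁻ x, F (h, x) ∂(κ t h) :=
    hF.lintegral_kernel_prod_right'
  rw [lintegral_map (f := fun ω => ∫⁻ x, F (pre t ω, x) ∂(κ t (pre t ω)))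
    (hin.comp (measurable_pre t)) hT]
  refine h1.trans ?_
  exact lintegral_map (f := fun y => ∫⁻ x, F (dropFirst t y, x) ∂(κ t (dropFirst t y)))
    (hin.comp (hdrop t)) hfr

/-! ### Bernoulli rewards -/

theorem measurable_prob_extend {K : ℕ} [NeZero K] (π : Policy K) (t : ℕ) (a : Fin K) :
    Measurable fun h : Fin t → Obs K => ENNReal.ofReal (π.prob t (extend h) a) :=
  ((π.measurable_prob t a).comp measurable_extend).ennreal_ofReal

/-- The arm is drawn from the policy, the reward is Bernoulli with mean `μ a`. -/
def bernoulliKernel {K : ℕ} [NeZero K] (π : Policy K) (μ : Fin K → ℝ) (t : ℕ) :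
    Kernel (Fin t → Obs K) (Obs K) where
  toFun h := ∑ a, ENNReal.ofReal (π.prob t (extend h) a) •
    (ENNReal.ofReal (μ a) • Measure.dirac ((a, 1) : Obs K) +
      ENNReal.ofReal (1 - μ a) • Measure.dirac ((a, 0) : Obs K))
  measurable' := by
    refine Measure.measurable_of_measurable_coe _ fun s _ => ?_
    simp only [Measure.coe_finsetSum, Finset.sum_apply, Measure.smul_apply, smul_eq_mul]
    exact Finset.measurable_sum _ fun a _ => (measurable_prob_extend π t a).mul_const _

theorem lintegral_bernoulliKernel {K : ℕ} [NeZero K] (π : Policy K) (μ : Fin K → ℝ) (t : ℕ)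
    (h : Fin t → Obs K) {f : Obs K → ℝ≥0∞} (hf : Measurable f) :
    ∫⁻ x, f x ∂(bernoulliKernel π μ t h) = ∑ a, ENNReal.ofReal (π.prob t (extend h) a) *
      (ENNReal.ofReal (μ a) * f (a, 1) + ENNReal.ofReal (1 - μ a) * f (a, 0)) := by
  show ∫⁻ x, f x ∂(∑ a, ENNReal.ofReal (π.prob t (extend h) a) •
    (ENNReal.ofReal (μ a) • Measure.dirac ((a, 1) : Obs K) +
      ENNReal.ofReal (1 - μ a) • Measure.dirac ((a, 0) : Obs K))) = _
  rw [lintegral_finsetSum_measure]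
  refine Finset.sum_congr rfl fun a _ => ?_
  rw [lintegral_smul_measure, lintegral_add_measure, lintegral_smul_measure,
    lintegral_smul_measure, lintegral_dirac' _ hf, lintegral_dirac' _ hf]
  simp

theorem sum_ofReal_prob {K : ℕ} (π : Policy K) (t : ℕ) (ω : Path K) :
    ∑ a, ENNReal.ofReal (π.prob t ω a) = 1 := by
  rw [← ENNReal.ofReal_sum_of_nonneg fun a _ => π.prob_nonneg t ω a, π.sum_prob,
    ENNReal.ofReal_one]

theorem ofReal_add_ofReal_one_sub {x : ℝ} (hx : x ∈ Set.Icc (0 : ℝ) 1) :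
    ENNReal.ofReal x + ENNReal.ofReal (1 - x) = 1 := by
  rw [← ENNReal.ofReal_add hx.1 (sub_nonneg.2 hx.2)]
  simp

theorem isMarkovKernel_bernoulliKernel {K : ℕ} [NeZero K] (π : Policy K) {μ : Fin K → ℝ}
    (hμ : ∀ a, μ a ∈ Set.Icc (0 : ℝ) 1) (t : ℕ) : IsMarkovKernel (bernoulliKernel π μ t) := by
  refine ⟨fun h => ⟨?_⟩⟩
  rw [← lintegral_one, lintegral_bernoulliKernel π μ t h measurable_const]
  simp only [mul_one, ofReal_add_ofReal_one_sub (hμ _)]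
  exact sum_ofReal_prob π t _

/-- The law with independent Bernoulli rewards, tested on functions. -/
structure IsBernoulliLaw {K : ℕ} (π : Policy K) (μ : Fin K → ℝ) (P : Measure (Path K)) :
    Prop where
  isProbabilityMeasure : IsProbabilityMeasure P
  lintegral_eq : ∀ t, ∀ F : (Fin t → Obs K) × Obs K → ℝ≥0∞, Measurable F →
    ∫⁻ ω, F (pre t ω, ω t) ∂P = ∫⁻ ω, ∑ a, ENNReal.ofReal (π.prob t ω a) *
      (ENNReal.ofReal (μ a) * F (pre t ω, (a, 1)) +
        ENNReal.ofReal (1 - μ a) * F (pre t ω, (a, 0))) ∂P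

theorem exists_isBernoulliLaw {K : ℕ} [NeZero K] (π : Policy K) {μ : Fin K → ℝ}
    (hμ : ∀ a, μ a ∈ Set.Icc (0 : ℝ) 1) : ∃ P, IsBernoulliLaw π μ P := by
  have := isMarkovKernel_bernoulliKernel π hμ
  obtain ⟨P, hP, h⟩ := exists_trajectory_law (bernoulliKernel π μ)
  refine ⟨P, hP, fun t F hF => ?_⟩
  rw [h t F hF]
  refine lintegral_congr fun ω => ?_
  rw [lintegral_bernoulliKernel π μ t _ (f := fun x => F (pre t ω, x)) (hF.comp measurable_prodMk_left)]
  refine Finset.sum_congr rfl fun a _ => ?_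
  rw [apply_extend_pre (π.adapted t a)]

/-! ### Bernoulli laws are bandit laws -/

theorem IsBernoulliLaw.setLIntegral_eq {K : ℕ} {π : Policy K} {μ : Fin K → ℝ}
    {P : Measure (Path K)} (hP : IsBernoulliLaw π μ P) {t : ℕ} {B : Set (Path K)}
    (hB : MeasurableSet[past K t] B) {f : Obs K → ℝ≥0∞} (hf : Measurable f) :
    ∫⁻ ω in B, f (ω t) ∂P = ∫⁻ ω in B, ∑ a, ENNReal.ofReal (π.prob t ω a) *
      (ENNReal.ofReal (μ a) * f (a, 1) + ENNReal.ofReal (1 - μ a) * f (a, 0)) ∂P := by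
  have hB' := past_le K t _ hB
  obtain ⟨D, hD, rfl⟩ := hB
  have h := hP.lintegral_eq t (fun p => D.indicator (fun _ => 1) p.1 * f p.2)
    (((measurable_const.indicator hD).comp measurable_fst).mul (hf.comp measurable_snd))
  rw [← lintegral_indicator hB', ← lintegral_indicator hB']
  refine Eq.trans (lintegral_congr fun ω => ?_) (h.trans (lintegral_congr fun ω => ?_))
  · by_cases hω : pre t ω ∈ D
    · have : ω ∈ (fun (ω : Path K) (i : Fin t) => ω i) ⁻¹' D := hω
      simp [hω, this]
    · have : ω ∉ (fun (ω : Path K) (i : Fin t) => ω i) ⁻¹' D := hω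
      simp [hω, this]
  · by_cases hω : pre t ω ∈ D
    · have : ω ∈ (fun (ω : Path K) (i : Fin t) => ω i) ⁻¹' D := hω
      simp [hω, this]
    · have : ω ∉ (fun (ω : Path K) (i : Fin t) => ω i) ⁻¹' D := hω
      simp [hω, this]

/-- Only the one-step identity on the single event `B` is assumed, so that the lemma also serves
laws that are Bernoulli on part of the path space, as in `exists_isBanditLaw_eq_on`. -/
theorem bernoulli_arm_law {K : ℕ} {π : Policy K} {μ : Fin K → ℝ} {P : Measure (Path K)}
    (hμ : ∀ a, μ a ∈ Set.Icc (0 : ℝ) 1) {t : ℕ} {B : Set (Path K)}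
    (h : ∀ f : Obs K → ℝ≥0∞, Measurable f →
      ∫⁻ ω in B, f (ω t) ∂P = ∫⁻ ω in B, ∑ a, ENNReal.ofReal (π.prob t ω a) *
        (ENNReal.ofReal (μ a) * f (a, 1) + ENNReal.ofReal (1 - μ a) * f (a, 0)) ∂P)
    (a : Fin K) :
    P (B ∩ {ω | arm t ω = a}) = ∫⁻ ω in B, ENNReal.ofReal (π.prob t ω a) ∂P := by
  classical
  have hA : MeasurableSet {x : Obs K | x.1 = a} :=
    measurable_fst (MeasurableSet.of_discrete (s := {a}))
  have h1 := h ({x : Obs K | x.1 = a}.indicator fun _ => 1) (measurable_const.indicator hA)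
  have h2 : (fun ω : Path K => ({x : Obs K | x.1 = a}.indicator fun _ => (1 : ℝ≥0∞)) (ω t)) =
      {ω : Path K | arm t ω = a}.indicator fun _ => 1 := rfl
  rw [h2, lintegral_indicator (measurableSet_arm' t a),
    Measure.restrict_restrict (measurableSet_arm' t a), lintegral_one,
    Measure.restrict_apply_univ, Set.inter_comm] at h1
  rw [h1]
  refine lintegral_congr fun ω => ?_
  rw [Finset.sum_eq_single a]
  · simp [ofReal_add_ofReal_one_sub (hμ a)]
  · intro b _ hb
    simp [hb]
  · simp

theorem bernoulli_reward_mean {K : ℕ} {π : Policy K} {μ : Fin K → ℝ} {P : Measure (Path K)}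
    (hμ : ∀ a, μ a ∈ Set.Icc (0 : ℝ) 1) {t : ℕ} {B : Set (Path K)}
    (h : ∀ f : Obs K → ℝ≥0∞, Measurable f →
      ∫⁻ ω in B, f (ω t) ∂P = ∫⁻ ω in B, ∑ a, ENNReal.ofReal (π.prob t ω a) *
        (ENNReal.ofReal (μ a) * f (a, 1) + ENNReal.ofReal (1 - μ a) * f (a, 0)) ∂P)
    (a : Fin K) :
    ∫⁻ ω in B ∩ {ω | arm t ω = a}, ENNReal.ofReal (reward t ω) ∂P =
      ENNReal.ofReal (μ a) * P (B ∩ {ω | arm t ω = a}) := by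
  classical
  have hA : MeasurableSet {x : Obs K | x.1 = a} :=
    measurable_fst (MeasurableSet.of_discrete (s := {a}))
  have h1 := h ({x : Obs K | x.1 = a}.indicator fun x => ENNReal.ofReal (x.2 : ℝ))
    ((measurable_subtype_coe.comp measurable_snd).ennreal_ofReal.indicator hA)
  have h2 : (fun ω : Path K =>
      ({x : Obs K | x.1 = a}.indicator fun x => ENNReal.ofReal (x.2 : ℝ)) (ω t)) =
      {ω : Path K | arm t ω = a}.indicator fun ω => ENNReal.ofReal (reward t ω) := rfl
  rw [h2, lintegral_indicator (measurableSet_arm' t a),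
    Measure.restrict_restrict (measurableSet_arm' t a), Set.inter_comm] at h1
  rw [h1, bernoulli_arm_law hμ h a,
    ← lintegral_const_mul _ (π.measurable_prob t a).ennreal_ofReal]
  refine lintegral_congr fun ω => ?_
  rw [Finset.sum_eq_single a]
  · simp [mul_comm]
  · intro b _ hb
    simp [hb]
  · simp

theorem IsBernoulliLaw.isBanditLaw {K : ℕ} {π : Policy K} {μ : Fin K → ℝ}
    {P : Measure (Path K)} (hP : IsBernoulliLaw π μ P) (hμ : ∀ a, μ a ∈ Set.Icc (0 : ℝ) 1) :
    IsBanditLaw π μ P :=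
  have := hP.isProbabilityMeasure
  isBanditLaw_of_isLawOn (fun a => (hμ a).1)
    ⟨fun _ a _ hB _ => bernoulli_arm_law hμ (fun _ hf => hP.setLIntegral_eq hB hf) a,
      fun _ a _ hB _ => bernoulli_reward_mean hμ (fun _ hf => hP.setLIntegral_eq hB hf) a⟩

/-! ### Martingale differences -/

/-- The only fact about rewards used by the concentration and e-process estimates: the centered
reward is orthogonal to bounded functions of the past and the current arm, since such functions may
be pulled out of the conditional expectation. -/
theorem IsBanditLaw.integral_mul_reward_sub {K : ℕ} {π : Policy K} {μ : Fin K → ℝ}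
    {P : Measure (Path K)} (hP : IsBanditLaw π μ P) {t : ℕ} {f : Path K → ℝ}
    (hf : Measurable[past K t ⊔ MeasurableSpace.comap (arm t) ⊤] f) {M : ℝ}
    (hM : ∀ ω, |f ω| ≤ M) :
    ∫ ω, f ω * (reward t ω - μ (arm t ω)) ∂P = 0 := by
  have := hP.isProbabilityMeasure
  have hle := past_sup_arm_le K t
  have hf' : Measurable f := hf.mono hle le_rfl
  have hfr : Integrable (f * reward t) P :=
    (integrable_reward t P).bdd_mul hf'.aestronglyMeasurable (Eventually.of_forall hM)
  have h1 : P[f * reward t | past K t ⊔ MeasurableSpace.comap (arm t) ⊤] =ᵐ[P]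
      fun ω => f ω * μ (arm t ω) := by
    filter_upwards [condExp_mul_of_stronglyMeasurable_left hf.stronglyMeasurable hfr
      (integrable_reward t P), hP.reward_mean t] with ω h h'
    rw [h, Pi.mul_apply, h']
  have h2 := integral_condExp (μ := P) (f := f * reward t) hle
  have hint2 : Integrable (fun ω => f ω * μ (arm t ω)) P :=
    (integrable_congr h1).1 integrable_condExp
  simp only [mul_sub]
  rw [integral_sub (f := fun ω => f ω * reward t ω) hfr hint2, ← integral_congr_ae h1, h2]
  simp

theorem measurable_sup_left {K t : ℕ} {Z : Type*} [MeasurableSpace Z] {f : Path K → Z}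
    (hf : Measurable[past K t] f) :
    Measurable[past K t ⊔ MeasurableSpace.comap (arm t) ⊤] f :=
  hf.mono le_sup_left le_rfl

/-! ### Change of measure -/

/-- The likelihood ratio of one round when the mean of the arm `a` is changed from `x` to `y`
(interpolated affinely between the rewards `0` and `1`). -/
def ratio {K : ℕ} (a : Fin K) (x y : ℝ) (o : Obs K) : ℝ :=
  if o.1 = a then (o.2 : ℝ) * (y / x) + (1 - (o.2 : ℝ)) * ((1 - y) / (1 - x)) else 1

/-- The likelihood ratio of the first `t` rounds. -/
def likelihood {K : ℕ} (a : Fin K) (x y : ℝ) (t : ℕ) (h : Fin t → Obs K) : ℝ :=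
  ∏ i, ratio a x y (h i)

/-- The likelihood ratio of the rounds before `n` that happen within the events `V`. -/
def stoppedLikelihood {K : ℕ} (a : Fin K) (x y : ℝ) (V : ℕ → Set (Path K)) (n : ℕ)
    (ω : Path K) : ℝ :=
  ∏ i ∈ Finset.range n, ((V i).indicator (fun ω => ratio a x y (ω i)) ω +
    (V i)ᶜ.indicator (fun _ => 1) ω)

theorem measurable_ratio {K : ℕ} (a : Fin K) (x y : ℝ) : Measurable (ratio a x y) := by
  unfold ratio
  refine Measurable.ite (measurable_fst (MeasurableSet.of_discrete (s := {a}))) ?_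
    measurable_const
  exact ((measurable_subtype_coe.comp measurable_snd).mul_const _).add
    (((measurable_subtype_coe.comp measurable_snd).const_sub 1).mul_const _)

theorem measurable_likelihood {K : ℕ} (a : Fin K) (x y : ℝ) (t : ℕ) :
    Measurable (likelihood a x y t) := by
  unfold likelihood
  exact Finset.measurable_prod _ fun i _ => (measurable_ratio a x y).comp (measurable_pi_apply i)

theorem ratio_pos {K : ℕ} (a : Fin K) {x y : ℝ} (hx : x ∈ Set.Ioo (0 : ℝ) 1)
    (hy : y ∈ Set.Ioo (0 : ℝ) 1) (o : Obs K) : 0 < ratio a x y o := by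
  unfold ratio
  split_ifs
  · have h1 : 0 < y / x := div_pos hy.1 hx.1
    have h2 : 0 < (1 - y) / (1 - x) := div_pos (sub_pos.2 hy.2) (sub_pos.2 hx.2)
    have h3 : (0 : ℝ) ≤ o.2 := o.2.2.1
    have h4 : (o.2 : ℝ) ≤ 1 := o.2.2.2
    rcases h3.eq_or_lt with h | h
    · rw [← h]; simpa using h2
    · exact add_pos_of_pos_of_nonneg (mul_pos h h1) (mul_nonneg (sub_nonneg.2 h4) h2.le)
  · exact one_pos

theorem ratio_le {K : ℕ} (a : Fin K) {x y : ℝ} (hx : x ∈ Set.Ioo (0 : ℝ) 1)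
    (hy : y ∈ Set.Ioo (0 : ℝ) 1) (o : Obs K) :
    ratio a x y o ≤ 1 + y / x + (1 - y) / (1 - x) := by
  have h1 : 0 < y / x := div_pos hy.1 hx.1
  have h2 : 0 < (1 - y) / (1 - x) := div_pos (sub_pos.2 hy.2) (sub_pos.2 hx.2)
  have h3 : (0 : ℝ) ≤ o.2 := o.2.2.1
  have h4 : (o.2 : ℝ) ≤ 1 := o.2.2.2
  unfold ratio
  split_ifs
  · nlinarith [mul_le_mul_of_nonneg_right h4 h1.le, mul_nonneg h3 h2.le]
  · linarith

/-- One step of the change of measure. -/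
theorem sum_ratio_eq {K : ℕ} [DecidableEq (Fin K)] (p : Fin K → ℝ≥0∞) (μ : Fin K → ℝ)
    (hμ : ∀ a, μ a ∈ Set.Ioo (0 : ℝ) 1) (a : Fin K) {y : ℝ}
    (f : Obs K → ℝ≥0∞) :
    ∑ b, p b * (ENNReal.ofReal (μ b) * (f (b, 1) * ENNReal.ofReal (ratio a (μ a) y (b, 1))) +
      ENNReal.ofReal (1 - μ b) * (f (b, 0) * ENNReal.ofReal (ratio a (μ a) y (b, 0)))) =
    ∑ b, p b * (ENNReal.ofReal (Function.update μ a y b) * f (b, 1) +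
      ENNReal.ofReal (1 - Function.update μ a y b) * f (b, 0)) := by
  refine Finset.sum_congr rfl fun b _ => ?_
  by_cases hb : b = a
  · subst hb
    have h1 : ENNReal.ofReal y = ENNReal.ofReal (μ b) * ENNReal.ofReal (y / μ b) := by
      rw [← ENNReal.ofReal_mul (hμ b).1.le, mul_div_cancel₀ _ (hμ b).1.ne']
    have h2 : ENNReal.ofReal (1 - y) =
        ENNReal.ofReal (1 - μ b) * ENNReal.ofReal ((1 - y) / (1 - μ b)) := by
      rw [← ENNReal.ofReal_mul (sub_pos.2 (hμ b).2).le,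
        mul_div_cancel₀ _ (sub_pos.2 (hμ b).2).ne']
    simp only [ratio, Function.update_self, h1, h2, if_true]
    simp only [Set.Icc.coe_one, Set.Icc.coe_zero, one_mul, sub_self, zero_mul, add_zero,
      sub_zero, zero_add]
    ring
  · simp [ratio, hb]

/-- The change of measure on the first `n` rounds. -/
theorem lintegral_changeOfMeasure {K : ℕ} {π : Policy K} {μ : Fin K → ℝ}
    (hμ : ∀ a, μ a ∈ Set.Ioo (0 : ℝ) 1) (a : Fin K) {y : ℝ} (hy : y ∈ Set.Ioo (0 : ℝ) 1)
    {P P' : Measure (Path K)} (hP : IsBernoulliLaw π μ P)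
    (hP' : IsBernoulliLaw π (Function.update μ a y) P') (n : ℕ) (F : (Fin n → Obs K) → ℝ≥0∞)
    (hF : Measurable F) :
    ∫⁻ ω, F (pre n ω) ∂P' =
      ∫⁻ ω, F (pre n ω) * ENNReal.ofReal (likelihood a (μ a) y n (pre n ω)) ∂P := by
  have := hP.isProbabilityMeasure
  have := hP'.isProbabilityMeasure
  induction n with
  | zero =>
    have h : ∀ ω : Path K, pre 0 ω = Fin.elim0 := fun ω => funext fun i => i.elim0
    simp only [h, likelihood, Finset.univ_eq_empty, Finset.prod_empty, ENNReal.ofReal_one, mul_one]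
    simp
  | succ n ih =>
    have hsnoc : ∀ ω : Path K, pre (n + 1) ω = Fin.snoc (pre n ω) (ω n) := by
      intro ω
      funext i
      refine Fin.lastCases ?_ (fun j => ?_) i
      · simp [pre]
      · simp [pre]
    have hsm : Measurable fun p : (Fin n → Obs K) × Obs K =>
        (Fin.snoc p.1 p.2 : Fin (n + 1) → Obs K) := by
      refine measurable_pi_iff.2 fun i => ?_
      refine Fin.lastCases ?_ (fun j => ?_) i
      · simp only [Fin.snoc_last]; exact measurable_snd
      · simp only [Fin.snoc_castSucc]; exact (measurable_pi_apply j).comp measurable_fst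
    have hlik : ∀ ω : Path K, likelihood a (μ a) y (n + 1) (pre (n + 1) ω) =
        likelihood a (μ a) y n (pre n ω) * ratio a (μ a) y (ω n) := by
      intro ω
      simp only [likelihood, Fin.prod_univ_castSucc]
      rfl
    have hpos : ∀ h, 0 ≤ likelihood a (μ a) y n h := fun h =>
      Finset.prod_nonneg fun i _ => (ratio_pos a (hμ a) hy _).le
    have hFm : Measurable fun p : (Fin n → Obs K) × Obs K => F (Fin.snoc p.1 p.2) := hF.comp hsm
    have e1 := hP'.lintegral_eq n _ hFm
    simp only [← hsnoc] at e1
    rw [e1]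
    have hR : Measurable fun p : (Fin n → Obs K) × Obs K => F (Fin.snoc p.1 p.2) *
        ENNReal.ofReal (likelihood a (μ a) y n p.1 * ratio a (μ a) y p.2) :=
      hFm.mul (((measurable_likelihood a (μ a) y n).comp measurable_fst).mul
        ((measurable_ratio a (μ a) y).comp measurable_snd)).ennreal_ofReal
    have e2 := hP.lintegral_eq n _ hR
    simp only [← hsnoc, ← hlik] at e2
    rw [e2]
    have : NeZero K := ⟨fun h => by subst h; exact a.elim0⟩
    -- The induction hypothesis is applied to the expectation of `F` over the last round under the
    -- changed means, which is a function of the first `n` rounds; `sum_ratio_eq` then converts that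
    -- last round back to the original means.
    have e3 := ih (fun h => ∑ b, ENNReal.ofReal (π.prob n (extend h) b) *
      (ENNReal.ofReal (Function.update μ a y b) * F (Fin.snoc h (b, 1)) +
        ENNReal.ofReal (1 - Function.update μ a y b) * F (Fin.snoc h (b, 0)))) (by
      refine Finset.measurable_sum _ fun b _ => (measurable_prob_extend π n b).mul ?_
      exact ((hFm.comp measurable_prodMk_right).const_mul _).add
        ((hFm.comp measurable_prodMk_right).const_mul _))
    have hpe : ∀ ω b, π.prob n (extend (pre n ω)) b = π.prob n ω b := fun ω b =>
      apply_extend_pre (π.adapted n b) ω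
    simp only [hpe] at e3
    rw [e3]
    refine lintegral_congr fun ω => ?_
    rw [← sum_ratio_eq _ μ hμ a (fun o => F (Fin.snoc (pre n ω) o)), Finset.sum_mul]
    refine Finset.sum_congr rfl fun b _ => ?_
    rw [ENNReal.ofReal_mul (hpos _), ENNReal.ofReal_mul (hpos _)]
    ring

theorem stoppedLikelihood_succ {K : ℕ} (a : Fin K) (x y : ℝ) (V : ℕ → Set (Path K)) (n : ℕ)
    (ω : Path K) : stoppedLikelihood a x y V (n + 1) ω = stoppedLikelihood a x y V n ω *
      ((V n).indicator (fun ω => ratio a x y (ω n)) ω + (V n)ᶜ.indicator (fun _ => 1) ω) := by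
  rw [stoppedLikelihood, Finset.prod_range_succ, stoppedLikelihood]

/-- The change of measure up to a stopping time. -/
theorem apply_eq_setLIntegral_stoppedLikelihood {K : ℕ} {π : Policy K} {μ : Fin K → ℝ}
    (hμ : ∀ a, μ a ∈ Set.Ioo (0 : ℝ) 1) (a : Fin K) {y : ℝ} (hy : y ∈ Set.Ioo (0 : ℝ) 1)
    {P P' : Measure (Path K)} (hP : IsBernoulliLaw π μ P)
    (hP' : IsBernoulliLaw π (Function.update μ a y) P') {V : ℕ → Set (Path K)}
    (hV : ∀ t, MeasurableSet[past K t] (V t)) (hVanti : Antitone V) (n : ℕ) (E : Set (Path K))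
    (hE : MeasurableSet[past K n] E) (hEV : ∀ k < n, MeasurableSet[past K k] (E ∩ (V k)ᶜ)) :
    P' E = ∫⁻ ω in E, ENNReal.ofReal (stoppedLikelihood a (μ a) y V n ω) ∂P := by
  induction n generalizing E with
  | zero =>
    have := hP.isProbabilityMeasure
    have := hP'.isProbabilityMeasure
    obtain ⟨D, hD, rfl⟩ := hE
    have h : ∀ ω : Path K, (fun i : Fin 0 => ω i) = Fin.elim0 := fun ω => funext fun i => i.elim0
    by_cases hD0 : Fin.elim0 ∈ D
    · have : (fun (ω : Path K) (i : Fin 0) => ω i) ⁻¹' D = Set.univ := by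
        ext ω; simp [h, hD0]
      rw [this]
      simp [stoppedLikelihood]
    · have : (fun (ω : Path K) (i : Fin 0) => ω i) ⁻¹' D = ∅ := by
        ext ω; simp [h, hD0]
      rw [this]
      simp
  | succ n ih =>
    have hE2 : MeasurableSet[past K n] (E ∩ (V n)ᶜ) := hEV n (Nat.lt_succ_self n)
    have hVn : MeasurableSet (V n) := past_le K n _ (hV n)
    have hE' : MeasurableSet E := past_le K _ _ hE
    rw [← measure_inter_add_sdiff E hVn, ← lintegral_inter_add_sdiff _ E hVn]
    congr 1
    -- On `V n` all earlier `V i` hold by antitonicity, so the stopped likelihood is the full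
    -- likelihood of `n + 1` rounds.
    · have hEn : MeasurableSet[past K (n + 1)] (E ∩ V n) :=
        hE.inter (past_mono (Nat.le_succ n) _ (hV n))
      have hEn' := past_le K _ _ hEn
      obtain ⟨D, hD, hDE⟩ := hEn
      have hDE' : ∀ ω, D.indicator (fun _ => (1 : ℝ≥0∞)) (pre (n + 1) ω) =
          (E ∩ V n).indicator (fun _ => 1) ω := by
        intro ω
        rw [← hDE]
        rfl
      have h1 := lintegral_changeOfMeasure hμ a hy hP hP' (n + 1) (D.indicator fun _ => 1)
        (measurable_const.indicator hD)
      simp only [hDE'] at h1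
      rw [lintegral_indicator hEn', lintegral_one, Measure.restrict_apply_univ] at h1
      rw [h1, ← lintegral_indicator hEn']
      refine lintegral_congr fun ω => ?_
      by_cases hω : ω ∈ E ∩ V n
      · rw [Set.indicator_of_mem hω, Set.indicator_of_mem hω, one_mul]
        congr 1
        rw [likelihood, stoppedLikelihood,
          Finset.prod_range fun i => (V i).indicator (fun ω => ratio a (μ a) y (ω i)) ω +
            (V i)ᶜ.indicator (fun _ => 1) ω]
        refine Finset.prod_congr rfl fun i _ => ?_
        have hi : ω ∈ V i := hVanti (Nat.lt_succ_iff.1 i.2) hω.2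
        simp [hi, pre]
      · rw [Set.indicator_of_notMem hω, Set.indicator_of_notMem hω, zero_mul]
    -- Off `V n` the last factor is `1`, and the event is already decided after `n` rounds, so the
    -- induction hypothesis applies to it.
    · rw [Set.sdiff_eq, ih _ hE2]
      · refine setLIntegral_congr_fun (hE'.inter hVn.compl) fun ω hω => ?_
        have hω' : ω ∉ V n := hω.2
        simp [stoppedLikelihood_succ, hω']
      · intro k hk
        have : E ∩ (V n)ᶜ ∩ (V k)ᶜ = E ∩ (V k)ᶜ := by
          ext ω
          simp only [Set.mem_inter_iff, Set.mem_compl_iff]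
          exact ⟨fun h => ⟨h.1.1, h.2⟩, fun h => ⟨⟨h.1, fun h' => h.2 (hVanti hk.le h')⟩, h.2⟩⟩
        rw [this]
        exact hEV k (hk.trans (Nat.lt_succ_self n))

/-- The divergence `d(x, y)` between Bernoulli distributions. -/
theorem bernKL_eq {x y : ℝ} (hx : x ∈ Set.Ioo (0 : ℝ) 1) (hy : y ∈ Set.Ioo (0 : ℝ) 1) :
    bernKL x y = x * Real.log (x / y) + (1 - x) * Real.log ((1 - x) / (1 - y)) := by
  have h1 := sub_pos.2 hx.2
  have h2 := sub_pos.2 hy.2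
  have : x * (1 - y) / (y * (1 - x)) = (x / y) / ((1 - x) / (1 - y)) := by
    field_simp [hx.1.ne', hy.1.ne', h1.ne', h2.ne']
  rw [bernKL, this, Real.log_div (div_pos hx.1 hy.1).ne' (div_pos h1 h2).ne']
  ring

/-- Concavity of the logarithm along the affine interpolation. The right side is affine in the
reward, so its expectation depends only on the mean and equals the divergence when that mean is `x`.
-/
theorem neg_log_ratio_le {K : ℕ} (a : Fin K) {x y : ℝ} (hx : x ∈ Set.Ioo (0 : ℝ) 1)
    (hy : y ∈ Set.Ioo (0 : ℝ) 1) (o : Obs K) (ho : o.1 = a) :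
    -Real.log (ratio a x y o) ≤
      o.2 * Real.log (x / y) + (1 - (o.2 : ℝ)) * Real.log ((1 - x) / (1 - y)) := by
  have h1 := sub_pos.2 hx.2
  have h2 := sub_pos.2 hy.2
  have hc := strictConcaveOn_log_Ioi.concaveOn.2
    (show y / x ∈ Set.Ioi (0 : ℝ) from div_pos hy.1 hx.1)
    (show (1 - y) / (1 - x) ∈ Set.Ioi (0 : ℝ) from div_pos h2 h1)
    (show (0 : ℝ) ≤ o.2 from o.2.2.1) (sub_nonneg.2 o.2.2.2) (by ring)
  simp only [smul_eq_mul] at hc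
  rw [ratio, if_pos ho, ← inv_div y x, ← inv_div (1 - y), Real.log_inv, Real.log_inv]
  linarith

theorem setIntegral_reward {K : ℕ} {π : Policy K} {μ : Fin K → ℝ} {P : Measure (Path K)}
    (hP : IsBanditLaw π μ P) {t : ℕ} (a : Fin K) {B : Set (Path K)}
    (hB : MeasurableSet[past K t] B) :
    ∫ ω in B ∩ {ω | arm t ω = a}, reward t ω ∂P = μ a * P.real (B ∩ {ω | arm t ω = a}) := by
  have := hP.isProbabilityMeasure
  have hBm := (past_le K t _ hB).inter (measurableSet_arm' t a)
  have hB2 : MeasurableSet[past K t ⊔ MeasurableSpace.comap (arm t) ⊤]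
      (B ∩ {ω : Path K | arm t ω = a}) :=
    ((le_sup_left : _ ≤ past K t ⊔ MeasurableSpace.comap (arm t) ⊤) _ hB).inter
      (measurableSet_sup_arm a)
  have h := hP.integral_mul_reward_sub (t := t)
    (f := (B ∩ {ω | arm t ω = a}).indicator fun _ => 1)
    ((@measurable_const _ _ _ (past K t ⊔ MeasurableSpace.comap (arm t) ⊤) _).indicator hB2)
    (M := 1) (fun ω => by
      by_cases hω : ω ∈ B ∩ {ω | arm t ω = a} <;> simp [hω])
  have h2 : ∫ ω in B ∩ {ω | arm t ω = a}, (reward t ω - μ a) ∂P = 0 := by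
    rw [← h, ← integral_indicator hBm]
    congr 1
    funext ω
    by_cases hω : ω ∈ B ∩ {ω | arm t ω = a}
    · have : arm t ω = a := hω.2
      simp [hω, this]
    · simp [hω]
  rw [integral_sub (integrable_reward t P).integrableOn (integrable_const _), sub_eq_zero] at h2
  rw [h2]
  simp [mul_comm]

/-! ### The Bernoulli divergence -/

/-- Gibbs' inequality, from `log t ≤ t - 1` at the two likelihood ratios: the linear terms cancel.
-/
theorem gibbs_nonneg {x y : ℝ} (hx : x ∈ Set.Ioo (0 : ℝ) 1) (hy : y ∈ Set.Ioo (0 : ℝ) 1) :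
    0 ≤ x * Real.log (x / y) + (1 - x) * Real.log ((1 - x) / (1 - y)) := by
  have h1 := sub_pos.2 hx.2
  have h2 := sub_pos.2 hy.2
  have e1 := Real.log_le_sub_one_of_pos (div_pos hy.1 hx.1)
  have e2 := Real.log_le_sub_one_of_pos (div_pos h2 h1)
  rw [← inv_div y x, ← inv_div (1 - y), Real.log_inv, Real.log_inv]
  have e3 := mul_le_mul_of_nonneg_left e1 hx.1.le
  have e4 := mul_le_mul_of_nonneg_left e2 h1.le
  have e5 : x * (y / x - 1) = y - x := by field_simp [hx.1.ne']
  have e6 : (1 - x) * ((1 - y) / (1 - x) - 1) = x - y := by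
    field_simp [h1.ne']
    ring
  linarith

theorem bernKL_pos {x y : ℝ} (hx : x ∈ Set.Ioo (0 : ℝ) 1) (hy : y ∈ Set.Ioo (0 : ℝ) 1)
    (hxy : x ≠ y) : 0 < bernKL x y := by
  rw [bernKL_eq hx hy]
  have h1 := sub_pos.2 hx.2
  have h2 := sub_pos.2 hy.2
  have hne : y / x ≠ 1 := fun h => hxy ((div_eq_one_iff_eq hx.1.ne').1 h).symm
  have e1 := Real.log_lt_sub_one_of_pos (div_pos hy.1 hx.1) hne
  have e2 := Real.log_le_sub_one_of_pos (div_pos h2 h1)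
  rw [← inv_div y x, ← inv_div (1 - y), Real.log_inv, Real.log_inv]
  have e3 := mul_lt_mul_of_pos_left e1 hx.1
  have e4 := mul_le_mul_of_nonneg_left e2 h1.le
  have e5 : x * (y / x - 1) = y - x := by field_simp [hx.1.ne']
  have e6 : (1 - x) * ((1 - y) / (1 - x) - 1) = x - y := by
    field_simp [h1.ne']
    ring
  linarith

/-- The difference of the two divergences is `d(x', x)` plus `x' - x` times `log (x / y) - log ((1 -
x) / (1 - y))`; the first is nonnegative by Gibbs, the second because `y ≤ x`. -/
theorem bernKL_mono {x x' y : ℝ} (hx : x ∈ Set.Ioo (0 : ℝ) 1) (hx' : x' ∈ Set.Ioo (0 : ℝ) 1)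
    (hy : y ∈ Set.Ioo (0 : ℝ) 1) (hyx : y ≤ x) (hxx : x ≤ x') : bernKL x y ≤ bernKL x' y := by
  rw [bernKL_eq hx hy, bernKL_eq hx' hy]
  have g := gibbs_nonneg hx' hx
  have h1 := sub_pos.2 hx.2
  have h2 := sub_pos.2 hy.2
  have h3 := sub_pos.2 hx'.2
  rw [Real.log_div hx.1.ne' hy.1.ne', Real.log_div h1.ne' h2.ne',
    Real.log_div hx'.1.ne' hy.1.ne', Real.log_div h3.ne' h2.ne']
  rw [Real.log_div hx'.1.ne' hx.1.ne', Real.log_div h3.ne' h1.ne'] at g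
  have l1 := Real.log_le_log hy.1 hyx
  have l2 := Real.log_le_log h1 (by linarith : 1 - x ≤ 1 - y)
  nlinarith [mul_nonneg (sub_nonneg.2 hxx) (sub_nonneg.2 l1),
    mul_nonneg (sub_nonneg.2 hxx) (sub_nonneg.2 l2)]

theorem continuousAt_bernKL {x y : ℝ} (hx : x ∈ Set.Ioo (0 : ℝ) 1)
    (hy : y ∈ Set.Ioo (0 : ℝ) 1) : ContinuousAt (fun z => bernKL x z) y := by
  have h1 := sub_pos.2 hx.2
  have h2 := sub_pos.2 hy.2
  unfold bernKL
  have c1 : ContinuousAt (fun z : ℝ => (1 - x) / (1 - z)) y :=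
    ContinuousAt.div (by fun_prop) (by fun_prop) h2.ne'
  have c2 : ContinuousAt (fun z : ℝ => x * (1 - z) / (z * (1 - x))) y :=
    ContinuousAt.div (by fun_prop) (by fun_prop) (mul_pos hy.1 h1).ne'
  exact (c1.log (div_pos h1 h2).ne').add
    ((c2.log (div_pos (mul_pos hx.1 h2) (mul_pos hy.1 h1)).ne').const_mul x)

/-! ### The information bound -/

theorem stoppedLikelihood_pos {K : ℕ} (a : Fin K) {x y : ℝ} (hx : x ∈ Set.Ioo (0 : ℝ) 1)
    (hy : y ∈ Set.Ioo (0 : ℝ) 1) (V : ℕ → Set (Path K)) (n : ℕ) (ω : Path K) :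
    0 < stoppedLikelihood a x y V n ω := by
  refine Finset.prod_pos fun i _ => ?_
  by_cases h : ω ∈ V i
  · simp [h, ratio_pos a hx hy]
  · simp [h]

theorem stoppedLikelihood_le {K : ℕ} (a : Fin K) {x y : ℝ} (hx : x ∈ Set.Ioo (0 : ℝ) 1)
    (hy : y ∈ Set.Ioo (0 : ℝ) 1) (V : ℕ → Set (Path K)) (n : ℕ) (ω : Path K) :
    stoppedLikelihood a x y V n ω ≤ (1 + y / x + (1 - y) / (1 - x)) ^ n := by
  have h1 : 0 < y / x := div_pos hy.1 hx.1
  have h2 : 0 < (1 - y) / (1 - x) := div_pos (sub_pos.2 hy.2) (sub_pos.2 hx.2)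
  rw [stoppedLikelihood, ← Finset.card_range n, ← Finset.prod_const, Finset.card_range]
  refine Finset.prod_le_prod (fun i _ => ?_) fun i _ => ?_
  · by_cases h : ω ∈ V i
    · simp [h, (ratio_pos a hx hy _).le]
    · simp [h]
  · by_cases h : ω ∈ V i
    · simp [h, ratio_le a hx hy]
    · simp [h]; linarith

theorem measurable_stoppedLikelihood {K : ℕ} (a : Fin K) (x y : ℝ) {V : ℕ → Set (Path K)}
    (hV : ∀ t, MeasurableSet[past K t] (V t)) (n : ℕ) :
    Measurable (stoppedLikelihood a x y V n) := by
  unfold stoppedLikelihood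
  refine Finset.measurable_prod _ fun i _ => ?_
  have hVi := past_le K i _ (hV i)
  exact (((measurable_ratio a x y).comp (measurable_pi_apply i)).indicator hVi).add
    (measurable_const.indicator hVi.compl)

theorem neg_log_stoppedLikelihood_le {K : ℕ} (a : Fin K) {x y : ℝ}
    (hx : x ∈ Set.Ioo (0 : ℝ) 1) (hy : y ∈ Set.Ioo (0 : ℝ) 1) (V : ℕ → Set (Path K)) (n : ℕ)
    (ω : Path K) :
    -Real.log (stoppedLikelihood a x y V n ω) ≤ ∑ i ∈ Finset.range n,
      (V i ∩ {ω | arm i ω = a}).indicator (fun ω => reward i ω * Real.log (x / y) +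
        (1 - reward i ω) * Real.log ((1 - x) / (1 - y))) ω := by
  rw [stoppedLikelihood, Real.log_prod, ← Finset.sum_neg_distrib]
  · refine Finset.sum_le_sum fun i _ => ?_
    by_cases h : ω ∈ V i
    · by_cases ha : arm i ω = a
      · have := neg_log_ratio_le a hx hy (ω i) ha
        simpa [h, ha, reward] using this
      · have ha' : (ω i).1 ≠ a := ha
        simp [h, ha, ratio, ha']
    · simp [h]
  · intro i _
    by_cases h : ω ∈ V i
    · simp [h, (ratio_pos a hx hy _).ne']
    · simp [h]

/-- The transportation inequality behind both lower bounds, without a general data-processing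
inequality. With `L` the likelihood ratio stopped at exit from `V`, the expectation of `-log L` is
at most the divergence times the expected pulls of `a` within `V`. Below, `log t ≤ t - 1` is used
with `t = L / δ` on `E` and with `t = L` off `E`; integration then only needs `∫_E L = P' E ≤ δ` and
`∫ L = 1`. -/
theorem information_bound {K : ℕ} [NeZero K] {π : Policy K} {μ : Fin K → ℝ}
    (hμ : ∀ a, μ a ∈ Set.Ioo (0 : ℝ) 1) (a : Fin K) {y : ℝ} (hy : y ∈ Set.Ioo (0 : ℝ) 1)
    {P : Measure (Path K)} (hP : IsBernoulliLaw π μ P) {V : ℕ → Set (Path K)}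
    (hV : ∀ t, MeasurableSet[past K t] (V t)) (hVanti : Antitone V) (n : ℕ) (E : Set (Path K))
    (hE : MeasurableSet[past K n] E) (hEV : ∀ k < n, MeasurableSet[past K k] (E ∩ (V k)ᶜ))
    {δ : ℝ} (hδ : 0 < δ)
    (hEδ : ∀ P', IsBernoulliLaw π (Function.update μ a y) P' → P' E ≤ ENNReal.ofReal δ) :
    P.real E * Real.log (1 / δ) - 1 ≤
      bernKL (μ a) y * ∑ i ∈ Finset.range n, P.real (V i ∩ {ω | arm i ω = a}) := by
  have hμI : ∀ a, μ a ∈ Set.Icc (0 : ℝ) 1 := fun a => Set.Ioo_subset_Icc_self (hμ a)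
  have hupd : ∀ b, Function.update μ a y b ∈ Set.Icc (0 : ℝ) 1 := by
    intro b
    by_cases hb : b = a
    · subst hb; simpa using Set.Ioo_subset_Icc_self hy
    · simpa [hb] using hμI b
  obtain ⟨P', hP'⟩ := exists_isBernoulliLaw π hupd
  have := hP.isProbabilityMeasure
  have := hP'.isProbabilityMeasure
  have hEm := past_le K n _ hE
  set L := stoppedLikelihood a (μ a) y V n with hL
  have hLpos : ∀ ω, 0 < L ω := stoppedLikelihood_pos a (hμ a) hy V n
  have hLint : Integrable L P :=
    Integrable.of_bound (measurable_stoppedLikelihood a _ y hV n).aestronglyMeasurable _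
      (Eventually.of_forall fun ω => by
        rw [Real.norm_of_nonneg (hLpos ω).le]
        exact stoppedLikelihood_le a (hμ a) hy V n ω)
  have hxE : ∫ ω in E, L ω ∂P ≤ δ := by
    have h1 := apply_eq_setLIntegral_stoppedLikelihood hμ a hy hP hP' hV hVanti n E hE hEV
    rw [← ofReal_integral_eq_lintegral_ofReal hLint.integrableOn
      (Eventually.of_forall fun ω => (hLpos ω).le)] at h1
    exact (ENNReal.ofReal_le_ofReal_iff hδ.le).1 (h1 ▸ hEδ P' hP')
  have hxU : ∫ ω, L ω ∂P = 1 := by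
    have h1 := apply_eq_setLIntegral_stoppedLikelihood hμ a hy hP hP' hV hVanti n Set.univ
      (@MeasurableSet.univ _ (past K n)) (fun k _ => by
        rw [Set.univ_inter]; exact (hV k).compl)
    rw [setLIntegral_univ, ← ofReal_integral_eq_lintegral_ofReal hLint
      (Eventually.of_forall fun ω => (hLpos ω).le), measure_univ] at h1
    have h2 := congrArg ENNReal.toReal h1
    rwa [ENNReal.toReal_ofReal (integral_nonneg fun ω => (hLpos ω).le), ENNReal.toReal_one,
      eq_comm] at h2
  have hxsum : ∫ ω in E, L ω ∂P + ∫ ω in Eᶜ, L ω ∂P = 1 := by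
    rw [integral_add_compl hEm hLint, hxU]
  have hxE0 : 0 ≤ ∫ ω in E, L ω ∂P := integral_nonneg fun ω => (hLpos ω).le
  set α := Real.log (μ a / y)
  set γ := Real.log ((1 - μ a) / (1 - y))
  have hterm : ∀ i, Integrable ((V i ∩ {ω | arm i ω = a}).indicator fun ω =>
      reward i ω * α + (1 - reward i ω) * γ) P := fun i =>
    Integrable.indicator (((integrable_reward i P).mul_const _).add
      (((integrable_const 1).sub (integrable_reward i P)).mul_const _))
      ((past_le K i _ (hV i)).inter (measurableSet_arm' i a))
  have hA : ∫ ω, ∑ i ∈ Finset.range n, (V i ∩ {ω | arm i ω = a}).indicator (fun ω =>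
      reward i ω * α + (1 - reward i ω) * γ) ω ∂P =
      bernKL (μ a) y * ∑ i ∈ Finset.range n, P.real (V i ∩ {ω | arm i ω = a}) := by
    rw [integral_finsetSum _ fun i _ => hterm i, Finset.mul_sum]
    refine Finset.sum_congr rfl fun i _ => ?_
    have hm := (past_le K i _ (hV i)).inter (measurableSet_arm' i a)
    have hlin : ∀ ω : Path K, reward i ω * α + (1 - reward i ω) * γ =
        reward i ω * (α - γ) + γ := fun ω => by ring
    simp only [hlin]
    rw [integral_indicator hm, integral_add (((integrable_reward i P).mul_const _).integrableOn)
      (integrable_const _), integral_mul_const,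
      setIntegral_reward (hP.isBanditLaw hμI) a (hV i), bernKL_eq (hμ a) hy]
    simp only [integral_const, smul_eq_mul, measureReal_restrict_apply_univ]
    ring
  -- The two tangent bounds for `-log L`. The scaling `1 / δ` on `E` is chosen so that the
  -- subtracted term integrates to at most `1`.
  have hG : ∀ ω, E.indicator (fun ω => 1 + Real.log (1 / δ) - 1 / δ * L ω) ω +
      Eᶜ.indicator (fun ω => 1 - L ω) ω ≤ ∑ i ∈ Finset.range n,
        (V i ∩ {ω | arm i ω = a}).indicator (fun ω =>
          reward i ω * α + (1 - reward i ω) * γ) ω := by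
    intro ω
    refine le_trans ?_ (neg_log_stoppedLikelihood_le a (hμ a) hy V n ω)
    by_cases hω : ω ∈ E
    · simp only [hω, Set.indicator_of_mem, Set.mem_compl_iff, not_true, not_false_eq_true,
        Set.indicator_of_notMem, add_zero]
      have h1 := Real.log_le_sub_one_of_pos (mul_pos (one_div_pos.2 hδ) (hLpos ω))
      rw [Real.log_mul (one_div_pos.2 hδ).ne' (hLpos ω).ne'] at h1
      linarith
    · simp only [hω, Set.mem_compl_iff, not_false_eq_true,
        Set.indicator_of_notMem, Set.indicator_of_mem, zero_add]
      have h1 := Real.log_le_sub_one_of_pos (hLpos ω)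
      linarith
  have i1 : Integrable (fun ω => 1 + Real.log (1 / δ) - 1 / δ * L ω) P :=
    (integrable_const _).sub (hLint.const_mul _)
  have i2 : Integrable (fun ω => 1 - L ω) P := (integrable_const _).sub hLint
  have hmono := integral_mono (μ := P) ((i1.indicator hEm).add (i2.indicator hEm.compl))
    (integrable_finsetSum _ fun i _ => hterm i) hG
  have hcalc : ∫ ω, (E.indicator (fun ω => 1 + Real.log (1 / δ) - 1 / δ * L ω) +
      Eᶜ.indicator (fun ω => 1 - L ω)) ω ∂P =
      P.real E * (1 + Real.log (1 / δ)) - 1 / δ * ∫ ω in E, L ω ∂P + P.real Eᶜ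
        - ∫ ω in Eᶜ, L ω ∂P := by
    simp only [Pi.add_apply]
    rw [integral_add (i1.indicator hEm) (i2.indicator hEm.compl), integral_indicator hEm,
      integral_indicator hEm.compl, integral_sub (integrable_const _)
      (hLint.const_mul _).integrableOn, integral_sub (integrable_const _) hLint.integrableOn,
      integral_const_mul]
    simp only [integral_const, smul_eq_mul, mul_one, measureReal_restrict_apply_univ]
    ring
  have hmono' := hcalc.symm.le.trans (hmono.trans hA.le)
  have hcompl : P.real Eᶜ = 1 - P.real E := by
    rw [measureReal_compl hEm]; simp
  have hdiv : 1 / δ * ∫ ω in E, L ω ∂P ≤ 1 := by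
    rw [one_div, inv_mul_le_iff₀ hδ, mul_one]; exact hxE
  rw [hcompl] at hmono'
  linarith

/-! ### First times -/

/-- `p` did not hold up to time `i`. -/
def survive {K : ℕ} (p : ℕ → Set (Path K)) (i : ℕ) : Set (Path K) := {ω | ∀ k ≤ i, ω ∉ p k}

/-- `p` holds for the first time at some time up to `n`, and `q` holds at that time. -/
def stopEvent {K : ℕ} (p q : ℕ → Set (Path K)) (n : ℕ) : Set (Path K) :=
  {ω | ∃ k ≤ n, (∀ j < k, ω ∉ p j) ∧ ω ∈ p k ∧ ω ∈ q k}

theorem measurableSet_survive {K : ℕ} {p : ℕ → Set (Path K)}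
    (hp : ∀ k, MeasurableSet[past K k] (p k)) (i : ℕ) :
    MeasurableSet[past K i] (survive p i) := by
  have : survive p i = ⋂ k ∈ Finset.range (i + 1), (p k)ᶜ := by
    ext ω; simp [survive]
  rw [this]
  refine Finset.measurableSet_biInter _ fun k hk => ?_
  exact (past_mono (Nat.lt_succ_iff.1 (Finset.mem_range.1 hk)) _ (hp k)).compl

theorem measurableSet_stopEvent {K : ℕ} {p q : ℕ → Set (Path K)}
    (hp : ∀ k, MeasurableSet[past K k] (p k)) (hq : ∀ k, MeasurableSet[past K k] (q k)) (n : ℕ) :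
    MeasurableSet[past K n] (stopEvent p q n) := by
  have : stopEvent p q n = ⋃ k ∈ Finset.range (n + 1),
      ((⋂ j ∈ Finset.range k, (p j)ᶜ) ∩ (p k ∩ q k)) := by
    ext ω
    simp only [stopEvent, Set.mem_ofPred_eq, Set.mem_iUnion, Finset.mem_range, Set.mem_inter_iff,
      Set.mem_iInter, Set.mem_compl_iff, Nat.lt_succ_iff, exists_prop]
  rw [this]
  refine Finset.measurableSet_biUnion _ fun k hk => ?_
  have hk' : k ≤ n := Nat.lt_succ_iff.1 (Finset.mem_range.1 hk)
  refine MeasurableSet.inter (Finset.measurableSet_biInter _ fun j hj => ?_) ?_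
  · exact (past_mono ((Finset.mem_range.1 hj).le.trans hk') _ (hp j)).compl
  · exact past_mono hk' _ ((hp k).inter (hq k))

theorem survive_antitone {K : ℕ} (p : ℕ → Set (Path K)) : Antitone (survive p) :=
  fun _ _ h _ hω k hk => hω k (hk.trans h)

/-- Whatever is decided at the first time is decided by time `k` once that time is at most `k`. This
provides the measurability hypothesis of the stopped change of measure. -/
theorem stopEvent_inter_compl_survive {K : ℕ} (p q : ℕ → Set (Path K)) {k n : ℕ} (hkn : k ≤ n) :
    stopEvent p q n ∩ (survive p k)ᶜ = stopEvent p q k := by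
  ext ω
  constructor
  · rintro ⟨⟨j, hj, h1, h2, h3⟩, h4⟩
    refine ⟨j, ?_, h1, h2, h3⟩
    by_contra hjk
    exact h4 fun i hi => h1 i (by omega)
  · rintro ⟨j, hj, h1, h2, h3⟩
    exact ⟨⟨j, hj.trans hkn, h1, h2, h3⟩, fun h => h j hj h2⟩

/-- Truncated layer-cake formula: `survive p i` is the event that the first time exceeds `i`. -/
theorem sum_indicator_survive_le {K : ℕ} (p : ℕ → Set (Path K)) (n : ℕ) (ω : Path K) :
    ∑ i ∈ Finset.range n, (survive p i).indicator (fun _ => (1 : ℝ≥0∞)) ω ≤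
      firstTime fun t => ω ∈ p t := by
  refine le_iInf₂ fun t ht => ?_
  calc ∑ i ∈ Finset.range n, (survive p i).indicator (fun _ => (1 : ℝ≥0∞)) ω
      ≤ ∑ i ∈ Finset.range n, if i < t then (1 : ℝ≥0∞) else 0 := by
        refine Finset.sum_le_sum fun i _ => ?_
        by_cases h : ω ∈ survive p i
        · have : i < t := by
            by_contra hti
            exact h t (not_lt.1 hti) ht
          simp [h, this]
        · simp [h]
    _ = ((Finset.range n).filter (· < t)).card := by
        rw [← Finset.sum_filter]; simp
    _ ≤ t := by
        have : ((Finset.range n).filter (· < t)).card ≤ (Finset.range t).card :=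
          Finset.card_le_card fun i hi => by
            simp only [Finset.mem_filter, Finset.mem_range] at hi ⊢
            exact hi.2
        rw [Finset.card_range] at this
        exact_mod_cast this

theorem sum_survive_le_lintegral {K : ℕ} {p : ℕ → Set (Path K)}
    (hp : ∀ k, MeasurableSet[past K k] (p k)) (n : ℕ) (P : Measure (Path K))
    [IsProbabilityMeasure P] :
    ENNReal.ofReal (∑ i ∈ Finset.range n, P.real (survive p i)) ≤
      ∫⁻ ω, firstTime (fun t => ω ∈ p t) ∂P := by
  calc ENNReal.ofReal (∑ i ∈ Finset.range n, P.real (survive p i))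
      = ∑ i ∈ Finset.range n, P (survive p i) := by
        rw [ENNReal.ofReal_sum_of_nonneg fun i _ => measureReal_nonneg]
        simp
    _ = ∫⁻ ω, ∑ i ∈ Finset.range n, (survive p i).indicator (fun _ => (1 : ℝ≥0∞)) ω ∂P := by
        have hm := fun i => past_le K i _ (measurableSet_survive hp i)
        rw [lintegral_finsetSum _ fun i _ => measurable_const.indicator (hm i)]
        refine Finset.sum_congr rfl fun i _ => ?_
        rw [lintegral_indicator (hm i)]
        simp
    _ ≤ _ := lintegral_mono fun ω => sum_indicator_survive_le p n ω

/-- The survival probabilities decrease, so `n` times the `n`-th one is at most the expectation of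
the first time. This replaces the possibly unbounded time by a finite horizon. -/
theorem exists_survive_le {K : ℕ} {p : ℕ → Set (Path K)}
    (hp : ∀ k, MeasurableSet[past K k] (p k)) (P : Measure (Path K))
    [IsProbabilityMeasure P] (hfin : ∫⁻ ω, firstTime (fun t => ω ∈ p t) ∂P ≠ ∞) {δ : ℝ}
    (hδ : 0 < δ) : ∃ n, P.real (survive p n) ≤ δ := by
  set I := (∫⁻ ω, firstTime (fun t => ω ∈ p t) ∂P).toReal
  obtain ⟨n, hn⟩ := exists_nat_gt (I / δ)
  refine ⟨n, ?_⟩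
  have h1 := sum_survive_le_lintegral hp n P
  rw [← ENNReal.ofReal_toReal hfin] at h1
  have h2 := (ENNReal.ofReal_le_ofReal_iff ENNReal.toReal_nonneg).1 h1
  have h3 : n * P.real (survive p n) ≤ ∑ i ∈ Finset.range n, P.real (survive p i) := by
    have := Finset.card_nsmul_le_sum (Finset.range n) (fun i => P.real (survive p i))
      (P.real (survive p n)) fun i hi =>
        measureReal_mono (survive_antitone p (Finset.mem_range.1 hi).le)
    simpa using this
  have hI : 0 ≤ I := ENNReal.toReal_nonneg
  have hn0 : (0 : ℝ) < n := (div_nonneg hI hδ.le).trans_lt hn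
  rw [div_lt_iff₀ hδ] at hn
  nlinarith

/-! ### Labels -/

theorem Algorithm.measurableSet_labels {K : ℕ} (A : Algorithm K) (t : ℕ)
    (φ : Finset (Fin K) → Finset (Fin K) → Prop) :
    MeasurableSet[past K t] {ω | φ (A.good t ω) (A.bad t ω)} := by
  classical
  have : {ω | φ (A.good t ω) (A.bad t ω)} =
      ⋃ x ∈ (Finset.univ.filter fun x : Finset (Fin K) × Finset (Fin K) => φ x.1 x.2),
        ({ω | A.good t ω = x.1} ∩ {ω | A.bad t ω = x.2}) := by
    ext ω
    simp
  rw [this]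
  exact Finset.measurableSet_biUnion _ fun x _ => (A.good_adapted t _).inter (A.bad_adapted t _)

/-- The arm `a` has its correct label. -/
def Algorithm.correct {K : ℕ} (A : Algorithm K) (ξ : ℝ) (μ : Fin K → ℝ) (a : Fin K) (k : ℕ) :
    Set (Path K) :=
  {ω | (ξ < μ a ∧ a ∈ A.good k ω) ∨ (μ a < ξ ∧ a ∈ A.bad k ω)}

theorem mem_goodArms {K : ℕ} {ξ : ℝ} {μ : Fin K → ℝ} {a : Fin K} :
    a ∈ goodArms ξ μ ↔ ξ < μ a := by simp [goodArms]

/-- Moving the mean of `a` to the other side of the threshold turns its correct label into an error.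
The value `ξ` itself counts as bad, hence the asymmetric hypotheses `y ≤ ξ` and `ξ < y`. -/
theorem stopEvent_le_delta {K : ℕ} {ξ δ : ℝ} {A : Algorithm K} (hA : IsDeltaCorrect ξ δ A)
    {μ : Fin K → ℝ} (p : ℕ → Set (Path K)) (n : ℕ) (a : Fin K) {y : ℝ}
    (hμy : ∀ b, Function.update μ a y b ∈ Set.Icc (0 : ℝ) 1)
    (h1 : ξ < μ a → y ≤ ξ) (h2 : μ a < ξ → ξ < y) {P' : Measure (Path K)}
    (hP' : IsBernoulliLaw A.policy (Function.update μ a y) P') :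
    P' (stopEvent p (A.correct ξ μ a) n) ≤ ENNReal.ofReal δ := by
  refine le_trans (measure_mono ?_) (hA _ hμy P' (hP'.isBanditLaw hμy))
  rintro ω ⟨k, -, -, -, h | h⟩
  · refine ⟨k, Or.inl fun hs => ?_⟩
    have := mem_goodArms.1 (hs h.2)
    rw [Function.update_self] at this
    linarith [h1 h.1]
  · refine ⟨k, Or.inr fun hs => ?_⟩
    have := hs h.2
    rw [Finset.mem_compl, mem_goodArms, Function.update_self] at this
    exact this (h2 h.1)

/-- For a good arm the alternative mean can be `ξ` itself. For a bad arm it must exceed `ξ`, and the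
bound at `ξ` is the limit of those at `y ↓ ξ`, by continuity of the divergence. -/
theorem label_bound {K : ℕ} [NeZero K] {ξ δ : ℝ} (hξ : ξ ∈ Set.Ioo (0 : ℝ) 1) (hδ : 0 < δ)
    {A : Algorithm K} (hA : IsDeltaCorrect ξ δ A) {μ : Fin K → ℝ}
    (hμ : ∀ a, μ a ∈ Set.Ioo (0 : ℝ) 1) {p : ℕ → Set (Path K)}
    (hp : ∀ k, MeasurableSet[past K k] (p k)) {P : Measure (Path K)}
    (hP : IsBernoulliLaw A.policy μ P) (n : ℕ) (a : Fin K) (ha : μ a ≠ ξ) :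
    P.real (stopEvent p (A.correct ξ μ a) n) * Real.log (1 / δ) - 1 ≤
      bernKL (μ a) ξ * ∑ i ∈ Finset.range n, P.real (survive p i ∩ {ω | arm i ω = a}) := by
  have hq : ∀ k, MeasurableSet[past K k] (A.correct ξ μ a k) := fun k =>
    A.measurableSet_labels k fun g b => (ξ < μ a ∧ a ∈ g) ∨ (μ a < ξ ∧ a ∈ b)
  have key : ∀ y ∈ Set.Ioo (0 : ℝ) 1, (ξ < μ a → y ≤ ξ) → (μ a < ξ → ξ < y) →
      P.real (stopEvent p (A.correct ξ μ a) n) * Real.log (1 / δ) - 1 ≤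
      bernKL (μ a) y * ∑ i ∈ Finset.range n, P.real (survive p i ∩ {ω | arm i ω = a}) := by
    intro y hy h1 h2
    refine information_bound hμ a hy hP (measurableSet_survive hp) (survive_antitone p) n _
      (measurableSet_stopEvent hp hq n) (fun k hk => ?_) hδ (fun P' hP' =>
        stopEvent_le_delta hA p n a (fun b => ?_) h1 h2 hP')
    · rw [stopEvent_inter_compl_survive p _ hk.le]
      exact measurableSet_stopEvent hp hq k
    · by_cases hb : b = a
      · subst hb; simpa using Set.Ioo_subset_Icc_self hy
      · simpa [hb] using Set.Ioo_subset_Icc_self (hμ b)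
  rcases lt_or_gt_of_ne ha with h | h
  · have hlim : Tendsto (fun y => bernKL (μ a) y *
        ∑ i ∈ Finset.range n, P.real (survive p i ∩ {ω | arm i ω = a})) (𝓝[>] ξ)
        (𝓝 (bernKL (μ a) ξ *
          ∑ i ∈ Finset.range n, P.real (survive p i ∩ {ω | arm i ω = a}))) :=
      (((continuousAt_bernKL (hμ a) hξ).tendsto).mono_left nhdsWithin_le_nhds).mul_const _
    refine ge_of_tendsto hlim ?_
    filter_upwards [Ioo_mem_nhdsGT hξ.2] with y hy
    exact key y ⟨hξ.1.trans hy.1, hy.2⟩ (fun h' => absurd h' (not_lt.2 h.le)) fun _ => hy.1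
  · exact key ξ hξ (fun _ => le_rfl) fun h' => absurd h' (not_lt.2 h.le)

theorem sum_survive_arm {K : ℕ} {p : ℕ → Set (Path K)} (P : Measure (Path K))
    [IsProbabilityMeasure P] (i : ℕ) :
    ∑ a, P.real (survive p i ∩ {ω | arm i ω = a}) = P.real (survive p i) := by
  have h := sum_measureReal_preimage_singleton (μ := P.restrict (survive p i)) (f := arm i)
    (Finset.univ : Finset (Fin K)) (fun a _ => measurableSet_arm' i a)
  simp only [Finset.coe_univ, Set.preimage_univ, measureReal_restrict_apply_univ] at h
  rw [← h]
  refine Finset.sum_congr rfl fun a _ => ?_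
  rw [Set.inter_comm]
  exact (measureReal_restrict_apply (measurableSet_arm' i a)).symm

/-- Summing the information bound over the arms in `T`. -/
theorem sum_label_bound {K : ℕ} [NeZero K] {ξ δ : ℝ} (hξ : ξ ∈ Set.Ioo (0 : ℝ) 1) (hδ : 0 < δ)
    {A : Algorithm K} (hA : IsDeltaCorrect ξ δ A) {μ : Fin K → ℝ}
    (hμ : ∀ a, μ a ∈ Set.Ioo (0 : ℝ) 1) (hμξ : ∀ a, μ a ≠ ξ) {p : ℕ → Set (Path K)}
    (hp : ∀ k, MeasurableSet[past K k] (p k)) {P : Measure (Path K)}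
    (hP : IsBernoulliLaw A.policy μ P) (n : ℕ) (T : Finset (Fin K)) :
    ∑ a ∈ T, (P.real (stopEvent p (A.correct ξ μ a) n) * Real.log (1 / δ) - 1) *
      (1 / bernKL (μ a) ξ) ≤ ∑ i ∈ Finset.range n, P.real (survive p i) := by
  have := hP.isProbabilityMeasure
  calc ∑ a ∈ T, (P.real (stopEvent p (A.correct ξ μ a) n) * Real.log (1 / δ) - 1) *
        (1 / bernKL (μ a) ξ)
      ≤ ∑ a ∈ T, ∑ i ∈ Finset.range n, P.real (survive p i ∩ {ω | arm i ω = a}) := by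
        refine Finset.sum_le_sum fun a _ => ?_
        have hd := bernKL_pos (hμ a) hξ (hμξ a)
        rw [mul_one_div, div_le_iff₀ hd]
        exact (label_bound hξ hδ hA hμ hp hP n a (hμξ a)).trans_eq (mul_comm _ _)
    _ ≤ ∑ a, ∑ i ∈ Finset.range n, P.real (survive p i ∩ {ω | arm i ω = a}) :=
        Finset.sum_le_univ_sum_of_nonneg fun a => Finset.sum_nonneg fun i _ => measureReal_nonneg
    _ = _ := by
        rw [Finset.sum_comm]
        exact Finset.sum_congr rfl fun i _ => sum_survive_arm P i

/-- A lower bound on the expectation of a first time `τ`: it suffices to bound below, for one `n`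
with `P (τ > n) ≤ δ`, the sum of the probabilities of correct labels. -/
theorem le_worstCase {K : ℕ} [NeZero K] {ξ δ : ℝ} (hξ : ξ ∈ Set.Ioo (0 : ℝ) 1) (hδ : 0 < δ)
    {A : Algorithm K} (hA : IsDeltaCorrect ξ δ A) {μ : Fin K → ℝ}
    (hμ : ∀ a, μ a ∈ Set.Ioo (0 : ℝ) 1) (hμξ : ∀ a, μ a ≠ ξ) {p : ℕ → Set (Path K)}
    (hp : ∀ k, MeasurableSet[past K k] (p k)) (T : Finset (Fin K)) {c : ℝ}
    (hc : ∀ P : Measure (Path K), IsProbabilityMeasure P → ∀ n,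
      1 - 2 * δ ≤ P.real {ω | (∃ k ≤ n, (∀ j < k, ω ∉ p j) ∧ ω ∈ p k) ∧
        ∀ t, A.good t ω ⊆ goodArms ξ μ ∧ A.bad t ω ⊆ (goodArms ξ μ)ᶜ} →
      c ≤ ∑ a ∈ T, (P.real (stopEvent p (A.correct ξ μ a) n) * Real.log (1 / δ) - 1) *
        (1 / bernKL (μ a) ξ)) :
    ENNReal.ofReal c ≤ worstCase A.policy μ fun ω => firstTime fun t => ω ∈ p t := by
  have hμI : ∀ a, μ a ∈ Set.Icc (0 : ℝ) 1 := fun a => Set.Ioo_subset_Icc_self (hμ a)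
  obtain ⟨P, hP⟩ := exists_isBernoulliLaw A.policy hμI
  have := hP.isProbabilityMeasure
  have hbl := hP.isBanditLaw hμI
  refine le_trans ?_ (le_iSup₂ (f := fun (P : Measure (Path K)) (_ : IsBanditLaw A.policy μ P) =>
    ∫⁻ ω, firstTime (fun t => ω ∈ p t) ∂P) P hbl)
  by_cases hfin : ∫⁻ ω, firstTime (fun t => ω ∈ p t) ∂P = ∞
  · rw [hfin]; exact le_top
  obtain ⟨n, hn⟩ := exists_survive_le hp P hfin hδ
  refine le_trans (ENNReal.ofReal_le_ofReal ?_) (sum_survive_le_lintegral hp n P)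
  refine (hc P inferInstance n ?_).trans (sum_label_bound hξ hδ hA hμ hμξ hp hP n T)
  set F := {ω | (∃ k ≤ n, (∀ j < k, ω ∉ p j) ∧ ω ∈ p k) ∧
        ∀ t, A.good t ω ⊆ goodArms ξ μ ∧ A.bad t ω ⊆ (goodArms ξ μ)ᶜ}
  set err := {ω | ∃ t, ¬ A.good t ω ⊆ goodArms ξ μ ∨ ¬ A.bad t ω ⊆ (goodArms ξ μ)ᶜ}
  have herr : P.real err ≤ δ := ENNReal.toReal_le_of_le_ofReal hδ.le (hA μ hμI P hbl)
  -- The loss `2δ`: one `δ` for not having stopped by the horizon `n`, one for a mislabelled arm.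
  have hcover : (Set.univ : Set (Path K)) ⊆ F ∪ (survive p n ∪ err) := by
    intro ω _
    by_cases h1 : ω ∈ survive p n
    · exact Or.inr (Or.inl h1)
    by_cases h2 : ω ∈ err
    · exact Or.inr (Or.inr h2)
    refine Or.inl ⟨?_, fun t => ?_⟩
    · classical
      simp only [survive, Set.mem_ofPred_eq, not_forall, not_not] at h1
      obtain ⟨k, hk, hpk⟩ := h1
      have hex : ∃ k, ω ∈ p k := ⟨k, hpk⟩
      exact ⟨Nat.find hex, (Nat.find_min' hex hpk).trans hk, fun j hj => Nat.find_min hex hj,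
        Nat.find_spec hex⟩
    · by_contra h3
      exact h2 ⟨t, by tauto⟩
  have h1 : 1 ≤ P.real F + (P.real (survive p n) + P.real err) := by
    calc (1 : ℝ) = P.real Set.univ := by simp
      _ ≤ P.real (F ∪ (survive p n ∪ err)) := measureReal_mono hcover
      _ ≤ P.real F + P.real (survive p n ∪ err) := measureReal_union_le _ _
      _ ≤ _ := by gcongr; exact measureReal_union_le _ _
  linarith

/-! ### Asymptotic lower bounds as `δ → 0`. -/

theorem tendsto_log_one_div : Tendsto (fun δ : ℝ => Real.log (1 / δ)) (𝓝[>] 0) atTop := by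
  simp only [one_div]
  exact Real.tendsto_log_atTop.comp tendsto_inv_nhdsGT_zero

theorem le_liminf_of_le {W c c' : ℝ} (f : ℝ → ℝ≥0∞)
    (hf : ∀ δ ∈ Set.Ioo (0 : ℝ) 1,
      ENNReal.ofReal ((W - c * δ) * Real.log (1 / δ) - c') / ENNReal.ofReal (Real.log (1 / δ))
        ≤ f δ) :
    ENNReal.ofReal W ≤ liminf f (𝓝[>] 0) := by
  have hid : Tendsto (fun δ : ℝ => δ) (𝓝[>] 0) (𝓝 0) := nhdsWithin_le_nhds
  have hlim : Tendsto (fun δ : ℝ => (W - c * δ) - c' / Real.log (1 / δ)) (𝓝[>] 0) (𝓝 W) := by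
    have h1 := (hid.const_mul c).const_sub W
    have h2 : Tendsto (fun δ : ℝ => c' / Real.log (1 / δ)) (𝓝[>] 0) (𝓝 0) :=
      tendsto_log_one_div.const_div_atTop c'
    simpa using h1.sub h2
  have hlim' := (ENNReal.continuous_ofReal.tendsto W).comp hlim
  rw [← hlim'.liminf_eq]
  refine liminf_le_liminf ?_
  filter_upwards [Ioo_mem_nhdsGT (zero_lt_one' ℝ),
    tendsto_log_one_div.eventually_gt_atTop 0] with δ hδ hL
  refine le_trans (le_of_eq ?_) (hf δ hδ)
  rw [← ENNReal.ofReal_div_of_pos hL, Function.comp]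
  congr 1
  field_simp

/-- If all arms are labelled at the stopping time and no label is ever wrong, then every arm carries
its correct label at that time; so each label probability is at least `1 - 2δ`. -/
theorem le_liminf_stopTime {K : ℕ} [NeZero K] {ξ : ℝ} (hξ : ξ ∈ Set.Ioo (0 : ℝ) 1)
    {μ : Fin K → ℝ} (hμ : ∀ a, μ a ∈ Set.Ioo (0 : ℝ) 1) (hμξ : ∀ a, μ a ≠ ξ) :
    ENNReal.ofReal (∑ a, 1 / bernKL (μ a) ξ) ≤
      liminf (fun δ : ℝ => ⨅ (A : Algorithm K) (_ : IsDeltaCorrect ξ δ A),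
        worstCase A.policy μ (stopTime A) / ENNReal.ofReal (Real.log (1 / δ))) (𝓝[>] 0) := by
  set W := ∑ a, 1 / bernKL (μ a) ξ
  refine le_liminf_of_le (c := 2 * W) (c' := W) _ fun δ hδ => ?_
  refine le_iInf₂ fun A hA => ENNReal.div_le_div_right ?_ _
  have hL : 0 ≤ Real.log (1 / δ) := by
    rw [one_div, Real.log_inv]
    linarith [Real.log_nonpos hδ.1.le hδ.2.le]
  refine le_worstCase hξ hδ.1 hA hμ hμξ
    (p := fun t => {ω | A.good t ω ∪ A.bad t ω = Finset.univ})
    (fun k => A.measurableSet_labels k fun g b => g ∪ b = Finset.univ) Finset.univ ?_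
  intro P _ n hF
  have h1 : ∀ a, ((1 - 2 * δ) * Real.log (1 / δ) - 1) * (1 / bernKL (μ a) ξ) ≤
      (P.real (stopEvent (fun t => {ω | A.good t ω ∪ A.bad t ω = Finset.univ})
        (A.correct ξ μ a) n) * Real.log (1 / δ) - 1) * (1 / bernKL (μ a) ξ) := by
    intro a
    have hd := one_div_pos.2 (bernKL_pos (hμ a) hξ (hμξ a))
    refine mul_le_mul_of_nonneg_right (sub_le_sub_right (mul_le_mul_of_nonneg_right
      (hF.trans (measureReal_mono ?_)) hL) 1) hd.le
    rintro ω ⟨⟨k, hk, h1, h2⟩, h3⟩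
    refine ⟨k, hk, h1, h2, ?_⟩
    have h4 : a ∈ A.good k ω ∪ A.bad k ω := by
      rw [show A.good k ω ∪ A.bad k ω = Finset.univ from h2]; exact Finset.mem_univ a
    rcases Finset.mem_union.1 h4 with h | h
    · exact Or.inl ⟨mem_goodArms.1 ((h3 k).1 h), h⟩
    · have := (h3 k).2 h
      rw [Finset.mem_compl, mem_goodArms, not_lt] at this
      exact Or.inr ⟨lt_of_le_of_ne this (hμξ a), h⟩
  refine le_trans (le_of_eq ?_) (Finset.sum_le_sum fun a _ => h1 a)
  rw [← Finset.mul_sum]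
  show _ = _ * W
  ring

/-- Which arms are labelled good first is up to the algorithm. Write `q a` for the probability that
the good arm `a` is correctly labelled at the time in question; only `q a ≤ 1` and a lower bound on
their sum are available. The weighted sum is smallest when the mass sits on the cheapest arms, those
with the largest means. -/
theorem le_liminf_goodTime {K : ℕ} [NeZero K] {ξ : ℝ} (hξ : ξ ∈ Set.Ioo (0 : ℝ) 1)
    {μ : Fin K → ℝ} (hμ : ∀ a, μ a ∈ Set.Ioo (0 : ℝ) 1) (hμξ : ∀ a, μ a ≠ ξ)
    (iStar : Fin K) (hstar : ξ < μ iStar) :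
    ENNReal.ofReal (∑ a with μ iStar ≤ μ a, 1 / bernKL (μ a) ξ) ≤
      liminf (fun δ : ℝ => ⨅ (A : Algorithm K) (_ : IsDeltaCorrect ξ δ A),
        worstCase A.policy μ (goodTime A (Finset.univ.filter fun a => μ iStar ≤ μ a).card) /
          ENNReal.ofReal (Real.log (1 / δ))) (𝓝[>] 0) := by
  classical
  set top := Finset.univ.filter fun a => μ iStar ≤ μ a with htop
  set w : Fin K → ℝ := fun a => 1 / bernKL (μ a) ξ with hw
  set W := ∑ a ∈ top, w a with hW
  set G := goodArms ξ μ
  refine le_liminf_of_le (c := 2 * (top.card * w iStar)) (c' := ∑ a ∈ G, w a) _ fun δ hδ => ?_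
  refine le_iInf₂ fun A hA => ENNReal.div_le_div_right ?_ _
  have hL : 0 ≤ Real.log (1 / δ) := by
    rw [one_div, Real.log_inv]
    linarith [Real.log_nonpos hδ.1.le hδ.2.le]
  refine le_worstCase hξ hδ.1 hA hμ hμξ (p := fun t => {ω | top.card ≤ (A.good t ω).card})
    (fun k => A.measurableSet_labels k fun g b => top.card ≤ g.card) G ?_
  intro P _ n hF
  set p : ℕ → Set (Path K) := fun t => {ω | top.card ≤ (A.good t ω).card} with hp
  set E : Fin K → Set (Path K) := fun a => stopEvent p (A.correct ξ μ a) n with hE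
  have hEm : ∀ a, MeasurableSet (E a) := fun a => past_le K n _
    (measurableSet_stopEvent (fun k => A.measurableSet_labels k fun g b => top.card ≤ g.card)
      (fun k => A.measurableSet_labels k fun g b => (ξ < μ a ∧ a ∈ g) ∨ (μ a < ξ ∧ a ∈ b)) n)
  have hwpos : ∀ a, 0 < w a := fun a => one_div_pos.2 (bernKL_pos (hμ a) hξ (hμξ a))
  have htopG : top ⊆ G := fun a ha => mem_goodArms.2 (hstar.trans_le (Finset.mem_filter.1 ha).2)
  -- Markov's inequality for the number of good arms correctly labelled at the first time: without
  -- errors it is at least `top.card`.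
  have hsum : top.card * (1 - 2 * δ) ≤ ∑ a ∈ G, P.real (E a) := by
    have hint : ∀ a ∈ G, Integrable ((E a).indicator fun _ => (1 : ℝ)) P := fun a _ =>
      (integrable_const _).indicator (hEm a)
    have h1 : ∑ a ∈ G, P.real (E a) = ∫ ω, ∑ a ∈ G, (E a).indicator (fun _ => (1 : ℝ)) ω ∂P := by
      rw [integral_finsetSum _ hint]
      refine Finset.sum_congr rfl fun a _ => ?_
      rw [integral_indicator (hEm a)]
      simp
    rw [h1]
    refine le_trans ?_ (mul_meas_ge_le_integral_of_nonneg (Eventually.of_forall fun ω =>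
      Finset.sum_nonneg fun a _ => Set.indicator_nonneg (fun _ _ => zero_le_one) ω)
      (integrable_finsetSum _ hint) (top.card : ℝ))
    refine mul_le_mul_of_nonneg_left (hF.trans (measureReal_mono ?_)) (Nat.cast_nonneg _)
    rintro ω ⟨⟨k, hk, h1, h2⟩, h3⟩
    have h4 : (A.good k ω).card ≤ ∑ a ∈ G, (E a).indicator (fun _ => (1 : ℝ)) ω := by
      calc ((A.good k ω).card : ℝ) = ∑ a ∈ A.good k ω, (1 : ℝ) := by simp
        _ = ∑ a ∈ A.good k ω, (E a).indicator (fun _ => (1 : ℝ)) ω := by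
            refine Finset.sum_congr rfl fun a ha => ?_
            have : ω ∈ E a := ⟨k, hk, h1, h2, Or.inl ⟨mem_goodArms.1 ((h3 k).1 ha), ha⟩⟩
            simp [this]
        _ ≤ _ := Finset.sum_le_sum_of_subset_of_nonneg (h3 k).1 fun a _ _ =>
            Set.indicator_nonneg (fun _ _ => zero_le_one) ω
    exact le_trans (by exact_mod_cast (show top.card ≤ (A.good k ω).card from h2)) h4
  -- Weak duality for the linear program, with the weight of the threshold arm `iStar` as multiplier
  -- of the sum constraint: arms outside `top` have larger weights, arms in `top` have smaller ones
  -- and mass at most `1`.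
  have hlp : W - top.card * w iStar + w iStar * ∑ a ∈ G, P.real (E a) ≤
      ∑ a ∈ G, P.real (E a) * w a := by
    rw [← Finset.sum_sdiff htopG, ← Finset.sum_sdiff htopG, hW]
    have h1 : ∀ a ∈ G \ top, w iStar * P.real (E a) ≤ P.real (E a) * w a := by
      intro a ha
      rw [mul_comm]
      refine mul_le_mul_of_nonneg_left ?_ measureReal_nonneg
      simp only [htop, Finset.mem_sdiff, Finset.mem_filter, Finset.mem_univ, true_and,
        not_le] at ha
      exact one_div_le_one_div_of_le (bernKL_pos (hμ a) hξ (hμξ a))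
        (bernKL_mono (hμ a) (hμ iStar) hξ (mem_goodArms.1 ha.1).le ha.2.le)
    have h2 : ∀ a ∈ top, w a - w iStar + w iStar * P.real (E a) ≤ P.real (E a) * w a := by
      intro a ha
      have h3 : w a ≤ w iStar := one_div_le_one_div_of_le
        (bernKL_pos (hμ iStar) hξ (hμξ iStar))
        (bernKL_mono (hμ iStar) (hμ a) hξ hstar.le (Finset.mem_filter.1 ha).2)
      have h4 : P.real (E a) ≤ 1 := measureReal_le_one
      nlinarith
    have h5 := Finset.sum_le_sum h1
    have h6 := Finset.sum_le_sum h2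
    rw [Finset.sum_add_distrib, Finset.sum_sub_distrib, ← Finset.mul_sum] at h6
    rw [← Finset.mul_sum] at h5
    simp only [Finset.sum_const, nsmul_eq_mul] at h6
    rw [mul_add]
    linarith
  have hfin : ∑ a ∈ G, (P.real (E a) * Real.log (1 / δ) - 1) * w a =
      (∑ a ∈ G, P.real (E a) * w a) * Real.log (1 / δ) - ∑ a ∈ G, w a := by
    rw [Finset.sum_mul, ← Finset.sum_sub_distrib]
    refine Finset.sum_congr rfl fun a _ => by ring
  show _ ≤ ∑ a ∈ G, (P.real (E a) * Real.log (1 / δ) - 1) * w a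
  rw [hfin]
  refine sub_le_sub_right (mul_le_mul_of_nonneg_right (le_trans ?_ hlp) hL) _
  nlinarith [mul_le_mul_of_nonneg_left hsum (hwpos iStar).le]

/-! ### Mixtures of bandit laws -/

theorem tsum_two_inv_pow_succ : ∑' n : ℕ, (2⁻¹ : ℝ≥0∞) ^ (n + 1) = 1 := by
  rw [ENNReal.tsum_geometric_add_one, ENNReal.one_sub_inv_two, inv_inv]
  exact ENNReal.inv_mul_cancel (by simp) (by simp)

/-- A countable mixture of bandit laws is a bandit law. -/
theorem isBanditLaw_sum {K : ℕ} {π : Policy K} {μ : Fin K → ℝ} (hμ : ∀ a, 0 ≤ μ a)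
    {P : ℕ → Measure (Path K)} (hP : ∀ n, IsBanditLaw π μ (P n)) :
    IsBanditLaw π μ (Measure.sum fun n => (2⁻¹ : ℝ≥0∞) ^ (n + 1) • P n) := by
  have hprob : ∀ n, IsProbabilityMeasure (P n) := fun n => (hP n).isProbabilityMeasure
  have : IsProbabilityMeasure (Measure.sum fun n => (2⁻¹ : ℝ≥0∞) ^ (n + 1) • P n) := by
    refine ⟨?_⟩
    rw [Measure.sum_apply _ MeasurableSet.univ]
    simpa using tsum_two_inv_pow_succ
  have hlaw := fun n => (hP n).isLawOn hμ fun _ => Set.univ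
  refine isBanditLaw_of_isLawOn hμ ⟨fun t a B hB hBV => ?_, fun t a B hB hBV => ?_⟩
  · have hB' := past_le K t _ hB
    rw [Measure.sum_apply _ (hB'.inter (measurableSet_arm' t a)), Measure.restrict_sum _ hB',
      lintegral_sum_measure]
    refine tsum_congr fun n => ?_
    rw [Measure.smul_apply, (hlaw n).arm_law t a B hB hBV, Measure.restrict_smul,
      lintegral_smul_measure]
  · have hB' := (past_le K t _ hB).inter (measurableSet_arm' t a)
    rw [Measure.sum_apply _ hB', Measure.restrict_sum _ hB', lintegral_sum_measure,
      ← ENNReal.tsum_mul_left]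
    refine tsum_congr fun n => ?_
    rw [Measure.smul_apply, Measure.restrict_smul, lintegral_smul_measure,
      (hlaw n).reward_mean t a B hB hBV, smul_eq_mul, smul_eq_mul]
    ring

/-- The constant in the definition of regret minimization may be chosen uniformly over all
bandit instances. -/
theorem exists_uniform_regret {K : ℕ} {π : Scheme K} {μ : Fin K → ℝ} (hμ : ∀ a, 0 ≤ μ a)
    (hπ : IsRegretMinimizing π μ) {S : Finset (Fin K)} {aStar : Fin K} (haS : aStar ∈ S)
    (hmax : ∀ a ∈ S, μ a ≤ μ aStar) :
    ∃ c : ℝ, 0 < c ∧ ∀ P, IsBanditLaw (π.initialized S) μ P → ∀ t : ℕ,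
      P {ω | arm t ω ≠ aStar} ≤ ENNReal.ofReal (c / ((t : ℝ) + 1)) := by
  by_contra hcon
  push Not at hcon
  -- The `n`-th instance violates the constant `4 ^ n` and enters the mixture with weight `2⁻¹ ^ (n
  -- + 1)`. A constant `c` for the mixture would then be at least `2 ^ n / 2` for every `n`.
  choose P hP t ht using fun n : ℕ => hcon ((4 : ℝ) ^ n) (by positivity)
  obtain ⟨c, -, hc⟩ := hπ S aStar haS hmax _ (isBanditLaw_sum hμ hP)
  obtain ⟨n, hn⟩ := pow_unbounded_of_one_lt (2 * c) (one_lt_two : (1 : ℝ) < 2)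
  have hm : MeasurableSet {ω : Path K | arm (t n) ω ≠ aStar} :=
    (measurableSet_arm' (t n) aStar).compl
  have h1 := hc (t n)
  rw [Measure.sum_apply _ hm] at h1
  have h2 : (2⁻¹ : ℝ≥0∞) ^ (n + 1) * ENNReal.ofReal (4 ^ n / ((t n : ℝ) + 1)) ≤
      ENNReal.ofReal (c / ((t n : ℝ) + 1)) :=
    ((mul_le_mul_right (ht n).le _).trans
      (ENNReal.le_tsum (f := fun n => ((2⁻¹ : ℝ≥0∞) ^ (n + 1) • P n) _) n)).trans h1
  have h3 : (2⁻¹ : ℝ≥0∞) ^ (n + 1) = ENNReal.ofReal ((2⁻¹ : ℝ) ^ (n + 1)) := by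
    rw [ENNReal.ofReal_pow (by norm_num), ENNReal.ofReal_inv_of_pos two_pos]
    simp
  have htpos : (0 : ℝ) < (t n : ℝ) + 1 := by positivity
  have h5 : 0 ≤ c / ((t n : ℝ) + 1) := by
    by_contra hneg
    rw [ENNReal.ofReal_of_nonpos (not_le.1 hneg).le, h3, ← ENNReal.ofReal_mul (by positivity),
      nonpos_iff_eq_zero, ENNReal.ofReal_eq_zero] at h2
    have : (0 : ℝ) < (2⁻¹ : ℝ) ^ (n + 1) * (4 ^ n / ((t n : ℝ) + 1)) := by positivity
    linarith
  rw [h3, ← ENNReal.ofReal_mul (by positivity), ENNReal.ofReal_le_ofReal_iff h5,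
    ← mul_div_assoc, div_le_div_iff_of_pos_right htpos] at h2
  have h6 : (2⁻¹ : ℝ) ^ (n + 1) * 4 ^ n = 2 ^ n / 2 := by
    rw [show (4 : ℝ) = 2 * 2 by norm_num, mul_pow, pow_succ, inv_pow]
    field_simp
  rw [h6] at h2
  linarith

/-! ### Continuing a stopped law -/

/-- The restrictions of both measures to `B` have the same trim to the past, and the integral of a
past-measurable function depends only on that trim. -/
theorem setLIntegral_eq_of_past {K t : ℕ} {Q Q' : Measure (Path K)}
    {V : Set (Path K)} (h : ∀ E, MeasurableSet[past K t] E → E ⊆ V → Q E = Q' E)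
    {B : Set (Path K)} (hB : MeasurableSet[past K t] B) (hBV : B ⊆ V) {f : Path K → ℝ≥0∞}
    (hf : Measurable[past K t] f) : ∫⁻ ω in B, f ω ∂Q = ∫⁻ ω in B, f ω ∂Q' := by
  have hB' := past_le K t _ hB
  have htrim : (Q.restrict B).trim (past_le K t) = (Q'.restrict B).trim (past_le K t) := by
    refine @Measure.ext _ (past K t) _ _ fun s hs => ?_
    rw [trim_measurableSet_eq _ hs, trim_measurableSet_eq _ hs,
      Measure.restrict_apply (past_le K t _ hs), Measure.restrict_apply (past_le K t _ hs)]
    exact h _ (hs.inter hB) (Set.inter_subset_right.trans hBV)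
  rw [← lintegral_trim (past_le K t) hf, htrim, lintegral_trim (past_le K t) hf]

open Classical in
/-- A law that satisfies the bandit identities only on the events `V t` agrees on these events
with a bandit law. -/
theorem exists_isBanditLaw_eq_on {K : ℕ} [NeZero K] {π : Policy K} {μ : Fin K → ℝ}
    (hμ : ∀ a, μ a ∈ Set.Icc (0 : ℝ) 1) {Q' : Measure (Path K)} [IsProbabilityMeasure Q']
    {V : ℕ → Set (Path K)} (hV : ∀ t, MeasurableSet[past K t] (V t)) (hVanti : Antitone V)
    (h : IsLawOn V π μ Q') :
    ∃ Q, IsBanditLaw π μ Q ∧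
      ∀ t E, MeasurableSet[past K (t + 1)] E → E ⊆ V t → Q E = Q' E := by
  have hD : ∀ t, MeasurableSet {h : Fin t → Obs K | extend h ∈ V t} := fun t =>
    measurable_extend (past_le K t _ (hV t))
  have hDV : ∀ t ω, extend (pre t ω) ∈ V t ↔ ω ∈ V t := fun t ω => by
    have := apply_extend_pre (f := fun ω => (ω ∈ V t : Prop))
      ((@measurableSet_setOfPred _ (past K t) _).1 (hV t)) ω
    exact this.to_iff
  have := isMarkovKernel_bernoulliKernel π hμ
  -- Inside `V t` the next round is drawn from the conditional law under `Q'`, outside it is drawn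
  -- with Bernoulli rewards. As `V t` is decided before round `t`, the two laws agree within `V t`
  -- even for events that involve round `t`.
  let κ : (t : ℕ) → Kernel (Fin t → Obs K) (Obs K) := fun t =>
    Kernel.piecewise (hD t) (condDistrib (fun ω : Path K => ω t) (pre t) Q')
      (bernoulliKernel π μ t)
  obtain ⟨Q, hQ, hQκ⟩ := exists_trajectory_law κ
  have hstep : ∀ t, (∀ E, MeasurableSet[past K t] E → E ⊆ V t → Q E = Q' E) →
      ∀ E, MeasurableSet[past K (t + 1)] E → E ⊆ V t → Q E = Q' E := by
    intro t hC E hE hEV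
    have hE' := past_le K _ _ hE
    rw [past_succ_eq] at hE
    obtain ⟨D, hDm, rfl⟩ := hE
    set F : (Fin t → Obs K) × Obs K → ℝ≥0∞ :=
      (D ∩ Prod.fst ⁻¹' {h | extend h ∈ V t}).indicator fun _ => 1 with hF
    have hFm : Measurable F := measurable_const.indicator (hDm.inter (measurable_fst (hD t)))
    have hFE : ∀ ω : Path K, F (pre t ω, ω t) =
        ((fun ω : Path K => (pre t ω, ω t)) ⁻¹' D).indicator (fun _ => 1) ω := by
      intro ω
      by_cases hω : (pre t ω, ω t) ∈ D
      · have h2 : ω ∈ (fun ω : Path K => (pre t ω, ω t)) ⁻¹' D := hω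
        rw [Set.indicator_of_mem h2, hF, Set.indicator_of_mem]
        exact ⟨hω, (hDV t ω).2 (hEV h2)⟩
      · have h2 : ω ∉ (fun ω : Path K => (pre t ω, ω t)) ⁻¹' D := hω
        rw [Set.indicator_of_notMem h2, hF, Set.indicator_of_notMem]
        exact fun h => hω h.1
    set g : (Fin t → Obs K) → ℝ≥0∞ := fun h =>
      ∫⁻ x, F (h, x) ∂(condDistrib (fun ω : Path K => ω t) (pre t) Q' h) with hg
    have hgm : Measurable g := hFm.lintegral_kernel_prod_right'
    have hg0 : ∀ ω, ω ∉ V t → ∀ x, F (pre t ω, x) = 0 := fun ω hω x =>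
      Set.indicator_of_notMem (fun h => hω ((hDV t ω).1 h.2)) _
    have hgind : ∀ ν : Measure (Path K), ∫⁻ ω, g (pre t ω) ∂ν = ∫⁻ ω in V t, g (pre t ω) ∂ν := by
      intro ν
      rw [← lintegral_indicator (past_le K t _ (hV t))]
      refine lintegral_congr fun ω => ?_
      by_cases hω : ω ∈ V t
      · rw [Set.indicator_of_mem hω]
      · rw [Set.indicator_of_notMem hω]
        simp [hg, hg0 ω hω]
    have e1 : Q ((fun ω : Path K => (pre t ω, ω t)) ⁻¹' D) = ∫⁻ ω, g (pre t ω) ∂Q := by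
      rw [← lintegral_indicator_one hE']
      simp only [Pi.one_def, ← hFE]
      rw [hQκ t F hFm]
      refine lintegral_congr fun ω => ?_
      by_cases hω : ω ∈ V t
      · have : pre t ω ∈ {h : Fin t → Obs K | extend h ∈ V t} := (hDV t ω).2 hω
        simp only [κ, Kernel.piecewise_apply, this, if_true, hg]
      · simp [hg, hg0 ω hω]
    have e2 : Q' ((fun ω : Path K => (pre t ω, ω t)) ⁻¹' D) = ∫⁻ ω, g (pre t ω) ∂Q' := by
      rw [← lintegral_indicator_one hE']
      simp only [Pi.one_def, ← hFE]
      have hc := compProd_map_condDistrib (mβ := inferInstance) (μ := Q') (X := pre t) (Y := fun ω : Path K => ω t)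
        (measurable_pi_apply t).aemeasurable
      rw [← lintegral_map hFm (measurable_pre_coord t), ← hc, Measure.lintegral_compProd hFm,
        lintegral_map hgm (measurable_pre t)]
    rw [e1, e2, hgind Q, hgind Q']
    exact setLIntegral_eq_of_past hC (hV t) le_rfl (hgm.comp (comap_measurable (pre t)))
  have hC : ∀ t, ∀ E, MeasurableSet[past K t] E → E ⊆ V t → Q E = Q' E := by
    intro t
    induction t with
    | zero =>
      rintro _ ⟨D, -, rfl⟩ -
      have he : ∀ ω : Path K, (fun i : Fin 0 => ω i) = Fin.elim0 :=
        fun ω => funext fun i => i.elim0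
      by_cases hD0 : Fin.elim0 ∈ D
      · have : (fun (ω : Path K) (i : Fin 0) => ω i) ⁻¹' D = Set.univ := by
          ext ω; simp [he, hD0]
        simp [this]
      · have : (fun (ω : Path K) (i : Fin 0) => ω i) ⁻¹' D = ∅ := by
          ext ω; simp [he, hD0]
        simp [this]
    | succ t ih =>
      exact fun E hE hEV => hstep t ih E hE (hEV.trans (hVanti (Nat.le_succ t)))
  -- Off `V t` the one-step Bernoulli identity holds, which is what `bernoulli_arm_law` and
  -- `bernoulli_reward_mean` ask for. Both bandit identities are then checked separately on `V t`
  -- and off it.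
  have hoff : ∀ t B, MeasurableSet[past K t] B → B ⊆ (V t)ᶜ → ∀ f : Obs K → ℝ≥0∞,
      Measurable f → ∫⁻ ω in B, f (ω t) ∂Q = ∫⁻ ω in B, ∑ a, ENNReal.ofReal (π.prob t ω a) *
        (ENNReal.ofReal (μ a) * f (a, 1) + ENNReal.ofReal (1 - μ a) * f (a, 0)) ∂Q := by
    intro t B hB hBV f hf
    have hB' := past_le K t _ hB
    obtain ⟨D, hDm, hDB⟩ := hB
    have hDB' : ∀ ω : Path K, D.indicator (fun _ => (1 : ℝ≥0∞)) (pre t ω) =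
        B.indicator (fun _ => 1) ω := by
      intro ω
      rw [← hDB]
      rfl
    have e := hQκ t (fun p => D.indicator (fun _ => 1) p.1 * f p.2)
      (((measurable_const.indicator hDm).comp measurable_fst).mul (hf.comp measurable_snd))
    simp only [hDB'] at e
    rw [← lintegral_indicator hB', ← lintegral_indicator hB']
    refine Eq.trans (lintegral_congr fun ω => ?_) (e.trans (lintegral_congr fun ω => ?_))
    · by_cases hω : ω ∈ B <;> simp [hω]
    · by_cases hω : ω ∈ B
      · have : pre t ω ∉ {h : Fin t → Obs K | extend h ∈ V t} :=
          fun h' => hBV hω ((hDV t ω).1 h')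
        simp only [hω, Set.indicator_of_mem, one_mul, κ, Kernel.piecewise_apply, this, if_false]
        rw [lintegral_bernoulliKernel π μ t _ hf]
        refine Finset.sum_congr rfl fun a _ => ?_
        rw [apply_extend_pre (π.adapted t a)]
      · simp [hω]
  refine ⟨Q, ?_, fun t => hstep t (hC t)⟩
  refine isBanditLaw_of_isLawOn (fun a => (hμ a).1)
    ⟨fun t a B hB _ => ?_, fun t a B hB _ => ?_⟩
  · have hVm := past_le K t _ (hV t)
    have hin := hB.inter (hV t)
    have hout : MeasurableSet[past K t] (B \ V t) := hB.diff (hV t)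
    have hsplit : B ∩ {ω | arm t ω = a} ∩ V t = B ∩ V t ∩ {ω | arm t ω = a} := by
      rw [Set.inter_right_comm]
    have hsplit' : (B ∩ {ω | arm t ω = a}) \ V t = (B \ V t) ∩ {ω | arm t ω = a} := by
      ext ω
      simp only [Set.mem_sdiff, Set.mem_inter_iff]
      tauto
    rw [← measure_inter_add_sdiff _ hVm, ← lintegral_inter_add_sdiff _ B hVm, hsplit, hsplit']
    congr 1
    · rw [hstep t (hC t) _ ((past_mono (Nat.le_succ t) _ hin).inter
          (measurableSet_arm (Nat.lt_succ_self t) a))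
          (Set.inter_subset_left.trans Set.inter_subset_right),
        h.arm_law t a _ hin Set.inter_subset_right]
      exact (setLIntegral_eq_of_past (hC t) hin Set.inter_subset_right
        (π.adapted t a).ennreal_ofReal).symm
    · exact bernoulli_arm_law hμ (hoff t _ hout fun ω hω => hω.2) a
  · have hVm := past_le K t _ (hV t)
    have hin := hB.inter (hV t)
    have hout : MeasurableSet[past K t] (B \ V t) := hB.diff (hV t)
    have hsplit : B ∩ {ω | arm t ω = a} ∩ V t = B ∩ V t ∩ {ω | arm t ω = a} := by
      rw [Set.inter_right_comm]
    have hsplit' : (B ∩ {ω | arm t ω = a}) \ V t = (B \ V t) ∩ {ω | arm t ω = a} := by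
      ext ω
      simp only [Set.mem_sdiff, Set.mem_inter_iff]
      tauto
    have hin' : MeasurableSet[past K (t + 1)] (B ∩ V t ∩ {ω | arm t ω = a}) :=
      (past_mono (Nat.le_succ t) _ hin).inter (measurableSet_arm (Nat.lt_succ_self t) a)
    rw [← measure_inter_add_sdiff (B ∩ _) hVm,
      ← lintegral_inter_add_sdiff _ (B ∩ _) hVm, hsplit, hsplit', mul_add]
    congr 1
    · rw [setLIntegral_eq_of_past (hstep t (hC t)) hin'
          (Set.inter_subset_left.trans Set.inter_subset_right)
          (measurable_reward (Nat.lt_succ_self t)).ennreal_ofReal,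
        hstep t (hC t) _ hin' (Set.inter_subset_left.trans Set.inter_subset_right)]
      exact h.reward_mean t a _ hin Set.inter_subset_right
    · exact bernoulli_reward_mean hμ (hoff t _ hout fun ω hω => hω.2) a

/-! ### Follow the leader for Bernoulli bets -/

/-- The projection onto the interval `[lo, hi]`. -/
def clip (lo hi x : ℝ) : ℝ := min hi (max x lo)

/-- `β` is the bet corresponding to the empirical mean clipped to `[lo, hi]`. -/
structure IsClippedBet (ξ lo hi : ℝ) (β : ℝ → ℝ) : Prop where
  lo_pos : 0 < lo
  lo_le : lo ≤ ξ
  le_hi : ξ ≤ hi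
  hi_lt : hi < 1
  bet_eq : ∀ x, ξ + β x * (ξ * (1 - ξ)) = clip lo hi x

theorem isClippedBet_betMinus {ξ b : ℝ} (hξ : ξ ∈ Set.Ioo (0 : ℝ) 1) (hb : b ∈ Set.Ioo (0 : ℝ) 1) :
    IsClippedBet ξ ξ (b * (1 - ξ) + ξ) (betMinus ξ b) := by
  have h1 := sub_pos.2 hξ.2
  have h0 := mul_pos hξ.1 h1
  refine ⟨hξ.1, le_rfl, by nlinarith [hb.1], by nlinarith [hb.2], fun x => ?_⟩
  rw [betMinus, clip, min_mul_of_nonneg _ _ h0.le, max_mul_of_nonneg _ _ h0.le, zero_mul,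
    div_mul_cancel₀ _ h0.ne', add_comm ξ, ← min_add_add_right, ← max_add_add_right,
    zero_add, sub_add_cancel]
  congr 2
  have := hξ.1.ne'
  field_simp

theorem isClippedBet_betPlus {ξ b : ℝ} (hξ : ξ ∈ Set.Ioo (0 : ℝ) 1) (hb : b ∈ Set.Ioo (0 : ℝ) 1) :
    IsClippedBet ξ (ξ * (1 - b)) ξ (betPlus ξ b) := by
  have h1 := sub_pos.2 hξ.2
  have h0 := mul_pos hξ.1 h1
  refine ⟨mul_pos hξ.1 (sub_pos.2 hb.2), by nlinarith [hb.1, hξ.1], le_rfl, hξ.2, fun x => ?_⟩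
  rw [betPlus, clip, min_mul_of_nonneg _ _ h0.le, max_mul_of_nonneg _ _ h0.le, zero_mul,
    div_mul_cancel₀ _ h0.ne', add_comm ξ, ← min_add_add_right, ← max_add_add_right,
    zero_add, sub_add_cancel]
  congr 2
  field_simp
  ring

section
variable {ξ lo hi : ℝ} {β : ℝ → ℝ}

theorem clip_mem (hβ : IsClippedBet ξ lo hi β) (x : ℝ) : clip lo hi x ∈ Set.Icc lo hi :=
  ⟨le_min (hβ.lo_le.trans hβ.le_hi) (le_max_right _ _), min_le_left _ _⟩

theorem Icc_subset_Ioo (hβ : IsClippedBet ξ lo hi β) : Set.Icc lo hi ⊆ Set.Ioo (0 : ℝ) 1 :=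
  fun _ hp => ⟨hβ.lo_pos.trans_le hp.1, hp.2.trans_lt hβ.hi_lt⟩

theorem abs_clip_sub_le (lo hi x y : ℝ) : |clip lo hi x - clip lo hi y| ≤ |x - y| := by
  unfold clip
  refine (abs_min_sub_min_le_max _ _ _ _).trans ?_
  rw [sub_self, abs_zero, max_eq_right (abs_nonneg _)]
  exact abs_max_sub_max_le_abs _ _ _

/-- The variational inequality of the projection onto an interval; it is the first-order optimality
condition in `clip_optimal`. -/
theorem clip_variational {lo hi p : ℝ} (hp : p ∈ Set.Icc lo hi) (x : ℝ) :
    (p - clip lo hi x) * (x - clip lo hi x) ≤ 0 := by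
  unfold clip
  rcases le_total x lo with h | h
  · rw [max_eq_right h, min_eq_right (hp.1.trans hp.2)]
    nlinarith [hp.1]
  · rw [max_eq_left h]
    rcases le_total hi x with h' | h'
    · rw [min_eq_left h']
      nlinarith [hp.2]
    · rw [min_eq_right h']
      simp

theorem log_sub_log_le {x y : ℝ} (hx : 0 < x) (hy : 0 < y) :
    Real.log x - Real.log y ≤ (x - y) / y := by
  have h := Real.log_le_sub_one_of_pos (div_pos hx hy)
  rw [Real.log_div hx.ne' hy.ne'] at h
  rwa [sub_div, div_self hy.ne']

/-- The clipped mean is the leader. -/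
theorem clip_optimal (hβ : IsClippedBet ξ lo hi β) {p : ℝ} (hp : p ∈ Set.Icc lo hi) {m : ℝ}
    (hm : m ∈ Set.Icc (0 : ℝ) 1) :
    m * Real.log p + (1 - m) * Real.log (1 - p) ≤
      m * Real.log (clip lo hi m) + (1 - m) * Real.log (1 - clip lo hi m) := by
  have hq := Icc_subset_Ioo hβ (clip_mem hβ m)
  have hp' := Icc_subset_Ioo hβ hp
  have hv := clip_variational hp m
  set q := clip lo hi m
  have h1 := sub_pos.2 hq.2
  have e1 := mul_le_mul_of_nonneg_left (log_sub_log_le hp'.1 hq.1) hm.1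
  have e2 := mul_le_mul_of_nonneg_left (log_sub_log_le (sub_pos.2 hp'.2) h1)
    (sub_nonneg.2 hm.2)
  have e3 : m * ((p - q) / q) + (1 - m) * ((1 - p - (1 - q)) / (1 - q)) =
      (p - q) * (m - q) / (q * (1 - q)) := by
    field_simp [hq.1.ne', h1.ne']
    ring
  have e4 := div_nonpos_of_nonpos_of_nonneg hv (mul_pos hq.1 h1).le
  linarith

/-- The factor of the e-process is affine in the reward. -/
theorem factor_eq (hβ : IsClippedBet ξ lo hi β) (m x : ℝ) :
    1 + β m * (x - ξ) = x * (clip lo hi m / ξ) +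
      (1 - x) * ((1 - clip lo hi m) / (1 - ξ)) := by
  have h0 : 0 < ξ := hβ.lo_pos.trans_le hβ.lo_le
  have h1 : 0 < 1 - ξ := sub_pos.2 (hβ.le_hi.trans_lt hβ.hi_lt)
  rw [← hβ.bet_eq m]
  field_simp [h0.ne', h1.ne']
  ring

theorem factor_pos (hβ : IsClippedBet ξ lo hi β) (m : ℝ) {x : ℝ} (hx : x ∈ Set.Icc (0 : ℝ) 1) :
    0 < 1 + β m * (x - ξ) := by
  rw [factor_eq hβ]
  have hq := Icc_subset_Ioo hβ (clip_mem hβ m)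
  have h0 : 0 < ξ := hβ.lo_pos.trans_le hβ.lo_le
  have h1 : 0 < 1 - ξ := sub_pos.2 (hβ.le_hi.trans_lt hβ.hi_lt)
  have h2 := div_pos hq.1 h0
  have h3 := div_pos (sub_pos.2 hq.2) h1
  rcases hx.1.eq_or_lt with h | h
  · rw [← h]; simpa using h3
  · exact add_pos_of_pos_of_nonneg (mul_pos h h2) (mul_nonneg (sub_nonneg.2 hx.2) h3.le)

theorem factor_le (hβ : IsClippedBet ξ lo hi β) (m : ℝ) {x : ℝ} (hx : x ∈ Set.Icc (0 : ℝ) 1) :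
    1 + β m * (x - ξ) ≤ 1 / ξ + 1 / (1 - ξ) := by
  rw [factor_eq hβ]
  have hq := Icc_subset_Ioo hβ (clip_mem hβ m)
  have h0 : 0 < ξ := hβ.lo_pos.trans_le hβ.lo_le
  have h1 : 0 < 1 - ξ := sub_pos.2 (hβ.le_hi.trans_lt hβ.hi_lt)
  have h2 := (div_pos hq.1 h0).le
  have h3 := (div_pos (sub_pos.2 hq.2) h1).le
  have h4 : clip lo hi m / ξ ≤ 1 / ξ := div_le_div_of_nonneg_right hq.2.le h0.le
  have h5 : (1 - clip lo hi m) / (1 - ξ) ≤ 1 / (1 - ξ) :=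
    div_le_div_of_nonneg_right (by linarith [hq.1]) h1.le
  exact add_le_add ((mul_le_of_le_one_left h2 hx.2).trans h4)
    ((mul_le_of_le_one_left h3 (by linarith [hx.1])).trans h5)

/-- Concavity reduces a reward in `[0,1]` to the log loss of a Bernoulli forecast, which is affine
in the reward. Rewards then enter only through their sum. -/
theorem log_factor_ge (hβ : IsClippedBet ξ lo hi β) (m : ℝ) {x : ℝ}
    (hx : x ∈ Set.Icc (0 : ℝ) 1) :
    x * (Real.log (clip lo hi m) - Real.log ξ) +
      (1 - x) * (Real.log (1 - clip lo hi m) - Real.log (1 - ξ)) ≤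
      Real.log (1 + β m * (x - ξ)) := by
  have hq := Icc_subset_Ioo hβ (clip_mem hβ m)
  have h0 : 0 < ξ := hβ.lo_pos.trans_le hβ.lo_le
  have h1 : 0 < 1 - ξ := sub_pos.2 (hβ.le_hi.trans_lt hβ.hi_lt)
  have h2 := sub_pos.2 hq.2
  rw [factor_eq hβ, ← Real.log_div hq.1.ne' h0.ne', ← Real.log_div h2.ne' h1.ne']
  have hc := strictConcaveOn_log_Ioi.concaveOn.2
    (show clip lo hi m / ξ ∈ Set.Ioi (0 : ℝ) from div_pos hq.1 h0)
    (show (1 - clip lo hi m) / (1 - ξ) ∈ Set.Ioi (0 : ℝ) from div_pos h2 h1)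
    hx.1 (sub_nonneg.2 hx.2) (by ring)
  simpa only [smul_eq_mul] using hc

/-- The log loss is Lipschitz in the forecast because clipping keeps forecasts away from `0` and
`1`. This is where the truncation constant of the bets is used. -/
theorem log_stability (hβ : IsClippedBet ξ lo hi β) {q q' ε : ℝ} (hq : q ∈ Set.Icc lo hi)
    (hq' : q' ∈ Set.Icc lo hi) (hqq : |q - q'| ≤ ε) {x : ℝ} (hx : x ∈ Set.Icc (0 : ℝ) 1) :
    x * (Real.log q' - Real.log ξ) + (1 - x) * (Real.log (1 - q') - Real.log (1 - ξ)) -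
      (1 / lo + 1 / (1 - hi)) * ε ≤
      x * (Real.log q - Real.log ξ) + (1 - x) * (Real.log (1 - q) - Real.log (1 - ξ)) := by
  have hqI := Icc_subset_Ioo hβ hq
  have hqI' := Icc_subset_Ioo hβ hq'
  have hε : 0 ≤ ε := (abs_nonneg _).trans hqq
  have hh : 0 < 1 - hi := sub_pos.2 hβ.hi_lt
  obtain ⟨ha, hb⟩ := abs_le.1 hqq
  have e1 : Real.log q' - Real.log q ≤ 1 / lo * ε := by
    refine (log_sub_log_le hqI'.1 hqI.1).trans ?_
    rw [one_div_mul_eq_div]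
    calc (q' - q) / q ≤ ε / q := div_le_div_of_nonneg_right (by linarith) hqI.1.le
      _ ≤ ε / lo := div_le_div_of_nonneg_left hε hβ.lo_pos hq.1
  have e2 : Real.log (1 - q') - Real.log (1 - q) ≤ 1 / (1 - hi) * ε := by
    refine (log_sub_log_le (sub_pos.2 hqI'.2) (sub_pos.2 hqI.2)).trans ?_
    rw [one_div_mul_eq_div]
    calc (1 - q' - (1 - q)) / (1 - q) ≤ ε / (1 - q) :=
          div_le_div_of_nonneg_right (by linarith) (sub_pos.2 hqI.2).le
      _ ≤ ε / (1 - hi) := div_le_div_of_nonneg_left hε hh (by linarith [hq.2])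
  have h1 : 0 ≤ 1 / lo * ε := mul_nonneg (one_div_pos.2 hβ.lo_pos).le hε
  have h2 : 0 ≤ 1 / (1 - hi) * ε := mul_nonneg (one_div_pos.2 hh).le hε
  have e3 := mul_le_mul_of_nonneg_left e1 hx.1
  have e4 := mul_le_mul_of_nonneg_left e2 (sub_nonneg.2 hx.2)
  nlinarith [mul_le_mul_of_nonneg_right hx.2 h1,
    mul_le_mul_of_nonneg_right (show 1 - x ≤ 1 by linarith [hx.1]) h2]

theorem one_div_succ_le_log (n : ℕ) :
    1 / ((n : ℝ) + 1) ≤ 2 * (Real.log (1 + (n + 1)) - Real.log (1 + n)) := by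
  have h1 : (0 : ℝ) < 1 + n := by positivity
  have h2 : (0 : ℝ) < 1 + (n + 1) := by positivity
  have h := log_sub_log_le h1 h2
  have h3 : ((1 : ℝ) + n - (1 + (n + 1))) / (1 + (n + 1)) = -(1 / (1 + (n + 1))) := by
    rw [← neg_div]; congr 1; ring
  rw [h3] at h
  have h4 : 1 / ((n : ℝ) + 1) ≤ 2 * (1 / (1 + (n + 1))) := by
    rw [mul_one_div, div_le_div_iff₀ (by positivity) h2]
    linarith
  linarith

/-- One step of the be-the-leader argument. -/
theorem leader_step (hβ : IsClippedBet ξ lo hi β) {n : ℕ} {S m x E : ℝ} (hS0 : 0 ≤ S)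
    (hSn : S ≤ n) (hm : m = if n = 0 then ξ else S / n) (hx : x ∈ Set.Icc (0 : ℝ) 1)
    (hE : ∀ p ∈ Set.Icc lo hi, S * (Real.log p - Real.log ξ) +
      (n - S) * (Real.log (1 - p) - Real.log (1 - ξ)) -
      2 * (1 / lo + 1 / (1 - hi)) * Real.log (1 + n) ≤ E) {p : ℝ} (hp : p ∈ Set.Icc lo hi) :
    (S + x) * (Real.log p - Real.log ξ) +
      ((n + 1 : ℕ) - (S + x)) * (Real.log (1 - p) - Real.log (1 - ξ)) -
      2 * (1 / lo + 1 / (1 - hi)) * Real.log (1 + (n + 1 : ℕ)) ≤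
        E + Real.log (1 + β m * (x - ξ)) := by
  have hn1 : (0 : ℝ) < n + 1 := by positivity
  have hξ0 : 0 < ξ := hβ.lo_pos.trans_le hβ.lo_le
  have hξ1 : ξ < 1 := hβ.le_hi.trans_lt hβ.hi_lt
  set m' := (S + x) / (n + 1) with hm'
  have hm'I : m' ∈ Set.Icc (0 : ℝ) 1 :=
    ⟨div_nonneg (add_nonneg hS0 hx.1) hn1.le,
      (div_le_one hn1).2 (add_le_add hSn hx.2)⟩
  -- One more observation moves an average by at most `1 / (n + 1)`. Without observations the
  -- default mean `ξ` is used, and both numbers lie in `[0,1]`.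
  have hmm : |m - m'| ≤ 1 / (n + 1) := by
    by_cases h0 : n = 0
    · subst h0
      have hS : S = 0 := le_antisymm (by simpa using hSn) hS0
      rw [hm, hm', hS]
      simp only [if_true, Nat.cast_zero, zero_add, div_one]
      rw [abs_le]
      constructor <;> linarith [hx.1, hx.2]
    · have hn0 : (0 : ℝ) < n := by exact_mod_cast Nat.pos_of_ne_zero h0
      rw [hm, if_neg h0, hm']
      have : S / n - (S + x) / (n + 1) = (S / n - x) / (n + 1) := by
        field_simp
        ring
      rw [this, abs_div, abs_of_pos hn1]
      refine div_le_div_of_nonneg_right ?_ hn1.le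
      have h1 : 0 ≤ S / n := div_nonneg hS0 hn0.le
      have h2 : S / n ≤ 1 := (div_le_one hn0).2 hSn
      rw [abs_le]
      constructor <;> linarith [hx.1, hx.2]
  have hq' := clip_mem hβ m'
  -- The inductive bound is used at the next leader `q'`, not at `p`. Playing `q` in place of `q'`
  -- in the new round costs one stability term, and `q'` beats `p` on all `n + 1` rounds. The
  -- stability terms sum to the logarithm.
  have e1 := hE _ hq'
  have e2 := log_factor_ge hβ m hx
  have e3 := log_stability hβ (clip_mem hβ m) hq' ((abs_clip_sub_le lo hi m m').trans hmm) hx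
  have e4 := clip_optimal hβ hp hm'I
  have e5 := mul_le_mul_of_nonneg_left e4 hn1.le
  have e6 : ((n : ℝ) + 1) * m' = S + x := by rw [hm']; field_simp
  have hLip : 0 ≤ 1 / lo + 1 / (1 - hi) :=
    add_nonneg (one_div_pos.2 hβ.lo_pos).le (one_div_pos.2 (sub_pos.2 hβ.hi_lt)).le
  have e7 := mul_le_mul_of_nonneg_left (one_div_succ_le_log n) hLip
  set q' := clip lo hi m'
  have e8 : ((n : ℝ) + 1) * (m' * Real.log p + (1 - m') * Real.log (1 - p)) =
      (S + x) * Real.log p + (n + 1 - (S + x)) * Real.log (1 - p) := by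
    rw [← e6]; ring
  have e9 : ((n : ℝ) + 1) * (m' * Real.log q' + (1 - m') * Real.log (1 - q')) =
      (S + x) * Real.log q' + (n + 1 - (S + x)) * Real.log (1 - q') := by
    rw [← e6]; ring
  rw [e8, e9] at e5
  push_cast
  nlinarith

end

/-! ### E-processes from time zero -/

/-- The e-process with bets `β`. -/
def betProduct {K : ℕ} (ξ : ℝ) (β : ℝ → ℝ) (t : ℕ) (a : Fin K) (ω : Path K) : ℝ :=
  ∏ i ∈ pulls 0 t a ω, (1 + β (empMean ξ 0 i a ω) * (reward i ω - ξ))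

theorem pulls_succ_self {K : ℕ} {t : ℕ} {a : Fin K} {ω : Path K} (h : arm t ω = a) :
    pulls 0 (t + 1) a ω = insert t (pulls 0 t a ω) := by
  ext i
  simp only [pulls, Finset.mem_filter, Finset.mem_Ico, Finset.mem_insert, zero_le, true_and,
    Nat.lt_succ_iff_lt_or_eq]
  constructor
  · rintro ⟨h1 | h1, h2⟩
    · exact Or.inr ⟨h1, h2⟩
    · exact Or.inl h1
  · rintro (h1 | ⟨h1, h2⟩)
    · exact ⟨Or.inr h1, h1 ▸ h⟩
    · exact ⟨Or.inl h1, h2⟩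

theorem notMem_pulls {K : ℕ} (t : ℕ) (a : Fin K) (ω : Path K) : t ∉ pulls 0 t a ω := by
  simp [pulls]

theorem pulls_succ_of_ne {K : ℕ} {t : ℕ} {a : Fin K} {ω : Path K} (h : arm t ω ≠ a) :
    pulls 0 (t + 1) a ω = pulls 0 t a ω := by
  ext i
  simp only [pulls, Finset.mem_filter, Finset.mem_Ico, zero_le, true_and,
    Nat.lt_succ_iff_lt_or_eq]
  constructor
  · rintro ⟨h1 | h1, h2⟩
    · exact ⟨h1, h2⟩
    · exact absurd (h1 ▸ h2) h
  · rintro ⟨h1, h2⟩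
    exact ⟨Or.inl h1, h2⟩

theorem betProduct_succ_of_ne {K : ℕ} (ξ : ℝ) (β : ℝ → ℝ) {t : ℕ} {a : Fin K} {ω : Path K}
    (h : arm t ω ≠ a) : betProduct ξ β (t + 1) a ω = betProduct ξ β t a ω := by
  rw [betProduct, pulls_succ_of_ne h, betProduct]

theorem betProduct_succ_self {K : ℕ} (ξ : ℝ) (β : ℝ → ℝ) {t : ℕ} {a : Fin K} {ω : Path K}
    (h : arm t ω = a) : betProduct ξ β (t + 1) a ω =
      betProduct ξ β t a ω * (1 + β (empMean ξ 0 t a ω) * (reward t ω - ξ)) := by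
  rw [betProduct, pulls_succ_self h, Finset.prod_insert (notMem_pulls t a ω), mul_comm, betProduct]

theorem reward_mem {K : ℕ} (t : ℕ) (ω : Path K) : reward t ω ∈ Set.Icc (0 : ℝ) 1 :=
  ⟨reward_nonneg t ω, reward_le_one t ω⟩

theorem betProduct_pos {K : ℕ} {ξ lo hi : ℝ} {β : ℝ → ℝ} (hβ : IsClippedBet ξ lo hi β) (t : ℕ)
    (a : Fin K) (ω : Path K) : 0 < betProduct ξ β t a ω :=
  Finset.prod_pos fun i _ => factor_pos hβ _ (reward_mem i ω)

theorem one_le_factor_bound {ξ : ℝ} (hξ : ξ ∈ Set.Ioo (0 : ℝ) 1) : 1 ≤ 1 / ξ + 1 / (1 - ξ) := by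
  have h1 : 1 ≤ 1 / ξ := (one_le_div hξ.1).2 hξ.2.le
  have h2 : 0 < 1 / (1 - ξ) := one_div_pos.2 (sub_pos.2 hξ.2)
  linarith

theorem betProduct_le_pow {K : ℕ} {ξ lo hi : ℝ} {β : ℝ → ℝ} (hβ : IsClippedBet ξ lo hi β) (t : ℕ)
    (a : Fin K) (ω : Path K) :
    betProduct ξ β t a ω ≤ (1 / ξ + 1 / (1 - ξ)) ^ (pulls 0 t a ω).card := by
  rw [← Finset.prod_const]
  exact Finset.prod_le_prod (fun i _ => (factor_pos hβ _ (reward_mem i ω)).le)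
    fun i _ => factor_le hβ _ (reward_mem i ω)

/-- The sum of the observed rewards of the arm `a`. -/
def rewardSum {K : ℕ} (t : ℕ) (a : Fin K) (ω : Path K) : ℝ := ∑ i ∈ pulls 0 t a ω, reward i ω

theorem rewardSum_nonneg {K : ℕ} (t : ℕ) (a : Fin K) (ω : Path K) : 0 ≤ rewardSum t a ω :=
  Finset.sum_nonneg fun i _ => reward_nonneg i ω

theorem rewardSum_le {K : ℕ} (t : ℕ) (a : Fin K) (ω : Path K) :
    rewardSum t a ω ≤ (pulls 0 t a ω).card := by
  have := Finset.sum_le_card_nsmul (pulls 0 t a ω) (fun i => reward i ω) 1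
    fun i _ => reward_le_one i ω
  simpa [rewardSum] using this

/-- The growth of the e-process, compared with a constant bet in hindsight. -/
theorem log_betProduct_ge_of_mem {K : ℕ} {ξ lo hi : ℝ} {β : ℝ → ℝ} (hβ : IsClippedBet ξ lo hi β)
    (t : ℕ) (a : Fin K) (ω : Path K) {p : ℝ} (hp : p ∈ Set.Icc lo hi) :
    rewardSum t a ω * (Real.log p - Real.log ξ) + ((pulls 0 t a ω).card - rewardSum t a ω) *
      (Real.log (1 - p) - Real.log (1 - ξ)) -
      2 * (1 / lo + 1 / (1 - hi)) * Real.log (1 + (pulls 0 t a ω).card) ≤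
      Real.log (betProduct ξ β t a ω) := by
  induction t generalizing p with
  | zero => simp [rewardSum, betProduct, pulls]
  | succ t ih =>
    by_cases h : arm t ω = a
    · have hsum : rewardSum (t + 1) a ω = rewardSum t a ω + reward t ω := by
        rw [rewardSum, pulls_succ_self h, Finset.sum_insert (notMem_pulls t a ω), add_comm,
          rewardSum]
      have hcard : (pulls 0 (t + 1) a ω).card = (pulls 0 t a ω).card + 1 := by
        rw [pulls_succ_self h, Finset.card_insert_of_notMem (notMem_pulls t a ω)]
      rw [hsum, hcard, betProduct_succ_self ξ β h, Real.log_mul (betProduct_pos hβ t a ω).ne'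
        (factor_pos hβ _ (reward_mem t ω)).ne']
      exact leader_step hβ (rewardSum_nonneg t a ω) (rewardSum_le t a ω) rfl (reward_mem t ω)
        (fun p hp => ih hp) hp
    · rw [betProduct_succ_of_ne ξ β h, rewardSum, pulls_succ_of_ne h]
      exact ih hp

/-- The slope of the log-likelihood ratio. -/
def slope (x ξ : ℝ) : ℝ := Real.log (x / ξ) - Real.log ((1 - x) / (1 - ξ))

/-- The growth of the e-process in terms of the divergence and of the centered rewards. -/
theorem log_betProduct_ge {K : ℕ} {ξ lo hi : ℝ} {β : ℝ → ℝ} (hβ : IsClippedBet ξ lo hi β)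
    (t : ℕ) (a : Fin K) (ω : Path K) {x : ℝ} (hx : x ∈ Set.Icc lo hi) :
    ∑ i ∈ pulls 0 t a ω, (bernKL x ξ + slope x ξ * (reward i ω - x)) -
      2 * (1 / lo + 1 / (1 - hi)) * Real.log (1 + (pulls 0 t a ω).card) ≤
      Real.log (betProduct ξ β t a ω) := by
  refine le_trans (le_of_eq ?_) (log_betProduct_ge_of_mem hβ t a ω hx)
  have hxI := Icc_subset_Ioo hβ hx
  have h0 : 0 < ξ := hβ.lo_pos.trans_le hβ.lo_le
  have h1 : 0 < 1 - ξ := sub_pos.2 (hβ.le_hi.trans_lt hβ.hi_lt)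
  congr 1
  rw [Finset.sum_add_distrib, ← Finset.mul_sum, Finset.sum_sub_distrib,
    bernKL_eq hxI ⟨h0, sub_pos.1 h1⟩, slope, Real.log_div hxI.1.ne' h0.ne',
    Real.log_div (sub_pos.2 hxI.2).ne' h1.ne']
  simp only [Finset.sum_const, nsmul_eq_mul, rewardSum]
  ring

/-! ### The tail of the duration of an epoch -/

/-- No arm was labelled in the first `u` rounds of an epoch; `M` is the threshold for labelling
and `n₀` the number of initial rounds without tests. -/
def alive {K : ℕ} (ξ b M : ℝ) (n₀ u : ℕ) : Set (Path K) :=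
  {ω | ∀ v < u, n₀ ≤ v →
    eMinus ξ b 0 (v + 1) (arm v ω) ω < M ∧ ePlus ξ b 0 (v + 1) (arm v ω) ω ≤ M}

theorem eMinus_eq {K : ℕ} (ξ b : ℝ) (t : ℕ) (a : Fin K) (ω : Path K) :
    eMinus ξ b 0 t a ω = betProduct ξ (betMinus ξ b) t a ω := rfl

theorem ePlus_eq {K : ℕ} (ξ b : ℝ) (t : ℕ) (a : Fin K) (ω : Path K) :
    ePlus ξ b 0 t a ω = betProduct ξ (betPlus ξ b) t a ω := rfl

theorem measurable_eMinus {K : ℕ} (ξ b : ℝ) (t : ℕ) (a : Fin K) :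
    Measurable[past K t] fun ω : Path K => eMinus ξ b 0 t a ω :=
  measurable_eProcess ξ 0 t a (by unfold betMinus; fun_prop)

theorem measurable_ePlus {K : ℕ} (ξ b : ℝ) (t : ℕ) (a : Fin K) :
    Measurable[past K t] fun ω : Path K => ePlus ξ b 0 t a ω :=
  measurable_eProcess ξ 0 t a (by unfold betPlus; fun_prop)

theorem measurable_eMinus_arm {K : ℕ} (ξ b : ℝ) (v : ℕ) :
    Measurable[past K (v + 1)] fun ω : Path K => eMinus ξ b 0 (v + 1) (arm v ω) ω :=
  @measurable_select _ _ _ _ (past K (v + 1)) _ _ _ _ (measurable_arm (Nat.lt_succ_self v))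
    (fun a ω => eMinus ξ b 0 (v + 1) a ω) fun a _ => measurable_eMinus ξ b (v + 1) a

theorem measurable_ePlus_arm {K : ℕ} (ξ b : ℝ) (v : ℕ) :
    Measurable[past K (v + 1)] fun ω : Path K => ePlus ξ b 0 (v + 1) (arm v ω) ω :=
  @measurable_select _ _ _ _ (past K (v + 1)) _ _ _ _ (measurable_arm (Nat.lt_succ_self v))
    (fun a ω => ePlus ξ b 0 (v + 1) a ω) fun a _ => measurable_ePlus ξ b (v + 1) a

theorem measurableSet_alive {K : ℕ} (ξ b M : ℝ) (n₀ u : ℕ) :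
    MeasurableSet[past K u] (alive (K := K) ξ b M n₀ u) := by
  have : alive (K := K) ξ b M n₀ u = ⋂ v ∈ (Finset.range u).filter (n₀ ≤ ·),
      ({ω | eMinus ξ b 0 (v + 1) (arm v ω) ω < M} ∩
        {ω | ePlus ξ b 0 (v + 1) (arm v ω) ω ≤ M}) := by
    ext ω
    simp only [alive, Set.mem_ofPred_eq, Set.mem_iInter, Finset.mem_filter, Finset.mem_range,
      Set.mem_inter_iff, and_imp]
  rw [this]
  refine Finset.measurableSet_biInter _ fun v hv => ?_
  have hvu : v + 1 ≤ u := Finset.mem_range.1 (Finset.mem_filter.1 hv).1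
  exact past_mono hvu _ (((measurable_eMinus_arm ξ b v) measurableSet_Iio).inter
    ((measurable_ePlus_arm ξ b v) measurableSet_Iic))

theorem alive_antitone {K : ℕ} (ξ b M : ℝ) (n₀ : ℕ) : Antitone (alive (K := K) ξ b M n₀) :=
  fun _ _ h _ hω v hv => hω v (hv.trans_le h)

theorem card_pulls_le {K : ℕ} (t : ℕ) (a : Fin K) (ω : Path K) : (pulls 0 t a ω).card ≤ t := by
  refine (Finset.card_filter_le _ _).trans ?_
  simp

/-- An e-process changes only when its arm is pulled, and after the initial rounds the pulled arm is
always tested. During the untested initial rounds each factor is bounded, so the processes cannot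
have passed `M` if `M` is large. -/
theorem le_of_alive {K : ℕ} {ξ b M : ℝ} (hξ : ξ ∈ Set.Ioo (0 : ℝ) 1) (hb : b ∈ Set.Ioo (0 : ℝ) 1)
    {n₀ : ℕ} (hM : (1 / ξ + 1 / (1 - ξ)) ^ n₀ ≤ M) (u : ℕ) (ω : Path K)
    (h : ω ∈ alive ξ b M n₀ u) (a : Fin K) :
    eMinus ξ b 0 u a ω ≤ M ∧ ePlus ξ b 0 u a ω ≤ M := by
  have hB := one_le_factor_bound hξ
  have hsmall : ∀ u ≤ n₀, eMinus ξ b 0 u a ω ≤ M ∧ ePlus ξ b 0 u a ω ≤ M := by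
    intro u hu
    have h1 := pow_le_pow_right₀ hB ((card_pulls_le u a ω).trans hu)
    exact ⟨((betProduct_le_pow (isClippedBet_betMinus hξ hb) u a ω).trans h1).trans hM,
      ((betProduct_le_pow (isClippedBet_betPlus hξ hb) u a ω).trans h1).trans hM⟩
  induction u with
  | zero => exact hsmall 0 (Nat.zero_le _)
  | succ u ih =>
    by_cases hu : n₀ ≤ u
    · by_cases ha : arm u ω = a
      · have := h u (Nat.lt_succ_self u) hu
        rw [ha] at this
        exact ⟨this.1.le, this.2⟩
      · have := ih (alive_antitone ξ b M n₀ (Nat.le_succ u) h)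
        rw [eMinus_eq, ePlus_eq, betProduct_succ_of_ne _ _ ha, betProduct_succ_of_ne _ _ ha]
        exact this
    · exact hsmall (u + 1) (by omega)

/-- The gain of a round: its expectation given the past and the arm is the divergence. -/
def gain {K : ℕ} (ξ : ℝ) (μ : Fin K → ℝ) (i : ℕ) (ω : Path K) : ℝ :=
  bernKL (μ (arm i ω)) ξ + slope (μ (arm i ω)) ξ * (reward i ω - μ (arm i ω))

/-- The mean of an arm lies in the clipping interval of `betMinus` if it is at least `ξ` and in that
of `betPlus` otherwise; the e-process betting in the right direction gives the bound. The constant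
adds up both cases, so it serves all arms. -/
theorem exists_growth {K : ℕ} {ξ b : ℝ} (hξ : ξ ∈ Set.Ioo (0 : ℝ) 1) (hb : b ∈ Set.Ioo (0 : ℝ) 1)
    {μ : Fin K → ℝ} (hμ : ∀ a, μ a ∈ Set.Icc (ξ * (1 - b)) (b * (1 - ξ) + ξ)) :
    ∃ C : ℝ, 0 ≤ C ∧ ∀ (a : Fin K) (t : ℕ) (ω : Path K) (M : ℝ),
      eMinus ξ b 0 t a ω ≤ M → ePlus ξ b 0 t a ω ≤ M →
      ∑ i ∈ pulls 0 t a ω, gain ξ μ i ω ≤ Real.log M + C * Real.log (1 + t) := by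
  have h1 := isClippedBet_betMinus hξ hb
  have h2 := isClippedBet_betPlus hξ hb
  set C₁ := 2 * (1 / ξ + 1 / (1 - (b * (1 - ξ) + ξ))) with hC₁
  set C₂ := 2 * (1 / (ξ * (1 - b)) + 1 / (1 - ξ)) with hC₂
  have p1 : 0 ≤ C₁ := by
    have := one_div_pos.2 h1.lo_pos
    have := one_div_pos.2 (sub_pos.2 h1.hi_lt)
    positivity
  have p2 : 0 ≤ C₂ := by
    have := one_div_pos.2 h2.lo_pos
    have := one_div_pos.2 (sub_pos.2 h2.hi_lt)
    positivity
  refine ⟨C₁ + C₂, add_nonneg p1 p2, fun a t ω M hm hp => ?_⟩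
  have hgain : ∑ i ∈ pulls 0 t a ω, gain ξ μ i ω =
      ∑ i ∈ pulls 0 t a ω, (bernKL (μ a) ξ + slope (μ a) ξ * (reward i ω - μ a)) := by
    refine Finset.sum_congr rfl fun i hi => ?_
    rw [gain, (Finset.mem_filter.1 hi).2]
  have hcard : Real.log (1 + (pulls 0 t a ω).card) ≤ Real.log (1 + t) := by
    refine Real.log_le_log (by positivity) ?_
    have := card_pulls_le t a ω
    gcongr
  have hl0 : 0 ≤ Real.log (1 + (pulls 0 t a ω).card) :=
    Real.log_nonneg (by simp)
  rw [hgain]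
  rcases le_total ξ (μ a) with h | h
  · have g := log_betProduct_ge h1 t a ω (x := μ a) ⟨h, (hμ a).2⟩
    have l := Real.log_le_log (betProduct_pos h1 t a ω) hm
    rw [← hC₁] at g
    nlinarith [mul_le_mul_of_nonneg_left hcard p1, mul_nonneg p2 (hl0.trans hcard)]
  · have g := log_betProduct_ge h2 t a ω (x := μ a) ⟨(hμ a).1, h⟩
    have l := Real.log_le_log (betProduct_pos h2 t a ω) hp
    rw [← hC₂] at g
    nlinarith [mul_le_mul_of_nonneg_left hcard p2, mul_nonneg p1 (hl0.trans hcard)]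

theorem sum_pulls_eq {K : ℕ} (t : ℕ) (ω : Path K) (f : ℕ → ℝ) :
    ∑ a, ∑ i ∈ pulls 0 t a ω, f i = ∑ i ∈ Finset.range t, f i := by
  simp only [pulls, Nat.Ico_zero_eq_range]
  exact Finset.sum_fiberwise _ _ _

/-- The centered part of the gain. -/
def noise {K : ℕ} (ξ : ℝ) (μ : Fin K → ℝ) (i : ℕ) (ω : Path K) : ℝ :=
  slope (μ (arm i ω)) ξ * (reward i ω - μ (arm i ω))

theorem measurable_comp_arm {K : ℕ} (f : Fin K → ℝ) (i : ℕ) :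
    Measurable[past K (i + 1)] fun ω : Path K => f (arm i ω) :=
  (measurable_of_finite f).comp (measurable_arm (Nat.lt_succ_self i))

theorem measurable_comp_arm_sup {K : ℕ} (f : Fin K → ℝ) (i : ℕ) :
    Measurable[past K i ⊔ MeasurableSpace.comap (arm i) ⊤] fun ω : Path K => f (arm i ω) := by
  refine Measurable.comp (g := f) measurable_from_top ?_
  exact ((comap_measurable (m := ⊤) (arm (K := K) i)).mono le_sup_right le_rfl)

theorem measurable_noise {K : ℕ} (ξ : ℝ) (μ : Fin K → ℝ) (i : ℕ) :
    Measurable[past K (i + 1)] (noise (K := K) ξ μ i) :=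
  (measurable_comp_arm (fun a => slope (μ a) ξ) i).mul
    ((measurable_reward (Nat.lt_succ_self i)).sub (measurable_comp_arm μ i))

theorem abs_noise_le {K : ℕ} {ξ : ℝ} {μ : Fin K → ℝ} (hμ : ∀ a, μ a ∈ Set.Icc (0 : ℝ) 1) {κ : ℝ}
    (hκ : ∀ a, |slope (μ a) ξ| ≤ κ) (i : ℕ) (ω : Path K) : |noise ξ μ i ω| ≤ κ := by
  have h1 : |reward i ω - μ (arm i ω)| ≤ 1 := by
    rw [abs_le]
    constructor <;> linarith [reward_nonneg i ω, reward_le_one i ω, (hμ (arm i ω)).1,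
      (hμ (arm i ω)).2]
  rw [noise, abs_mul]
  calc |slope (μ (arm i ω)) ξ| * |reward i ω - μ (arm i ω)| ≤ κ * 1 :=
        mul_le_mul (hκ _) h1 (abs_nonneg _) ((abs_nonneg _).trans (hκ (arm i ω)))
    _ = κ := mul_one κ

/-- Exponential moments of the noise. -/
theorem integral_exp_noise_le {K : ℕ} {π : Policy K} {ξ : ℝ} {μ : Fin K → ℝ}
    (hμ : ∀ a, μ a ∈ Set.Icc (0 : ℝ) 1) {κ : ℝ} (hκ : ∀ a, |slope (μ a) ξ| ≤ κ) {θ : ℝ}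
    (hθ : 0 ≤ θ) (hθκ : θ * κ ≤ 1) {Q : Measure (Path K)} (hQ : IsBanditLaw π μ Q) (u : ℕ) :
    Integrable (fun ω => Real.exp (-θ * ∑ i ∈ Finset.range u, noise ξ μ i ω)) Q ∧
    ∫ ω, Real.exp (-θ * ∑ i ∈ Finset.range u, noise ξ μ i ω) ∂Q ≤
      Real.exp (θ ^ 2 * κ ^ 2 * u) := by
  have := hQ.isProbabilityMeasure
  have hmeas : ∀ u, Measurable[past K u] fun ω : Path K =>
      Real.exp (-θ * ∑ i ∈ Finset.range u, noise ξ μ i ω) := fun u =>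
    Real.measurable_exp.comp ((Finset.measurable_sum _ fun i hi =>
      (measurable_noise ξ μ i).mono (past_mono (Finset.mem_range.1 hi)) le_rfl).const_mul _)
  have hbd : ∀ u ω, Real.exp (-θ * ∑ i ∈ Finset.range u, noise (K := K) ξ μ i ω) ≤
      Real.exp (θ * (u * κ)) := by
    intro u ω
    refine Real.exp_le_exp.2 ?_
    rw [neg_mul, ← mul_neg, ← Finset.sum_neg_distrib]
    refine mul_le_mul_of_nonneg_left ?_ hθ
    have := Finset.sum_le_card_nsmul (Finset.range u) (fun i => -noise ξ μ i ω) κ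
      fun i _ => (neg_le_abs _).trans (abs_noise_le hμ hκ i ω)
    simpa using this
  have hint : ∀ u, Integrable (fun ω =>
      Real.exp (-θ * ∑ i ∈ Finset.range u, noise ξ μ i ω)) Q := fun u =>
    Integrable.of_bound ((hmeas u).mono (past_le K u) le_rfl).aestronglyMeasurable _
      (Eventually.of_forall fun ω => by
        rw [Real.norm_of_nonneg (Real.exp_pos _).le]; exact hbd u ω)
  refine ⟨hint u, ?_⟩
  induction u with
  | zero => simp
  | succ u ih =>
    set f : Path K → ℝ := fun ω => Real.exp (-θ * ∑ i ∈ Finset.range u, noise ξ μ i ω) with hf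
    have hzero : ∫ ω, f ω * noise ξ μ u ω ∂Q = 0 := by
      have h := hQ.integral_mul_reward_sub (t := u)
        (f := fun ω => f ω * slope (μ (arm u ω)) ξ)
        ((measurable_sup_left (hmeas u)).mul
          (measurable_comp_arm_sup (fun a => slope (μ a) ξ) u))
        (M := Real.exp (θ * (u * κ)) * κ) (fun ω => by
          rw [abs_mul, abs_of_pos (Real.exp_pos _)]
          exact mul_le_mul (hbd u ω) (hκ _) (abs_nonneg _) (Real.exp_pos _).le)
      rw [← h]
      refine integral_congr_ae (Eventually.of_forall fun ω => ?_)
      simp only [noise]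
      ring
    have hnint : Integrable (fun ω => f ω * noise ξ μ u ω) Q :=
      (hint u).mul_bdd (c := κ)
        ((measurable_noise ξ μ u).mono (past_le K _) le_rfl).aestronglyMeasurable
        (Eventually.of_forall fun ω => abs_noise_le hμ hκ u ω)
    have hle : ∀ ω, Real.exp (-θ * ∑ i ∈ Finset.range (u + 1), noise ξ μ i ω) ≤
        (1 + θ ^ 2 * κ ^ 2) * f ω - θ * (f ω * noise ξ μ u ω) := by
      intro ω
      have hz : |-θ * noise ξ μ u ω| ≤ θ * κ := by
        rw [abs_mul, abs_neg, abs_of_nonneg hθ]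
        exact mul_le_mul_of_nonneg_left (abs_noise_le hμ hκ u ω) hθ
      have h1 := (abs_le.1 (Real.abs_exp_sub_one_sub_id_le (hz.trans hθκ))).2
      have h2 : (-θ * noise ξ μ u ω) ^ 2 ≤ θ ^ 2 * κ ^ 2 := by
        rw [← mul_pow, ← sq_abs]
        exact pow_le_pow_left₀ (abs_nonneg _) hz 2
      rw [Finset.sum_range_succ, mul_add, Real.exp_add]
      -- From `exp z ≤ 1 + z + z ^ 2` for `|z| ≤ 1`, which is why `θ * κ ≤ 1` is required. The
      -- linear term integrates to zero against the past.
      have h3 : Real.exp (-θ * noise ξ μ u ω) ≤ 1 + θ ^ 2 * κ ^ 2 - θ * noise ξ μ u ω := by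
        linarith
      have h4 := mul_le_mul_of_nonneg_left h3 (Real.exp_pos
        (-θ * ∑ i ∈ Finset.range u, noise ξ μ i ω)).le
      simp only [hf]
      linarith
    calc ∫ ω, Real.exp (-θ * ∑ i ∈ Finset.range (u + 1), noise ξ μ i ω) ∂Q
        ≤ ∫ ω, ((1 + θ ^ 2 * κ ^ 2) * f ω - θ * (f ω * noise ξ μ u ω)) ∂Q :=
          integral_mono (hint (u + 1)) (((hint u).const_mul _).sub (hnint.const_mul _)) hle
      _ = (1 + θ ^ 2 * κ ^ 2) * ∫ ω, f ω ∂Q := by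
          rw [integral_sub ((hint u).const_mul _) (hnint.const_mul _), integral_const_mul,
            integral_const_mul, hzero, mul_zero, sub_zero]
      _ ≤ Real.exp (θ ^ 2 * κ ^ 2) * Real.exp (θ ^ 2 * κ ^ 2 * u) := by
          refine mul_le_mul ?_ ih (integral_nonneg fun ω => (Real.exp_pos _).le)
            (Real.exp_pos _).le
          linarith [Real.add_one_le_exp (θ ^ 2 * κ ^ 2)]
      _ = Real.exp (θ ^ 2 * κ ^ 2 * (u + 1 : ℕ)) := by
          rw [← Real.exp_add]
          congr 1
          push_cast
          ring

/-- While no arm is labelled, the total gain is at most logarithmic in `M`. -/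
theorem sum_gain_le_of_alive {K : ℕ} {ξ b : ℝ} (hξ : ξ ∈ Set.Ioo (0 : ℝ) 1)
    (hb : b ∈ Set.Ioo (0 : ℝ) 1) {μ : Fin K → ℝ} {C : ℝ}
    (hC : ∀ (a : Fin K) (t : ℕ) (ω : Path K) (M : ℝ),
      eMinus ξ b 0 t a ω ≤ M → ePlus ξ b 0 t a ω ≤ M →
      ∑ i ∈ pulls 0 t a ω, gain ξ μ i ω ≤ Real.log M + C * Real.log (1 + t)) {M : ℝ} {n₀ : ℕ}
    (hM : (1 / ξ + 1 / (1 - ξ)) ^ n₀ ≤ M) {u : ℕ} {ω : Path K} (h : ω ∈ alive ξ b M n₀ u) :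
    ∑ i ∈ Finset.range u, gain ξ μ i ω ≤ K * (Real.log M + C * Real.log (1 + u)) := by
  rw [← sum_pulls_eq u ω fun i => gain ξ μ i ω]
  have := Finset.sum_le_card_nsmul (Finset.univ : Finset (Fin K))
    (fun a => ∑ i ∈ pulls 0 u a ω, gain ξ μ i ω) (Real.log M + C * Real.log (1 + u))
    fun a _ => hC a u ω M (le_of_alive hξ hb hM u ω h a).1 (le_of_alive hξ hb hM u ω h a).2
  simpa only [Finset.card_univ, Fintype.card_fin, nsmul_eq_mul] using this

/-- The tangent to the logarithm with slope `ε`: the logarithmic regret is absorbed into an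
arbitrarily small fraction of the linear drift. -/
theorem log_one_add_le {ε : ℝ} (hε : 0 < ε) (u : ℕ) :
    Real.log (1 + u) ≤ ε * u + (ε - 1 - Real.log ε) := by
  have h := Real.log_le_sub_one_of_pos (mul_pos hε (by positivity : (0 : ℝ) < 1 + u))
  rw [Real.log_mul hε.ne' (by positivity)] at h
  linarith

/-- The duration of an epoch has exponential tails beyond a multiple of `log M`, uniformly over
policies and bandit instances. -/
theorem exists_tail_bound {K : ℕ} {ξ b : ℝ} (hξ : ξ ∈ Set.Ioo (0 : ℝ) 1)
    (hb : b ∈ Set.Ioo (0 : ℝ) 1) {μ : Fin K → ℝ}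
    (hμ : ∀ a, μ a ∈ Set.Icc (ξ * (1 - b)) (b * (1 - ξ) + ξ)) (hμξ : ∀ a, μ a ≠ ξ) :
    ∃ C₁ γ : ℝ, 0 < C₁ ∧ 0 < γ ∧ ∀ (π : Policy K) (Q : Measure (Path K)), IsBanditLaw π μ Q →
      ∀ (M : ℝ) (n₀ : ℕ), (1 / ξ + 1 / (1 - ξ)) ^ n₀ ≤ M → 1 ≤ Real.log M →
        ∀ u : ℕ, C₁ * Real.log M ≤ u → Q.real (alive ξ b M n₀ u) ≤ Real.exp (-γ * u) := by
  obtain ⟨C, hC0, hC⟩ := exists_growth hξ hb hμ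
  have hμI : ∀ a, μ a ∈ Set.Ioo (0 : ℝ) 1 := fun a =>
    ⟨(mul_pos hξ.1 (sub_pos.2 hb.2)).trans_le (hμ a).1,
      (hμ a).2.trans_lt (by nlinarith [hξ.2, hb.2])⟩
  have hd : ∀ a, 0 < bernKL (μ a) ξ := fun a => bernKL_pos (hμI a) hξ (hμξ a)
  obtain ⟨d, hd0, hdle⟩ : ∃ d : ℝ, 0 < d ∧ ∀ a, d ≤ bernKL (μ a) ξ := by
    rcases isEmpty_or_nonempty (Fin K) with h | h
    · exact ⟨1, one_pos, fun a => h.elim a⟩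
    · obtain ⟨a₀, ha₀⟩ := Finite.exists_min fun a => bernKL (μ a) ξ
      exact ⟨_, hd a₀, ha₀⟩
  -- The summands `1` and `d` only ensure `1 ≤ κ` and `d ≤ κ`, so that `θ = d / (4 * κ ^ 2)`
  -- satisfies `θ * κ ≤ 1`. This `θ` makes the variance term `θ ^ 2 * κ ^ 2` equal to `θ * d / 4`.
  set κ := ∑ a, |slope (μ a) ξ| + 1 + d with hκdef
  have hκ : ∀ a, |slope (μ a) ξ| ≤ κ := fun a => by
    have := Finset.single_le_sum (f := fun a => |slope (μ a) ξ|) (fun b _ => abs_nonneg _)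
      (Finset.mem_univ a)
    linarith
  have hκ1 : 1 ≤ κ := by
    have := Finset.sum_nonneg (s := Finset.univ) fun (a : Fin K) _ => abs_nonneg (slope (μ a) ξ)
    linarith
  have hκd : d ≤ κ := by
    have := Finset.sum_nonneg (s := Finset.univ) fun (a : Fin K) _ => abs_nonneg (slope (μ a) ξ)
    linarith
  have hκ0 : 0 < κ := by linarith
  set θ := d / (4 * κ ^ 2) with hθdef
  have hθ0 : 0 < θ := by positivity
  have hθκ : θ * κ ≤ 1 := by
    rw [hθdef, div_mul_eq_mul_div, div_le_one (by positivity)]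
    nlinarith
  have hθ2 : θ ^ 2 * κ ^ 2 = θ * (d / 4) := by
    rw [hθdef]
    field_simp
  have hKC : 0 ≤ K * C := by positivity
  set ε := d / (4 * (K * C + 1)) with hεdef
  have hε0 : 0 < ε := by positivity
  have hεd : K * C * ε ≤ d / 4 := by
    rw [hεdef, mul_div_assoc', div_le_div_iff₀ (by positivity) (by norm_num)]
    nlinarith
  set C₅ := K * C * |ε - 1 - Real.log ε| with hC₅
  have hC₅0 : 0 ≤ C₅ := by positivity
  refine ⟨4 / d * (K + C₅) + 1, θ * (d / 4), by positivity, by positivity, ?_⟩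
  intro π Q hQ M n₀ hM hlog u hu
  have := hQ.isProbabilityMeasure
  have hu' : K * Real.log M + C₅ ≤ u * (d / 4) := by
    have h1 : 4 / d * (K + C₅) * Real.log M ≤ u := by nlinarith
    have h2 : (K + C₅) * Real.log M ≤ u * (d / 4) := by
      have h3 := mul_le_mul_of_nonneg_right h1 (by positivity : 0 ≤ d / 4)
      have h4 : 4 / d * (K + C₅) * Real.log M * (d / 4) = (K + C₅) * Real.log M := by
        field_simp
      linarith
    nlinarith
  -- Survival forces the noise far below zero. The drift is at least `u * d`; a quarter of it pays
  -- for `K * log M` and constants, another quarter for the logarithmic regret, so the noise is at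
  -- most `-u * d / 2`. Chernoff's bound against `θ * d / 4` leaves the rate `γ = θ * d / 4`.
  have hW : ∀ ω ∈ alive (K := K) ξ b M n₀ u,
      Real.exp (θ * (u * (d / 2))) ≤
        Real.exp (-θ * ∑ i ∈ Finset.range u, noise ξ μ i ω) := by
    intro ω hω
    have h1 := sum_gain_le_of_alive hξ hb hC hM hω
    have h2 : u * d + ∑ i ∈ Finset.range u, noise ξ μ i ω ≤
        ∑ i ∈ Finset.range u, gain ξ μ i ω := by
      have : ∑ i ∈ Finset.range u, gain ξ μ i ω =
          ∑ i ∈ Finset.range u, bernKL (μ (arm i ω)) ξ +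
            ∑ i ∈ Finset.range u, noise ξ μ i ω := by
        rw [← Finset.sum_add_distrib]
        rfl
      rw [this]
      have h3 := Finset.card_nsmul_le_sum (Finset.range u) (fun i => bernKL (μ (arm i ω)) ξ) d
        fun i _ => hdle _
      simp only [Finset.card_range, nsmul_eq_mul] at h3
      linarith
    have h4 := log_one_add_le hε0 u
    have h5 := mul_le_mul_of_nonneg_left h4 hKC
    have h6 : K * C * (ε - 1 - Real.log ε) ≤ C₅ :=
      mul_le_mul_of_nonneg_left (le_abs_self _) hKC
    have h7 : K * C * ε * u ≤ d / 4 * u := mul_le_mul_of_nonneg_right hεd (Nat.cast_nonneg u)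
    refine Real.exp_le_exp.2 ?_
    rw [neg_mul, ← mul_neg]
    refine mul_le_mul_of_nonneg_left ?_ hθ0.le
    nlinarith
  obtain ⟨hint, hexp⟩ := integral_exp_noise_le (fun a => Set.Ioo_subset_Icc_self (hμI a)) hκ
    hθ0.le hθκ hQ u
  have hmarkov := mul_meas_ge_le_integral_of_nonneg (μ := Q)
    (Eventually.of_forall fun ω => (Real.exp_pos _).le) hint (Real.exp (θ * (u * (d / 2))))
  have hmono : Q.real (alive ξ b M n₀ u) ≤ Q.real {ω | Real.exp (θ * (u * (d / 2))) ≤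
      Real.exp (-θ * ∑ i ∈ Finset.range u, noise ξ μ i ω)} := measureReal_mono hW
  have h1 : Real.exp (θ * (u * (d / 2))) * Q.real (alive ξ b M n₀ u) ≤
      Real.exp (θ ^ 2 * κ ^ 2 * u) :=
    ((mul_le_mul_of_nonneg_left hmono (Real.exp_pos _).le).trans hmarkov).trans hexp
  rw [hθ2] at h1
  have h2 : Real.exp (-(θ * (d / 4)) * u) =
      Real.exp (θ * (d / 4) * u) / Real.exp (θ * (u * (d / 2))) := by
    rw [← Real.exp_sub]
    congr 1
    ring
  rw [h2, le_div_iff₀ (Real.exp_pos _)]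
  linarith

/-! ### The expected number of pulls of the best arm in an epoch -/

/-- Before the last round of the epoch the e-processes are below `M`, so the gain is controlled by
`exists_growth`. The round that ends the epoch may overshoot, by one bounded gain `C'` at most. -/
theorem sum_alive_gain_le {K : ℕ} {ξ b : ℝ} (hξ : ξ ∈ Set.Ioo (0 : ℝ) 1)
    (hb : b ∈ Set.Ioo (0 : ℝ) 1) {μ : Fin K → ℝ} {C : ℝ} (hC0 : 0 ≤ C)
    (hC : ∀ (a : Fin K) (t : ℕ) (ω : Path K) (M : ℝ),
      eMinus ξ b 0 t a ω ≤ M → ePlus ξ b 0 t a ω ≤ M →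
      ∑ i ∈ pulls 0 t a ω, gain ξ μ i ω ≤ Real.log M + C * Real.log (1 + t)) {M : ℝ} {n₀ : ℕ}
    (hM : (1 / ξ + 1 / (1 - ξ)) ^ n₀ ≤ M) {C' : ℝ} (hC' : ∀ i ω, gain (K := K) ξ μ i ω ≤ C')
    (hC'0 : 0 ≤ C') (a : Fin K) (N : ℕ) (ω : Path K) :
    ∑ u ∈ Finset.range N, (alive ξ b M n₀ u ∩ {ω | arm u ω = a}).indicator (gain ξ μ u) ω ≤
      Real.log M + C * Real.log (1 + N) + C' := by
  have halive : ∀ N, ω ∈ alive ξ b M n₀ N →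
      ∑ u ∈ Finset.range N, (alive ξ b M n₀ u ∩ {ω | arm u ω = a}).indicator (gain ξ μ u) ω ≤
        Real.log M + C * Real.log (1 + N) := by
    intro N hN
    refine le_trans (le_of_eq ?_) (hC a N ω M (le_of_alive hξ hb hM N ω hN a).1
      (le_of_alive hξ hb hM N ω hN a).2)
    rw [pulls, Nat.Ico_zero_eq_range, Finset.sum_filter]
    refine Finset.sum_congr rfl fun u hu => ?_
    have h1 : ω ∈ alive ξ b M n₀ u := alive_antitone ξ b M n₀ (Finset.mem_range.1 hu).le hN
    by_cases h2 : arm u ω = a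
    · simp [h1, h2]
    · simp [h2]
  induction N with
  | zero =>
    have := halive 0 (fun v hv => absurd hv (Nat.not_lt_zero v))
    linarith
  | succ n ih =>
    by_cases h1 : ω ∈ alive ξ b M n₀ (n + 1)
    · linarith [halive _ h1]
    have hmono : Real.log (1 + n) ≤ Real.log (1 + (n + 1 : ℕ)) :=
      Real.log_le_log (by positivity) (by push_cast; linarith)
    have hmono' := mul_le_mul_of_nonneg_left hmono hC0
    rw [Finset.sum_range_succ]
    by_cases h2 : ω ∈ alive ξ b M n₀ n
    · have h3 := halive n h2
      have h4 : (alive ξ b M n₀ n ∩ {ω | arm n ω = a}).indicator (gain ξ μ n) ω ≤ C' := by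
        by_cases h : ω ∈ alive ξ b M n₀ n ∩ {ω | arm n ω = a}
        · rw [Set.indicator_of_mem h]; exact hC' n ω
        · rw [Set.indicator_of_notMem h]; exact hC'0
      linarith
    · have h3 : ω ∉ alive ξ b M n₀ n ∩ {ω | arm n ω = a} := fun h => h2 h.1
      rw [Set.indicator_of_notMem h3]
      linarith

theorem gain_eq {K : ℕ} (ξ : ℝ) (μ : Fin K → ℝ) (i : ℕ) (ω : Path K) :
    gain ξ μ i ω = bernKL (μ (arm i ω)) ξ + noise ξ μ i ω := rfl

theorem exists_gain_le {K : ℕ} (ξ : ℝ) {μ : Fin K → ℝ} (hμ : ∀ a, μ a ∈ Set.Icc (0 : ℝ) 1) :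
    ∃ C' : ℝ, 0 ≤ C' ∧ ∀ i ω, |gain (K := K) ξ μ i ω| ≤ C' := by
  refine ⟨∑ a, |bernKL (μ a) ξ| + ∑ a, |slope (μ a) ξ|, ?_, fun i ω => ?_⟩
  · exact add_nonneg (Finset.sum_nonneg fun _ _ => abs_nonneg _)
      (Finset.sum_nonneg fun _ _ => abs_nonneg _)
  · have h1 := abs_noise_le hμ (ξ := ξ) (fun a => Finset.single_le_sum
      (f := fun a => |slope (μ a) ξ|) (fun b _ => abs_nonneg _) (Finset.mem_univ a)) i ω
    have h2 := Finset.single_le_sum (f := fun a => |bernKL (μ a) ξ|) (fun b _ => abs_nonneg _)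
      (Finset.mem_univ (arm i ω))
    rw [gain_eq]
    exact (abs_add_le _ _).trans (add_le_add h2 h1)

/-- Wald's identity: whether the epoch is alive before round `u` is known from the past, so each
pull of `a` contributes exactly the divergence to the expected gain, and the pathwise bound on the
gain is integrated. -/
theorem sum_alive_arm_le {K : ℕ} {π : Policy K} {ξ b : ℝ} (hξ : ξ ∈ Set.Ioo (0 : ℝ) 1)
    (hb : b ∈ Set.Ioo (0 : ℝ) 1) {μ : Fin K → ℝ} {C : ℝ} (hC0 : 0 ≤ C)
    (hC : ∀ (a : Fin K) (t : ℕ) (ω : Path K) (M : ℝ),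
      eMinus ξ b 0 t a ω ≤ M → ePlus ξ b 0 t a ω ≤ M →
      ∑ i ∈ pulls 0 t a ω, gain ξ μ i ω ≤ Real.log M + C * Real.log (1 + t)) {M : ℝ} {n₀ : ℕ}
    (hM : (1 / ξ + 1 / (1 - ξ)) ^ n₀ ≤ M) {C' : ℝ} (hC' : ∀ i ω, |gain (K := K) ξ μ i ω| ≤ C')
    (hC'0 : 0 ≤ C') {Q : Measure (Path K)} (hQ : IsBanditLaw π μ Q) (a : Fin K) (N : ℕ) :
    bernKL (μ a) ξ * ∑ u ∈ Finset.range N, Q.real (alive ξ b M n₀ u ∩ {ω | arm u ω = a}) ≤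
      Real.log M + C * Real.log (1 + N) + C' := by
  have := hQ.isProbabilityMeasure
  have hm : ∀ u, MeasurableSet (alive (K := K) ξ b M n₀ u ∩ {ω | arm u ω = a}) := fun u =>
    (past_le K u _ (measurableSet_alive ξ b M n₀ u)).inter (measurableSet_arm' u a)
  have hgm : ∀ u, Measurable (gain (K := K) ξ μ u) := fun u =>
    ((measurable_comp_arm (fun a => bernKL (μ a) ξ) u).add (measurable_noise ξ μ u)).mono
      (past_le K _) le_rfl
  have hgi : ∀ u, Integrable (gain (K := K) ξ μ u) Q := fun u =>
    Integrable.of_bound (hgm u).aestronglyMeasurable C' (Eventually.of_forall fun ω => hC' u ω)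
  have hterm : ∀ u, ∫ ω, (alive ξ b M n₀ u ∩ {ω | arm u ω = a}).indicator (gain ξ μ u) ω ∂Q =
      bernKL (μ a) ξ * Q.real (alive ξ b M n₀ u ∩ {ω | arm u ω = a}) := by
    intro u
    rw [integral_indicator (hm u), setIntegral_congr_fun
      (g := fun ω => reward u ω * slope (μ a) ξ + (bernKL (μ a) ξ - slope (μ a) ξ * μ a)) (hm u)
      (fun ω hω => by
        have : arm u ω = a := hω.2
        simp only [gain, this]
        ring),
      integral_add ((integrable_reward u Q).mul_const _).integrableOn (integrable_const _),
      integral_mul_const, setIntegral_reward hQ a (measurableSet_alive ξ b M n₀ u)]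
    simp only [integral_const, smul_eq_mul, measureReal_restrict_apply_univ]
    ring
  have h1 := integral_mono (μ := Q) (integrable_finsetSum (Finset.range N) fun u _ =>
    (hgi u).indicator (hm u)) (integrable_const (Real.log M + C * Real.log (1 + N) + C'))
    (fun ω => sum_alive_gain_le hξ hb hC0 hC hM (fun i ω => (le_abs_self _).trans (hC' i ω))
      hC'0 a N ω)
  rw [integral_finsetSum _ fun u _ => (hgi u).indicator (hm u),
    Finset.sum_congr rfl fun u _ => hterm u, ← Finset.mul_sum] at h1
  simpa using h1

theorem sum_one_div_succ_le (R : ℕ) :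
    ∑ u ∈ Finset.range R, 1 / ((u : ℝ) + 1) ≤ 2 * Real.log (1 + R) := by
  induction R with
  | zero => simp
  | succ n ih =>
    rw [Finset.sum_range_succ]
    have := one_div_succ_le_log n
    push_cast
    linarith

/-- Horizon-free regret minimization enters here: the bounds `c / (t + 1)` sum to a logarithm of the
horizon `R`. -/
theorem sum_alive_ne_le {K : ℕ} {ξ b : ℝ} {M : ℝ} {n₀ : ℕ} {Q : Measure (Path K)}
    [IsProbabilityMeasure Q] {a : Fin K} {c : ℝ} (hc0 : 0 ≤ c)
    (hc : ∀ t : ℕ, Q {ω | arm t ω ≠ a} ≤ ENNReal.ofReal (c / ((t : ℝ) + 1))) (R : ℕ) :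
    ∑ u ∈ Finset.range R, Q.real (alive ξ b M n₀ u ∩ {ω | arm u ω ≠ a}) ≤
      c * (2 * Real.log (1 + R)) := by
  refine le_trans (Finset.sum_le_sum fun u _ => ?_)
    ((Finset.mul_sum _ _ c).symm.le.trans (mul_le_mul_of_nonneg_left (sum_one_div_succ_le R) hc0))
  rw [mul_one_div]
  exact (measureReal_mono Set.inter_subset_right).trans
    (ENNReal.toReal_le_of_le_ofReal (by positivity) (hc u))

/-! ### Wrong labels -/

/-- The epoch ends at the round of index `u`, but not with the correct label for `a`. -/
def wrongLabel {K : ℕ} (ξ b M : ℝ) (μ : Fin K → ℝ) (a : Fin K) (n₀ u : ℕ) : Set (Path K) :=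
  alive ξ b M n₀ u ∩ {ω | n₀ ≤ u ∧
    ((arm u ω ≠ a ∧ (M ≤ eMinus ξ b 0 (u + 1) (arm u ω) ω ∨
      M < ePlus ξ b 0 (u + 1) (arm u ω) ω)) ∨
    (arm u ω = a ∧ ((ξ < μ a ∧ M < ePlus ξ b 0 (u + 1) (arm u ω) ω) ∨
      (μ a < ξ ∧ M ≤ eMinus ξ b 0 (u + 1) (arm u ω) ω))))}

theorem measurableSet_wrongLabel {K : ℕ} (ξ b M : ℝ) (μ : Fin K → ℝ) (a : Fin K) (n₀ u : ℕ) :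
    MeasurableSet[past K (u + 1)] (wrongLabel ξ b M μ a n₀ u) := by
  have h1 : MeasurableSet[past K (u + 1)]
      {ω : Path K | M ≤ eMinus ξ b 0 (u + 1) (arm u ω) ω} :=
    (measurable_eMinus_arm (K := K) ξ b u) measurableSet_Ici
  have h2 : MeasurableSet[past K (u + 1)]
      {ω : Path K | M < ePlus ξ b 0 (u + 1) (arm u ω) ω} :=
    (measurable_ePlus_arm (K := K) ξ b u) measurableSet_Ioi
  have h3 := measurableSet_arm (Nat.lt_succ_self u) a
  have hc : ∀ p : Prop, MeasurableSet[past K (u + 1)] {_ω : Path K | p} := fun p =>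
    @MeasurableSet.const _ (past K (u + 1)) p
  exact (past_mono (Nat.le_succ u) _ (measurableSet_alive ξ b M n₀ u)).inter
    ((hc _).inter ((h3.compl.inter (h1.union h2)).union
      (h3.inter (((hc _).inter h2).union ((hc _).inter h1)))))

/-- E-processes with bets in the wrong direction have expectation at most one. -/
theorem integral_betProduct_le_one {K : ℕ} {π : Policy K} {ξ lo hi : ℝ} {β : ℝ → ℝ}
    (hβ : IsClippedBet ξ lo hi β) (hβm : Measurable β) {μ : Fin K → ℝ} {a : Fin K}
    (hβμ : ∀ x, β x * (μ a - ξ) ≤ 0) {Q : Measure (Path K)} (hQ : IsBanditLaw π μ Q) (t : ℕ) :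
    Integrable (betProduct ξ β t a) Q ∧ ∫ ω, betProduct ξ β t a ω ∂Q ≤ 1 := by
  have := hQ.isProbabilityMeasure
  have hξ : ξ ∈ Set.Ioo (0 : ℝ) 1 :=
    ⟨hβ.lo_pos.trans_le hβ.lo_le, hβ.le_hi.trans_lt hβ.hi_lt⟩
  have hm : ∀ t, Measurable[past K t] (betProduct (K := K) ξ β t a) := fun t =>
    measurable_eProcess ξ 0 t a hβm
  have hbd : ∀ t ω, |betProduct (K := K) ξ β t a ω| ≤ (1 / ξ + 1 / (1 - ξ)) ^ t := by
    intro t ω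
    rw [abs_of_pos (betProduct_pos hβ t a ω)]
    exact (betProduct_le_pow hβ t a ω).trans
      (pow_le_pow_right₀ (one_le_factor_bound hξ) (card_pulls_le t a ω))
  have hint : ∀ t, Integrable (betProduct (K := K) ξ β t a) Q := fun t =>
    Integrable.of_bound ((hm t).mono (past_le K t) le_rfl).aestronglyMeasurable _
      (Eventually.of_forall fun ω => hbd t ω)
  refine ⟨hint t, ?_⟩
  induction t with
  | zero => simp [betProduct, pulls]
  | succ t ih =>
    classical
    have h0 : 0 < ξ * (1 - ξ) := mul_pos hξ.1 (sub_pos.2 hξ.2)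
    have hββ : ∀ x, |β x| ≤ 1 / (ξ * (1 - ξ)) := by
      intro x
      have h1 := hβ.bet_eq x
      have h2 := Icc_subset_Ioo hβ (clip_mem hβ x)
      have h3 : |β x| * (ξ * (1 - ξ)) = |β x * (ξ * (1 - ξ))| := by
        rw [abs_mul, abs_of_pos h0]
      rw [le_div_iff₀ h0, h3, abs_le]
      constructor <;> linarith [h2.1, h2.2, hξ.1, hξ.2]
    set f : Path K → ℝ := fun ω => {ω | arm t ω = a}.indicator (fun ω =>
      betProduct ξ β t a ω * β (empMean ξ 0 t a ω)) ω with hf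
    have hfm : Measurable[past K t ⊔ MeasurableSpace.comap (arm t) ⊤] f :=
      (measurable_sup_left ((hm t).mul (hβm.comp (measurable_empMean ξ le_rfl a)))).indicator
        (measurableSet_sup_arm a)
    have hfb : ∀ ω, |f ω| ≤ (1 / ξ + 1 / (1 - ξ)) ^ t * (1 / (ξ * (1 - ξ))) := by
      intro ω
      have hp : (0 : ℝ) ≤ (1 / ξ + 1 / (1 - ξ)) ^ t := (abs_nonneg _).trans (hbd t ω)
      by_cases h : arm t ω = a
      · have : f ω = betProduct ξ β t a ω * β (empMean ξ 0 t a ω) := by simp [hf, h]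
        rw [this, abs_mul]
        exact mul_le_mul (hbd t ω) (hββ _) (abs_nonneg _) hp
      · have : f ω = 0 := by simp [hf, h]
        rw [this, abs_zero]
        positivity
    have hzero := hQ.integral_mul_reward_sub hfm hfb
    -- Replacing `ξ` by `μ a` in the new factor can only increase it, by the sign hypothesis on the
    -- bets; afterwards the increment is a martingale difference.
    have hle : ∀ ω, betProduct ξ β (t + 1) a ω ≤
        betProduct ξ β t a ω + f ω * (reward t ω - μ (arm t ω)) := by
      intro ω
      by_cases h : arm t ω = a
      · have : f ω = betProduct ξ β t a ω * β (empMean ξ 0 t a ω) := by simp [hf, h]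
        rw [betProduct_succ_self ξ β h, this, h]
        have := mul_le_mul_of_nonneg_left (hβμ (empMean ξ 0 t a ω)) (betProduct_pos hβ t a ω).le
        nlinarith
      · have : f ω = 0 := by simp [hf, h]
        rw [betProduct_succ_of_ne ξ β h, this]
        simp
    have hfi : Integrable (fun ω => f ω * (reward t ω - μ (arm t ω))) Q := by
      refine Integrable.bdd_mul (c := (1 / ξ + 1 / (1 - ξ)) ^ t * (1 / (ξ * (1 - ξ)))) ?_
        (hfm.mono (past_sup_arm_le K t) le_rfl).aestronglyMeasurable (Eventually.of_forall hfb)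
      refine (integrable_reward t Q).sub (Integrable.of_bound
        ((measurable_comp_arm μ t).mono (past_le K _) le_rfl).aestronglyMeasurable
        (∑ a, |μ a|) (Eventually.of_forall fun ω => ?_))
      exact Finset.single_le_sum (f := fun a => |μ a|) (fun b _ => abs_nonneg _)
        (Finset.mem_univ (arm t ω))
    calc ∫ ω, betProduct ξ β (t + 1) a ω ∂Q
        ≤ ∫ ω, (betProduct ξ β t a ω + f ω * (reward t ω - μ (arm t ω))) ∂Q :=
          integral_mono (hint (t + 1)) ((hint t).add hfi) hle
      _ ≤ 1 := by
          rw [integral_add (hint t) hfi, hzero, add_zero]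
          exact ih

theorem betMinus_nonneg {ξ b : ℝ} (hξ : ξ ∈ Set.Ioo (0 : ℝ) 1) (hb : b ∈ Set.Ioo (0 : ℝ) 1)
    (x : ℝ) : 0 ≤ betMinus ξ b x :=
  le_min (div_pos hb.1 hξ.1).le (le_max_right _ _)

theorem betPlus_nonpos {ξ b : ℝ} (x : ℝ) : betPlus ξ b x ≤ 0 := min_le_left _ _

theorem real_le_inv_of_betProduct {K : ℕ} {π : Policy K} {ξ lo hi : ℝ} {β : ℝ → ℝ}
    (hβ : IsClippedBet ξ lo hi β) (hβm : Measurable β) {μ : Fin K → ℝ} {a : Fin K}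
    (hβμ : ∀ x, β x * (μ a - ξ) ≤ 0) {Q : Measure (Path K)} (hQ : IsBanditLaw π μ Q) {M : ℝ}
    (hM : 0 < M) (t : ℕ) : Q.real {ω | M ≤ betProduct ξ β t a ω} ≤ 1 / M := by
  obtain ⟨h1, h2⟩ := integral_betProduct_le_one hβ hβm hβμ hQ t
  have h3 := mul_meas_ge_le_integral_of_nonneg
    (Eventually.of_forall fun ω => (betProduct_pos hβ t a ω).le) h1 M
  rw [le_div_iff₀ hM, mul_comm]
  exact h3.trans h2

/-- Labelling an arm different from `a` requires many pulls of such arms. -/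
theorem sum_indicator_other_le {K : ℕ} {ξ b : ℝ} (hξ : ξ ∈ Set.Ioo (0 : ℝ) 1)
    (hb : b ∈ Set.Ioo (0 : ℝ) 1) {M : ℝ} (hM0 : 0 < M) (hM : 0 < Real.log M) {n₀ : ℕ}
    (a : Fin K) (R : ℕ)
    (ω : Path K) :
    ∑ u ∈ Finset.range R, (alive ξ b M n₀ u ∩ {ω | n₀ ≤ u ∧ arm u ω ≠ a ∧
        (M ≤ eMinus ξ b 0 (u + 1) (arm u ω) ω ∨
          M < ePlus ξ b 0 (u + 1) (arm u ω) ω)}).indicator (fun _ => (1 : ℝ)) ω ≤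
      Real.log (1 / ξ + 1 / (1 - ξ)) / Real.log M *
        ∑ u ∈ Finset.range R,
          (alive ξ b M n₀ u ∩ {ω | arm u ω ≠ a}).indicator (fun _ => (1 : ℝ)) ω := by
  classical
  set W : ℕ → Set (Path K) := fun u => alive ξ b M n₀ u ∩ {ω | n₀ ≤ u ∧ arm u ω ≠ a ∧
        (M ≤ eMinus ξ b 0 (u + 1) (arm u ω) ω ∨ M < ePlus ξ b 0 (u + 1) (arm u ω) ω)} with hW
  have hB := one_le_factor_bound hξ
  have hBl : 0 ≤ Real.log (1 / ξ + 1 / (1 - ξ)) := Real.log_nonneg hB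
  by_cases hex : ∃ u ∈ Finset.range R, ω ∈ W u
  · obtain ⟨u, hu, hωu⟩ := hex
    -- An epoch ends only once, since crossing the threshold at `v` contradicts being alive later.
    have hle1 : ∑ v ∈ Finset.range R, (W v).indicator (fun _ => (1 : ℝ)) ω ≤ 1 := by
      rw [Finset.sum_eq_single u]
      · simp [hωu]
      · intro v _ hvu
        refine Set.indicator_of_notMem (fun hωv => ?_) _
        have key : ∀ v w, v < w → ω ∈ W v → ω ∈ W w → False := by
          intro v w hvw hv hw
          have h1 := hw.1 v hvw hv.2.1
          rcases hv.2.2.2 with h | h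
          · exact absurd h1.1 (not_lt.2 h)
          · exact absurd h1.2 (not_le.2 h)
        rcases lt_or_gt_of_ne hvu with h | h
        · exact key v u h hωv hωu
        · exact key u v h hωu hωv
      · exact fun h => absurd hu h
    refine hle1.trans ?_
    -- Each factor is bounded, so reaching `M` takes at least `log M` divided by the logarithm of
    -- that bound many pulls, all of them pulls of an arm other than `a`.
    have hpow : M ≤ (1 / ξ + 1 / (1 - ξ)) ^ (pulls 0 (u + 1) (arm u ω) ω).card := by
      rcases hωu.2.2.2 with h | h
      · exact h.trans (betProduct_le_pow (isClippedBet_betMinus hξ hb) _ _ _)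
      · exact h.le.trans (betProduct_le_pow (isClippedBet_betPlus hξ hb) _ _ _)
    have hlog := Real.log_le_log hM0 hpow
    rw [Real.log_pow] at hlog
    have hcard : ((pulls 0 (u + 1) (arm u ω) ω).card : ℝ) ≤ ∑ v ∈ Finset.range R,
        (alive ξ b M n₀ v ∩ {ω | arm v ω ≠ a}).indicator (fun _ => (1 : ℝ)) ω := by
      have hsub : pulls 0 (u + 1) (arm u ω) ω ⊆
          (Finset.range R).filter fun v => ω ∈ alive ξ b M n₀ v ∩ {ω | arm v ω ≠ a} := by
        intro v hv
        obtain ⟨hv1, hv2⟩ := Finset.mem_filter.1 hv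
        have hvu : v ≤ u := Nat.lt_succ_iff.1 (Finset.mem_Ico.1 hv1).2
        refine Finset.mem_filter.2 ⟨Finset.mem_range.2 (hvu.trans_lt (Finset.mem_range.1 hu)),
          alive_antitone ξ b M n₀ hvu hωu.1, ?_⟩
        show arm v ω ≠ a
        rw [hv2]
        exact hωu.2.2.1
      calc ((pulls 0 (u + 1) (arm u ω) ω).card : ℝ) ≤ ((Finset.range R).filter fun v =>
            ω ∈ alive ξ b M n₀ v ∩ {ω | arm v ω ≠ a}).card := by
              exact_mod_cast Finset.card_le_card hsub
        _ = _ := by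
          rw [Finset.card_filter, Nat.cast_sum]
          refine Finset.sum_congr rfl fun v _ => ?_
          simp only [Set.indicator_apply, Nat.cast_ite, Nat.cast_one, Nat.cast_zero]
    rw [div_mul_eq_mul_div, le_div_iff₀ hM, one_mul]
    nlinarith
  · have h0 : ∑ v ∈ Finset.range R, (W v).indicator (fun _ => (1 : ℝ)) ω = 0 :=
      Finset.sum_eq_zero fun v hv => Set.indicator_of_notMem (fun h => hex ⟨v, hv, h⟩) _
    rw [h0]
    exact mul_nonneg (div_nonneg hBl hM.le)
      (Finset.sum_nonneg fun v _ => Set.indicator_nonneg (fun _ _ => zero_le_one) ω)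

/-! ### Expected duration of an epoch and probability of an incorrect label -/

theorem tsum_measure_le_ofReal {K : ℕ} {Q : Measure (Path K)} [IsFiniteMeasure Q]
    {W : ℕ → Set (Path K)} {X : ℝ} (h : ∀ N, ∑ u ∈ Finset.range N, Q.real (W u) ≤ X) :
    ∑' u, Q (W u) ≤ ENNReal.ofReal X := by
  refine ENNReal.tsum_le_of_sum_range_le fun N => ?_
  calc ∑ u ∈ Finset.range N, Q (W u) = ∑ u ∈ Finset.range N, ENNReal.ofReal (Q.real (W u)) :=
        Finset.sum_congr rfl fun u _ => (ofReal_measureReal (measure_ne_top Q _)).symm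
    _ = ENNReal.ofReal (∑ u ∈ Finset.range N, Q.real (W u)) :=
        (ENNReal.ofReal_sum_of_nonneg fun _ _ => measureReal_nonneg).symm
    _ ≤ _ := ENNReal.ofReal_le_ofReal (h N)

/-- Half of the exponent is spent on the factor `exp (-γ R / 2)`, the other half on summability. -/
theorem sum_range_le_of_tail {f : ℕ → ℝ} {γ : ℝ} (hγ : 0 < γ) {R : ℕ}
    (htail : ∀ u, R ≤ u → f u ≤ Real.exp (-γ * u)) (hf0 : ∀ u, 0 ≤ f u) (N : ℕ) :
    ∑ u ∈ Finset.range N, f u ≤ ∑ u ∈ Finset.range R, f u +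
      Real.exp (-(γ / 2) * R) * (1 - Real.exp (-(γ / 2)))⁻¹ := by
  set r := Real.exp (-(γ / 2)) with hr
  have hr0 : 0 ≤ r := (Real.exp_pos _).le
  have hr1 : r < 1 := Real.exp_lt_one_iff.2 (by linarith)
  have hpow : ∀ u : ℕ, r ^ u = Real.exp (-(γ / 2) * u) := fun u => by
    rw [hr, ← Real.exp_nat_mul, mul_comm]
  have hle : ∀ u, f u ≤ (if u < R then f u else 0) + Real.exp (-(γ / 2) * R) * r ^ u := by
    intro u
    by_cases hu : u < R
    · simp only [hu, if_true]
      have : 0 ≤ Real.exp (-(γ / 2) * R) * r ^ u := by positivity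
      linarith
    · simp only [hu, if_false, zero_add]
      refine (htail u (not_lt.1 hu)).trans ?_
      rw [hpow, ← Real.exp_add]
      refine Real.exp_le_exp.2 ?_
      have : (R : ℝ) ≤ u := by exact_mod_cast not_lt.1 hu
      nlinarith
  refine (Finset.sum_le_sum fun u _ => hle u).trans ?_
  rw [Finset.sum_add_distrib, ← Finset.mul_sum]
  refine add_le_add ?_ (mul_le_mul_of_nonneg_left ?_ (Real.exp_pos _).le)
  · rw [← Finset.sum_filter]
    exact Finset.sum_le_sum_of_subset_of_nonneg
      (fun u hu => Finset.mem_range.2 (Finset.mem_filter.1 hu).2) fun u _ _ => hf0 u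
  · rw [← tsum_geometric_of_lt_one hr0 hr1]
    exact (summable_geometric_of_lt_one hr0 hr1).sum_le_tsum _ fun u _ => by positivity

/-- Two ways to go wrong. Another arm is labelled, which needs many pulls of other arms; or `a`
itself gets the wrong label, that is, the e-process against a true hypothesis reaches `M`. Markov's
inequality bounds the latter by `1 / M` in each of `R` rounds. -/
theorem sum_wrongLabel_le {K : ℕ} {π : Policy K} {ξ b : ℝ} (hξ : ξ ∈ Set.Ioo (0 : ℝ) 1)
    (hb : b ∈ Set.Ioo (0 : ℝ) 1) {μ : Fin K → ℝ} {M : ℝ} (hM0 : 0 < M) (hM : 0 < Real.log M)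
    {n₀ : ℕ} {Q : Measure (Path K)} (hQ : IsBanditLaw π μ Q) (a : Fin K) (R : ℕ) :
    ∑ u ∈ Finset.range R, Q.real (wrongLabel ξ b M μ a n₀ u) ≤
      Real.log (1 / ξ + 1 / (1 - ξ)) / Real.log M *
        ∑ u ∈ Finset.range R, Q.real (alive ξ b M n₀ u ∩ {ω | arm u ω ≠ a}) + R / M := by
  have := hQ.isProbabilityMeasure
  set W : ℕ → Set (Path K) := fun u => alive ξ b M n₀ u ∩ {ω | n₀ ≤ u ∧ arm u ω ≠ a ∧
        (M ≤ eMinus ξ b 0 (u + 1) (arm u ω) ω ∨ M < ePlus ξ b 0 (u + 1) (arm u ω) ω)} with hW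
  have hal : ∀ u, MeasurableSet (alive (K := K) ξ b M n₀ u) := fun u =>
    past_le K u _ (measurableSet_alive ξ b M n₀ u)
  have hWm : ∀ u, MeasurableSet (W u) := fun u => by
    have h1 : MeasurableSet {ω : Path K | M ≤ eMinus ξ b 0 (u + 1) (arm u ω) ω} :=
      past_le K (u + 1) _ ((measurable_eMinus_arm (K := K) ξ b u) measurableSet_Ici)
    have h2 : MeasurableSet {ω : Path K | M < ePlus ξ b 0 (u + 1) (arm u ω) ω} :=
      past_le K (u + 1) _ ((measurable_ePlus_arm (K := K) ξ b u) measurableSet_Ioi)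
    exact (hal u).inter ((MeasurableSet.const _).inter
      ((measurableSet_arm' u a).compl.inter (h1.union h2)))
  have hAm : ∀ u, MeasurableSet (alive (K := K) ξ b M n₀ u ∩ {ω | arm u ω ≠ a}) := fun u =>
    (hal u).inter (measurableSet_arm' u a).compl
  have hsign : ∀ u, ∃ T : Set (Path K), wrongLabel ξ b M μ a n₀ u ⊆ W u ∪ T ∧
      Q.real T ≤ 1 / M := by
    intro u
    rcases lt_trichotomy ξ (μ a) with h | h | h
    · refine ⟨{ω | M ≤ betProduct ξ (betPlus ξ b) (u + 1) a ω}, ?_, real_le_inv_of_betProduct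
        (isClippedBet_betPlus hξ hb) (by unfold betPlus; fun_prop)
        (fun x => mul_nonpos_of_nonpos_of_nonneg (betPlus_nonpos x) (sub_pos.2 h).le) hQ hM0 _⟩
      rintro ω ⟨h1, h2, ⟨h3, h4⟩ | ⟨h3, ⟨-, h4⟩ | ⟨h4, -⟩⟩⟩
      · exact Or.inl ⟨h1, h2, h3, h4⟩
      · rw [h3] at h4
        exact Or.inr h4.le
      · exact absurd h4 h.not_gt
    · refine ⟨∅, ?_, by simp [hM0.le]⟩
      rintro ω ⟨h1, h2, ⟨h3, h4⟩ | ⟨h3, ⟨h4, -⟩ | ⟨h4, -⟩⟩⟩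
      · exact Or.inl ⟨h1, h2, h3, h4⟩
      · exact absurd h h4.ne
      · exact absurd h h4.ne'
    · refine ⟨{ω | M ≤ betProduct ξ (betMinus ξ b) (u + 1) a ω}, ?_, real_le_inv_of_betProduct
        (isClippedBet_betMinus hξ hb) (by unfold betMinus; fun_prop)
        (fun x => mul_nonpos_of_nonneg_of_nonpos (betMinus_nonneg hξ hb x) (sub_neg.2 h).le)
        hQ hM0 _⟩
      rintro ω ⟨h1, h2, ⟨h3, h4⟩ | ⟨h3, ⟨h4, -⟩ | ⟨-, h4⟩⟩⟩
      · exact Or.inl ⟨h1, h2, h3, h4⟩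
      · exact absurd h4 h.not_gt
      · rw [h3] at h4
        exact Or.inr h4
  have hstep : ∀ u, Q.real (wrongLabel ξ b M μ a n₀ u) ≤ Q.real (W u) + 1 / M := by
    intro u
    obtain ⟨T, hT, hTM⟩ := hsign u
    exact (measureReal_mono hT).trans ((measureReal_union_le _ _).trans (by gcongr))
  have hi : ∀ {E : Set (Path K)}, MeasurableSet E → Integrable (E.indicator fun _ => (1 : ℝ)) Q :=
    fun hE => (integrable_const 1).indicator hE
  have hmain := integral_mono (μ := Q)
    (integrable_finsetSum (Finset.range R) fun u _ => hi (hWm u))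
    ((integrable_finsetSum (Finset.range R) fun u _ => hi (hAm u)).const_mul _)
    (fun ω => sum_indicator_other_le hξ hb hM0 hM a R ω)
  rw [integral_finsetSum _ fun u _ => hi (hWm u), integral_const_mul,
    integral_finsetSum _ fun u _ => hi (hAm u)] at hmain
  simp only [integral_indicator_const _ (hWm _), integral_indicator_const _ (hAm _), smul_eq_mul,
    mul_one] at hmain
  calc ∑ u ∈ Finset.range R, Q.real (wrongLabel ξ b M μ a n₀ u)
      ≤ ∑ u ∈ Finset.range R, (Q.real (W u) + 1 / M) := Finset.sum_le_sum fun u _ => hstep u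
    _ = ∑ u ∈ Finset.range R, Q.real (W u) + R / M := by
        rw [Finset.sum_add_distrib, Finset.sum_const, Finset.card_range, nsmul_eq_mul, mul_one_div]
    _ ≤ _ := by gcongr

/-- Uniformly over bandit instances, the expected duration of an epoch and the probability of an
incorrect label, in terms of the logarithm of the threshold. -/
theorem exists_epoch_bound {K : ℕ} {ξ b : ℝ} (hξ : ξ ∈ Set.Ioo (0 : ℝ) 1)
    (hb : b ∈ Set.Ioo (0 : ℝ) 1) {μ : Fin K → ℝ}
    (hμ : ∀ a, μ a ∈ Set.Icc (ξ * (1 - b)) (b * (1 - ξ) + ξ)) (hμξ : ∀ a, μ a ≠ ξ)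
    {π : Scheme K} (hπ : IsRegretMinimizing π μ) {S : Finset (Fin K)} {aStar : Fin K}
    (haS : aStar ∈ S) (hmax : ∀ a ∈ S, μ a ≤ μ aStar) :
    ∃ c₀ c₁ γ : ℝ, 0 ≤ c₀ ∧ 0 < c₁ ∧ 0 < γ ∧ ∀ Q, IsBanditLaw (π.initialized S) μ Q →
      ∀ M : ℝ, 1 ≤ Real.log M → (1 / ξ + 1 / (1 - ξ)) ^ S.card ≤ M →
        (∀ N, ∑ u ∈ Finset.range N, Q.real (alive ξ b M S.card u) ≤
          Real.log M / bernKL (μ aStar) ξ + c₀ * Real.log (2 + c₁ * Real.log M) + c₀) ∧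
        ∀ N, ∑ u ∈ Finset.range N, Q.real (wrongLabel ξ b M μ aStar S.card u) ≤
          (c₁ * Real.log M + 1) / M + c₀ * (Real.log (2 + c₁ * Real.log M) / Real.log M) +
            c₀ * Real.exp (-γ * Real.log M) := by
  have hμI : ∀ a, μ a ∈ Set.Ioo (0 : ℝ) 1 := fun a =>
    ⟨(mul_pos hξ.1 (sub_pos.2 hb.2)).trans_le (hμ a).1,
      (hμ a).2.trans_lt (by nlinarith [hξ.2, hb.2])⟩
  have hd : 0 < bernKL (μ aStar) ξ := bernKL_pos (hμI aStar) hξ (hμξ aStar)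
  obtain ⟨C, hC0, hC⟩ := exists_growth hξ hb hμ
  obtain ⟨C', hC'0, hC'⟩ := exists_gain_le (K := K) ξ (fun a => Set.Ioo_subset_Icc_self (hμI a))
  obtain ⟨c₁, γ, hc₁, hγ, htail⟩ := exists_tail_bound hξ hb hμ hμξ
  obtain ⟨c, hc, hreg⟩ := exists_uniform_regret (fun a => (hμI a).1.le) hπ haS hmax
  set D := (1 - Real.exp (-(γ / 2)))⁻¹ with hD
  have hD0 : 0 < D := inv_pos.2 (sub_pos.2 (Real.exp_lt_one_iff.2 (by linarith)))
  set d := bernKL (μ aStar) ξ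
  set B := Real.log (1 / ξ + 1 / (1 - ξ)) with hB
  have hB0 : 0 ≤ B := Real.log_nonneg (one_le_factor_bound hξ)
  have hCd : 0 ≤ C / d := div_nonneg hC0 hd.le
  have hCd' : 0 ≤ C' / d := div_nonneg hC'0 hd.le
  have hBc : 0 ≤ B * (2 * c) := by positivity
  -- All multiplicative constants are lumped into one that serves both estimates; the superfluous
  -- summands are nonnegative.
  refine ⟨C / d + C' / d + 2 * c + D + B * (2 * c), c₁, γ / 2 * c₁, by positivity, hc₁,
    by positivity, fun Q hQ M hl hM => ?_⟩
  have := hQ.isProbabilityMeasure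
  set l := Real.log M with hldef
  have hM0 : 0 < M := lt_of_lt_of_le
    (pow_pos (one_pos.trans_le (one_le_factor_bound hξ)) _) hM
  have hl0 : 0 < l := one_pos.trans_le hl
  -- Beyond this horizon the tail bound applies. Up to it the regret costs `2 * c * log (1 + R)`,
  -- which is doubly logarithmic in `M`.
  set R := ⌈c₁ * l⌉₊ with hR
  have hR1 : c₁ * l ≤ R := Nat.le_ceil _
  have hR2 : (R : ℝ) ≤ c₁ * l + 1 := (Nat.ceil_lt_add_one (by positivity)).le
  set L := Real.log (2 + c₁ * l) with hL
  have hL0 : 0 ≤ L := Real.log_nonneg (by nlinarith)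
  have hLR : Real.log (1 + R) ≤ L := Real.log_le_log (by positivity) (by linarith)
  have hLR0 : 0 ≤ Real.log (1 + (R : ℝ)) := Real.log_nonneg (by simp)
  have htailR : ∀ u, R ≤ u → Q.real (alive ξ b M S.card u) ≤ Real.exp (-γ * u) := fun u hu =>
    htail _ Q hQ M S.card hM hl u (hR1.trans (by exact_mod_cast hu))
  have hne := sum_alive_ne_le (ξ := ξ) (b := b) (M := M) (n₀ := S.card) hc.le (hreg Q hQ) R
  have hne' : ∑ u ∈ Finset.range R, Q.real (alive ξ b M S.card u ∩ {ω | arm u ω ≠ aStar}) ≤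
      2 * c * L := hne.trans (by nlinarith)
  have hexp : Real.exp (-(γ / 2) * R) ≤ Real.exp (-(γ / 2 * c₁) * l) :=
    Real.exp_le_exp.2 (by nlinarith)
  have hexp1 : Real.exp (-(γ / 2) * R) ≤ 1 := Real.exp_le_one_iff.2 (by
    have : (0 : ℝ) ≤ R := Nat.cast_nonneg R
    nlinarith)
  constructor
  · intro N
    refine (sum_range_le_of_tail hγ htailR (fun _ => measureReal_nonneg) N).trans ?_
    have harm := sum_alive_arm_le hξ hb hC0 hC hM hC' hC'0 hQ aStar R
    rw [mul_comm, ← le_div_iff₀ hd] at harm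
    have hsplit : ∑ u ∈ Finset.range R, Q.real (alive ξ b M S.card u) =
        ∑ u ∈ Finset.range R, Q.real (alive ξ b M S.card u ∩ {ω | arm u ω = aStar}) +
        ∑ u ∈ Finset.range R, Q.real (alive ξ b M S.card u ∩ {ω | arm u ω ≠ aStar}) := by
      rw [← Finset.sum_add_distrib]
      refine Finset.sum_congr rfl fun u _ => ?_
      exact (measureReal_inter_add_sdiff (μ := Q) (s := alive ξ b M S.card u)
        (measurableSet_arm' u aStar)).symm
    have h1 : (l + C * Real.log (1 + R) + C') / d ≤ l / d + C / d * L + C' / d := by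
      rw [add_div, add_div, mul_div_right_comm]
      gcongr
    have h2 : Real.exp (-(γ / 2) * R) * D ≤ D := mul_le_of_le_one_left hD0.le hexp1
    rw [hsplit]
    have h3 : 0 ≤ C' / d * L := by positivity
    have h4 : 0 ≤ D * L := by positivity
    have h5 : 0 ≤ B * (2 * c) * L := by positivity
    linarith
  · intro N
    have hsub : ∀ u, Q.real (wrongLabel ξ b M μ aStar S.card u) ≤
        Q.real (alive ξ b M S.card u) := fun u => measureReal_mono Set.inter_subset_left
    refine (sum_range_le_of_tail hγ (fun u hu => (hsub u).trans (htailR u hu))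
      (fun _ => measureReal_nonneg) N).trans ?_
    have h1 := sum_wrongLabel_le (n₀ := S.card) hξ hb hM0 hl0 hQ aStar R
    have h2 : B / l * ∑ u ∈ Finset.range R,
        Q.real (alive ξ b M S.card u ∩ {ω | arm u ω ≠ aStar}) ≤ B * (2 * c) * (L / l) := by
      calc _ ≤ B / l * (2 * c * L) := by gcongr
        _ = _ := by ring
    have h3 : (R : ℝ) / M ≤ (c₁ * l + 1) / M := by gcongr
    have h4 : Real.exp (-(γ / 2) * R) * D ≤ D * Real.exp (-(γ / 2 * c₁) * l) := by
      rw [mul_comm]; gcongr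
    have hLl : 0 ≤ L / l := by positivity
    have he : 0 ≤ Real.exp (-(γ / 2 * c₁) * l) := (Real.exp_pos _).le
    have h5 : 0 ≤ (C / d + C' / d + 2 * c + D) * (L / l) := by positivity
    have h6 : 0 ≤ (C / d + C' / d + 2 * c + B * (2 * c)) * Real.exp (-(γ / 2 * c₁) * l) := by
      positivity
    linarith

/-! ### Asymptotics of a single epoch as `δ → 0`. -/

theorem tendsto_log_affine_div {c : ℝ} (hc : 0 < c) :
    Tendsto (fun x : ℝ => Real.log (2 + c * x) / x) atTop (𝓝 0) := by
  have h0 : Tendsto (fun x : ℝ => 2 + c * x) atTop atTop :=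
    tendsto_atTop_add_const_left _ _ (tendsto_id.const_mul_atTop hc)
  have h1 : Tendsto (fun x : ℝ => Real.log (2 + c * x) / (2 + c * x)) atTop (𝓝 0) :=
    (Real.isLittleO_log_id_atTop.tendsto_div_nhds_zero).comp h0
  have h2 : Tendsto (fun x : ℝ => (2 + c * x) / x) atTop (𝓝 c) := by
    have : Tendsto (fun x : ℝ => 2 / x + c) atTop (𝓝 (0 + c)) :=
      (tendsto_const_nhds.div_atTop tendsto_id).add_const c
    rw [zero_add] at this
    refine this.congr' ?_
    filter_upwards [eventually_gt_atTop 0] with x hx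
    field_simp
  have h3 := h1.mul h2
  rw [zero_mul] at h3
  refine h3.congr' ?_
  filter_upwards [eventually_gt_atTop 0] with x hx
  have : 2 + c * x ≠ 0 := by positivity
  field_simp

theorem tendsto_log_threshold {K : ℕ} (hK : 0 < K) :
    Tendsto (fun δ : ℝ => Real.log (2 * K / δ)) (𝓝[>] 0) atTop ∧
    Tendsto (fun δ : ℝ => Real.log (2 * K / δ) / Real.log (1 / δ)) (𝓝[>] 0) (𝓝 1) := by
  have hK' : (0 : ℝ) < 2 * K := by positivity
  have heq : ∀ᶠ δ : ℝ in 𝓝[>] 0, Real.log (2 * K) + Real.log (1 / δ) = Real.log (2 * K / δ) := by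
    filter_upwards [self_mem_nhdsWithin] with δ hδ
    have hδ' : (0 : ℝ) < δ := hδ
    rw [← Real.log_mul hK'.ne' (by positivity), mul_one_div]
  constructor
  · exact (tendsto_atTop_add_const_left _ _ tendsto_log_one_div).congr' heq
  · have h : Tendsto (fun δ : ℝ => Real.log (2 * K) / Real.log (1 / δ) + 1) (𝓝[>] 0)
        (𝓝 (0 + 1)) := (tendsto_const_nhds.div_atTop tendsto_log_one_div).add_const 1
    rw [zero_add] at h
    refine h.congr' ?_
    filter_upwards [heq, tendsto_log_one_div.eventually_gt_atTop 0] with δ h1 h2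
    rw [← h1, add_div, div_self h2.ne']

/-- For small `δ`, an epoch lasts about `log (1 / δ) / d` rounds in expectation and ends with the
correct label for the best arm, with high probability. -/
theorem eventually_epoch_bound {K : ℕ} {ξ b : ℝ} (hξ : ξ ∈ Set.Ioo (0 : ℝ) 1)
    (hb : b ∈ Set.Ioo (0 : ℝ) 1) {μ : Fin K → ℝ}
    (hμ : ∀ a, μ a ∈ Set.Icc (ξ * (1 - b)) (b * (1 - ξ) + ξ)) (hμξ : ∀ a, μ a ≠ ξ)
    {π : Scheme K} (hπ : IsRegretMinimizing π μ) {S : Finset (Fin K)} {aStar : Fin K}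
    (haS : aStar ∈ S) (hmax : ∀ a ∈ S, μ a ≤ μ aStar) {η : ℝ} (hη : 0 < η) :
    ∀ᶠ δ : ℝ in 𝓝[>] 0, ∀ Q, IsBanditLaw (π.initialized S) μ Q →
      ∑' u, Q (alive ξ b (2 * K / δ) S.card u) ≤
        ENNReal.ofReal ((1 / bernKL (μ aStar) ξ + η) * Real.log (1 / δ)) ∧
      ∑' u, Q (wrongLabel ξ b (2 * K / δ) μ aStar S.card u) ≤ ENNReal.ofReal η := by
  have hK : 0 < K := aStar.pos
  obtain ⟨c₀, c₁, γ, hc₀, hc₁, hγ, hbound⟩ := exists_epoch_bound hξ hb hμ hμξ hπ haS hmax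
  obtain ⟨hl, hratio⟩ := tendsto_log_threshold hK
  set d := bernKL (μ aStar) ξ
  have hA : Tendsto (fun δ : ℝ => (1 / d + c₀ * (Real.log (2 + c₁ * Real.log (2 * K / δ)) /
      Real.log (2 * K / δ)) + c₀ / Real.log (2 * K / δ)) *
      (Real.log (2 * K / δ) / Real.log (1 / δ))) (𝓝[>] 0) (𝓝 ((1 / d + c₀ * 0 + 0) * 1)) :=
    (((((tendsto_log_affine_div hc₁).comp hl).const_mul c₀).const_add (1 / d)).add
      (tendsto_const_nhds.div_atTop hl)).mul hratio
  have hW : Tendsto (fun x : ℝ => (c₁ * x + 1) * Real.exp (-x) +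
      c₀ * (Real.log (2 + c₁ * x) / x) + c₀ * Real.exp (-γ * x)) atTop (𝓝 (0 + c₀ * 0 + c₀ * 0)) := by
    refine (Tendsto.add ?_ ((tendsto_log_affine_div hc₁).const_mul c₀)).add
      (Tendsto.const_mul c₀ ?_)
    · have h1 := (Real.tendsto_pow_mul_exp_neg_atTop_nhds_zero 1).const_mul c₁
      have h2 := Real.tendsto_pow_mul_exp_neg_atTop_nhds_zero 0
      have h3 := h1.add h2
      simp only [pow_one, pow_zero, one_mul, mul_zero, add_zero] at h3
      refine h3.congr fun x => by ring
    · refine Real.tendsto_exp_atBot.comp ?_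
      exact tendsto_id.const_mul_atTop_of_neg (neg_neg_of_pos hγ)
  have hW' := hW.comp hl
  simp only [mul_zero, add_zero, mul_one] at hA hW'
  filter_upwards [hA.eventually_le_const (show 1 / d < 1 / d + η by linarith),
    hW'.eventually_le_const hη, hl.eventually_ge_atTop 1,
    hl.eventually_ge_atTop (Real.log ((1 / ξ + 1 / (1 - ξ)) ^ S.card)),
    tendsto_log_one_div.eventually_gt_atTop 0, self_mem_nhdsWithin]
    with δ h1 h2 h3 h4 h5 h6 Q hQ
  have hδ : (0 : ℝ) < δ := h6
  have := hQ.isProbabilityMeasure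
  have hM0 : (0 : ℝ) < 2 * K / δ := by positivity
  have hBM : (1 / ξ + 1 / (1 - ξ)) ^ S.card ≤ 2 * K / δ :=
    (Real.log_le_log_iff (pow_pos (one_pos.trans_le (one_le_factor_bound hξ)) _) hM0).1 h4
  obtain ⟨ha, hw⟩ := hbound Q hQ _ h3 hBM
  constructor
  · refine tsum_measure_le_ofReal fun N => (ha N).trans ?_
    have hl0 : 0 < Real.log (2 * K / δ) := one_pos.trans_le h3
    rw [← div_le_iff₀ h5]
    refine le_trans (le_of_eq ?_) h1
    field_simp
  · refine tsum_measure_le_ofReal fun N => (hw N).trans (le_trans (le_of_eq ?_) h2)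
    simp only [Function.comp]
    rw [Real.exp_neg, Real.exp_log hM0, div_eq_mul_inv]

/-! ### Epochs of the resetting algorithm: pathwise properties -/

theorem pulls_shift {K : ℕ} (s u : ℕ) (a : Fin K) (ω : Path K) :
    pulls s (s + u) a ω = (pulls 0 u a (shift s ω)).map (addLeftEmbedding s) := by
  ext j
  simp only [pulls, Finset.mem_filter, Finset.mem_Ico, Finset.mem_map, addLeftEmbedding_apply,
    Nat.zero_le, true_and]
  constructor
  · rintro ⟨⟨h1, h2⟩, h3⟩
    refine ⟨j - s, ⟨by omega, ?_⟩, by omega⟩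
    rw [← h3]
    simp only [arm, shift]
    congr 2
    omega
  · rintro ⟨k, ⟨h1, h2⟩, rfl⟩
    exact ⟨by omega, h2⟩

theorem empMean_shift {K : ℕ} (ξ : ℝ) (s u : ℕ) (a : Fin K) (ω : Path K) :
    empMean ξ s (s + u) a ω = empMean ξ 0 u a (shift s ω) := by
  simp only [empMean, pulls_shift, Finset.card_map, Finset.sum_map]
  rfl

theorem eMinus_shift {K : ℕ} (ξ b : ℝ) (s u : ℕ) (a : Fin K) (ω : Path K) :
    eMinus ξ b s (s + u) a ω = eMinus ξ b 0 u a (shift s ω) := by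
  simp only [eMinus, pulls_shift, Finset.prod_map, addLeftEmbedding_apply, empMean_shift]
  rfl

theorem ePlus_shift {K : ℕ} (ξ b : ℝ) (s u : ℕ) (a : Fin K) (ω : Path K) :
    ePlus ξ b s (s + u) a ω = ePlus ξ b 0 u a (shift s ω) := by
  simp only [ePlus, pulls_shift, Finset.prod_map, addLeftEmbedding_apply, empMean_shift]
  rfl

/-- The pair of label sets of a state. -/
def State.labels {K : ℕ} (σ : State K) : Finset (Fin K) × Finset (Fin K) := (σ.good, σ.bad)

/-- The state with labels `c` and last reset at time `s`. -/
def fresh {K : ℕ} (s : ℕ) (c : Finset (Fin K) × Finset (Fin K)) : State K := ⟨s, c.1, c.2⟩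

/-- The arms without a label. -/
def rest {K : ℕ} (c : Finset (Fin K) × Finset (Fin K)) : Finset (Fin K) := (c.1 ∪ c.2)ᶜ

/-- The loop goes on as long as the labels are active. -/
def Active {K : ℕ} (m : ℕ) (c : Finset (Fin K) × Finset (Fin K)) : Prop :=
  c.1.card < m ∧ (rest c).Nonempty

theorem not_stopped_iff {K m : ℕ} (σ : State K) : ¬ σ.Stopped m ↔ Active m σ.labels := by
  simp [State.Stopped, Active, rest, State.labels, State.unlabeled,
    Finset.nonempty_iff_ne_empty]

/-- The round of index `t` ends an epoch. -/
def Fires {K : ℕ} (ξ b δ : ℝ) (t : ℕ) (σ : State K) (ω : Path K) : Prop :=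
  2 * (K : ℝ) / δ ≤ eMinus ξ b σ.start (t + 1) (arm t ω) ω ∨
    2 * (K : ℝ) / δ < ePlus ξ b σ.start (t + 1) (arm t ω) ω

theorem step_of_not {K : ℕ} {ξ b δ : ℝ} {m t : ℕ} {σ : State K} {ω : Path K}
    (h : ¬ (Active m σ.labels ∧ σ.start + (rest σ.labels).card ≤ t ∧ Fires ξ b δ t σ ω)) :
    step ξ b δ m t σ ω = σ := by
  unfold step
  by_cases hc : σ.Stopped m ∨ t < σ.start + σ.unlabeled.card
  · rw [if_pos hc]
  · rw [if_neg hc]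
    push Not at hc
    have hf : ¬ Fires ξ b δ t σ ω := fun hf => h ⟨(not_stopped_iff σ).1 hc.1, hc.2, hf⟩
    unfold Fires at hf
    rw [if_neg hf]
    push Not at hf
    rw [if_neg (not_le.2 hf.1), if_neg (not_lt.2 hf.2)]

theorem step_of_fires {K : ℕ} {ξ b δ : ℝ} {m t : ℕ} {σ : State K} {ω : Path K}
    (h1 : Active m σ.labels) (h2 : σ.start + (rest σ.labels).card ≤ t)
    (h3 : Fires ξ b δ t σ ω) :
    (step ξ b δ m t σ ω).start = t + 1 ∧
    ((2 * (K : ℝ) / δ ≤ eMinus ξ b σ.start (t + 1) (arm t ω) ω ∧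
        (step ξ b δ m t σ ω).good = insert (arm t ω) σ.good ∨
      ¬ 2 * (K : ℝ) / δ ≤ eMinus ξ b σ.start (t + 1) (arm t ω) ω ∧
        (step ξ b δ m t σ ω).good = σ.good)) ∧
    ((2 * (K : ℝ) / δ < ePlus ξ b σ.start (t + 1) (arm t ω) ω ∧
        (step ξ b δ m t σ ω).bad = insert (arm t ω) σ.bad ∨
      ¬ 2 * (K : ℝ) / δ < ePlus ξ b σ.start (t + 1) (arm t ω) ω ∧
        (step ξ b δ m t σ ω).bad = σ.bad)) := by
  have hc : ¬ (σ.Stopped m ∨ t < σ.start + σ.unlabeled.card) := by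
    push Not
    exact ⟨(not_stopped_iff σ).2 h1, h2⟩
  have h3' := h3
  unfold Fires at h3'
  unfold step
  rw [if_neg hc]
  refine ⟨if_pos h3', ?_, ?_⟩
  · by_cases h : 2 * (K : ℝ) / δ ≤ eMinus ξ b σ.start (t + 1) (arm t ω) ω
    · exact Or.inl ⟨h, if_pos h⟩
    · exact Or.inr ⟨h, if_neg h⟩
  · by_cases h : 2 * (K : ℝ) / δ < ePlus ξ b σ.start (t + 1) (arm t ω) ω
    · exact Or.inl ⟨h, if_pos h⟩
    · exact Or.inr ⟨h, if_neg h⟩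

theorem step_eq_of_start_le {K : ℕ} {ξ b δ : ℝ} {m t : ℕ} {σ : State K} {ω : Path K}
    (h : (step ξ b δ m t σ ω).start ≤ t) : step ξ b δ m t σ ω = σ := by
  refine step_of_not fun h' => ?_
  rw [(step_of_fires h'.1 h'.2.1 h'.2.2).1] at h
  omega

/-- The state changes only together with `start`, so nothing has happened since the last reset.
Hence every state arises from a `fresh` one at its own starting time. -/
theorem state_start {K : ℕ} (ξ b δ : ℝ) (m t : ℕ) (ω : Path K) :
    state ξ b δ m (state ξ b δ m t ω).start ω = state ξ b δ m t ω := by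
  induction t with
  | zero => rfl
  | succ t ih =>
    by_cases h : (state ξ b δ m (t + 1) ω).start ≤ t
    · have h' : state ξ b δ m (t + 1) ω = state ξ b δ m t ω := step_eq_of_start_le h
      rw [h', ih]
    · have : (state ξ b δ m (t + 1) ω).start = t + 1 :=
        le_antisymm (state_start_le ξ b δ m (t + 1) ω) (by omega)
      rw [this]

theorem mem_alive_succ {K : ℕ} {ξ b M : ℝ} {n₀ u : ℕ} {ω : Path K} :
    ω ∈ alive ξ b M n₀ (u + 1) ↔ ω ∈ alive ξ b M n₀ u ∧ (n₀ ≤ u →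
      eMinus ξ b 0 (u + 1) (arm u ω) ω < M ∧ ePlus ξ b 0 (u + 1) (arm u ω) ω ≤ M) := by
  constructor
  · exact fun h => ⟨alive_antitone ξ b M n₀ (Nat.le_succ u) h, h u (Nat.lt_succ_self u)⟩
  · rintro ⟨h1, h2⟩ v hv hn
    rcases Nat.lt_succ_iff_lt_or_eq.1 hv with h | rfl
    · exact h1 v h hn
    · exact h2 hn

theorem fires_fresh_iff {K : ℕ} {ξ b δ : ℝ} {s u : ℕ} {c : Finset (Fin K) × Finset (Fin K)}
    {ω : Path K} : ¬ Fires ξ b δ (s + u) (fresh s c) ω ↔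
      (eMinus ξ b 0 (u + 1) (arm u (shift s ω)) (shift s ω) < 2 * K / δ ∧
        ePlus ξ b 0 (u + 1) (arm u (shift s ω)) (shift s ω) ≤ 2 * K / δ) := by
  change ¬ (2 * (K : ℝ) / δ ≤ eMinus ξ b s (s + (u + 1)) (arm (s + u) ω) ω ∨
    2 * (K : ℝ) / δ < ePlus ξ b s (s + (u + 1)) (arm (s + u) ω) ω) ↔ _
  rw [eMinus_shift, ePlus_shift]
  push Not
  rfl

/-- An epoch that starts at time `s` goes on exactly as long as the shifted path is alive. -/
theorem state_add_iff {K : ℕ} {ξ b δ : ℝ} {m s : ℕ} {c : Finset (Fin K) × Finset (Fin K)}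
    (hc : Active m c) {ω : Path K} (h : state ξ b δ m s ω = fresh s c) (u : ℕ) :
    state ξ b δ m (s + u) ω = fresh s c ↔
      shift s ω ∈ alive ξ b (2 * K / δ) (rest c).card u := by
  induction u with
  | zero => simp [h, alive]
  | succ u ih =>
    rw [mem_alive_succ, ← ih, ← fires_fresh_iff (s := s) (c := c)]
    change step ξ b δ m (s + u) (state ξ b δ m (s + u) ω) ω = fresh s c ↔ _
    constructor
    · intro h1
      have h2 : state ξ b δ m (s + u) ω = fresh s c := by
        rw [← h1]
        refine (step_eq_of_start_le ?_).symm
        rw [h1]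
        exact Nat.le_add_right s u
      refine ⟨h2, fun h3 h4 => ?_⟩
      rw [h2] at h1
      -- A firing round would move `start` to `s + u + 1`, whereas the state still starts at `s`.
      have h5 := (step_of_fires (σ := fresh s c) hc (by
        change s + (rest c).card ≤ s + u
        omega) h4).1
      rw [h1] at h5
      change s = s + u + 1 at h5
      omega
    · rintro ⟨h1, h2⟩
      rw [h1]
      refine step_of_not fun h3 => h2 ?_ h3.2.2
      have : s + (rest c).card ≤ s + u := h3.2.1
      omega

theorem labels_mono {K : ℕ} (ξ b δ : ℝ) (m : ℕ) (ω : Path K) :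
    Monotone fun t => (state ξ b δ m t ω).labels := by
  refine monotone_nat_of_le_succ fun t => ?_
  by_cases h : Active m (state ξ b δ m t ω).labels ∧ (state ξ b δ m t ω).start +
      (rest (state ξ b δ m t ω).labels).card ≤ t ∧ Fires ξ b δ t (state ξ b δ m t ω) ω
  · obtain ⟨-, h1, h2⟩ := step_of_fires h.1 h.2.1 h.2.2
    constructor
    · rcases h1 with h1 | h1
      · exact (Finset.subset_insert _ _).trans h1.2.symm.subset
      · exact h1.2.symm.subset
    · rcases h2 with h2 | h2
      · exact (Finset.subset_insert _ _).trans h2.2.symm.subset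
      · exact h2.2.symm.subset
  · exact (congrArg State.labels (step_of_not h)).symm.le

/-- As long as the loop goes on, only unlabelled arms are pulled. -/
def PullsRest {K : ℕ} (ξ b δ : ℝ) (m : ℕ) (ω : Path K) : Prop :=
  ∀ t, Active m (state ξ b δ m t ω).labels → arm t ω ∈ rest (state ξ b δ m t ω).labels

theorem fires_of_start {K : ℕ} {ξ b δ : ℝ} {m t : ℕ} {ω : Path K}
    (h : (state ξ b δ m (t + 1) ω).start = t + 1) :
    Active m (state ξ b δ m t ω).labels ∧ (state ξ b δ m t ω).start +
      (rest (state ξ b δ m t ω).labels).card ≤ t ∧ Fires ξ b δ t (state ξ b δ m t ω) ω := by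
  by_contra h'
  have h1 : state ξ b δ m (t + 1) ω = state ξ b δ m t ω := step_of_not h'
  have := state_start_le ξ b δ m t ω
  rw [h1] at h
  omega

/-- The arm that triggers a reset was unlabelled, so a reset adds a genuinely new label. -/
theorem PullsRest.labels_ne {K : ℕ} {ξ b δ : ℝ} {m : ℕ} {ω : Path K} (hω : PullsRest ξ b δ m ω)
    {t : ℕ} (h : (state ξ b δ m (t + 1) ω).start = t + 1) :
    (state ξ b δ m t ω).labels ≠ (state ξ b δ m (t + 1) ω).labels := by
  obtain ⟨h1, h2, h3⟩ := fires_of_start h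
  obtain ⟨-, h4, h5⟩ := step_of_fires h1 h2 h3
  have hrest := hω t h1
  simp only [rest, State.labels, Finset.mem_compl, Finset.mem_union, not_or] at hrest
  intro heq
  have hg : (state ξ b δ m t ω).good = (step ξ b δ m t (state ξ b δ m t ω) ω).good :=
    congrArg Prod.fst heq
  have hb : (state ξ b δ m t ω).bad = (step ξ b δ m t (state ξ b δ m t ω) ω).bad :=
    congrArg Prod.snd heq
  rcases h3 with h3 | h3
  · rcases h4 with h4 | h4
    · refine hrest.1 ?_
      rw [hg, h4.2]
      exact Finset.mem_insert_self _ _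
    · exact h4.1 h3
  · rcases h5 with h5 | h5
    · refine hrest.2 ?_
      rw [hb, h5.2]
      exact Finset.mem_insert_self _ _
    · exact h5.1 h3

/-- Labels only grow, and strictly at each reset, so a pair of label sets can begin only one epoch.
This keeps the sum of the starting probabilities over all times at most one. -/
theorem PullsRest.fresh_unique {K : ℕ} {ξ b δ : ℝ} {m : ℕ} {ω : Path K}
    (hω : PullsRest ξ b δ m ω) {c : Finset (Fin K) × Finset (Fin K)} {s s' : ℕ} (hlt : s < s')
    (h : state ξ b δ m s ω = fresh s c) (h' : state ξ b δ m s' ω = fresh s' c) : False := by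
  obtain ⟨t, rfl⟩ : ∃ t, s' = t + 1 := ⟨s' - 1, by omega⟩
  refine hω.labels_ne (t := t) (by rw [h']; rfl) (le_antisymm ?_ ?_)
  · exact labels_mono ξ b δ m ω (Nat.le_succ t)
  · refine le_trans (le_of_eq ?_) (labels_mono ξ b δ m ω (show s ≤ t by omega))
    simp only [h, h']
    rfl

/-- The labels that arise when the arms are labelled correctly in decreasing order of their
means. -/
def Nominal {K : ℕ} (ξ : ℝ) (μ : Fin K → ℝ) (c : Finset (Fin K) × Finset (Fin K)) : Prop :=
  c.1 ⊆ goodArms ξ μ ∧ c.2 ⊆ (goodArms ξ μ)ᶜ ∧ ∀ a ∈ c.1 ∪ c.2, ∀ a' ∈ rest c, μ a' < μ a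

/-- Induction over resets: from a nominal state, an epoch that does not end wrongly labels the best
remaining arm correctly, and only that arm. Only epochs started from nominal labels have to be
excluded. -/
theorem nominal_of_not_wrongLabel {K : ℕ} {ξ b δ : ℝ} {m : ℕ} {ω : Path K} {μ : Fin K → ℝ}
    (hμξ : ∀ a, μ a ≠ ξ) (hinj : ∀ a a', a ≠ a' → μ a ≠ μ a')
    {best : Finset (Fin K) → Fin K}
    (hbest : ∀ S, S.Nonempty → best S ∈ S ∧ ∀ a ∈ S, μ a ≤ μ (best S))
    (hω : ∀ c, Nominal ξ μ c → Active m c → ∀ s u, state ξ b δ m s ω = fresh s c →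
      shift s ω ∉ wrongLabel ξ b (2 * K / δ) μ (best (rest c)) (rest c).card u) (t : ℕ) :
    Nominal ξ μ (state ξ b δ m t ω).labels := by
  induction t with
  | zero => simp [Nominal, State.labels, state]
  | succ t ih =>
    by_cases hs : (state ξ b δ m (t + 1) ω).start ≤ t
    · have h' : state ξ b δ m (t + 1) ω = state ξ b δ m t ω := step_eq_of_start_le hs
      rw [h']
      exact ih
    have hstart : (state ξ b δ m (t + 1) ω).start = t + 1 :=
      le_antisymm (state_start_le ξ b δ m (t + 1) ω) (by omega)
    obtain ⟨h1, h2, h3⟩ := fires_of_start hstart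
    obtain ⟨-, h4, h5⟩ := step_of_fires h1 h2 h3
    change _ ∧ (state ξ b δ m (t + 1) ω).good = _ ∨ _ ∧ (state ξ b δ m (t + 1) ω).good = _ at h4
    change _ ∧ (state ξ b δ m (t + 1) ω).bad = _ ∨ _ ∧ (state ξ b δ m (t + 1) ω).bad = _ at h5
    set σ := state ξ b δ m t ω with hσ
    set σ' := state ξ b δ m (t + 1) ω
    obtain ⟨u, hu⟩ : ∃ u, t = σ.start + u := ⟨t - σ.start, by omega⟩
    have hfresh : state ξ b δ m σ.start ω = fresh σ.start σ.labels := state_start ξ b δ m t ω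
    have halive : shift σ.start ω ∈ alive ξ b (2 * K / δ) (rest σ.labels).card u := by
      rw [← state_add_iff h1 hfresh u, ← hu]
      rfl
    have hw := hω σ.labels ih h1 σ.start u hfresh
    have hcard : (rest σ.labels).card ≤ u := by omega
    have hm : eMinus ξ b 0 (u + 1) (arm u (shift σ.start ω)) (shift σ.start ω) =
        eMinus ξ b σ.start (t + 1) (arm t ω) ω := by
      rw [← eMinus_shift, ← add_assoc, ← hu]
      simp only [arm, shift, ← hu]
    have hp : ePlus ξ b 0 (u + 1) (arm u (shift σ.start ω)) (shift σ.start ω) =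
        ePlus ξ b σ.start (t + 1) (arm t ω) ω := by
      rw [← ePlus_shift, ← add_assoc, ← hu]
      simp only [arm, shift, ← hu]
    have harm : arm u (shift σ.start ω) = arm t ω := by
      simp only [arm, shift, ← hu]
    have hw' : ¬ ((arm t ω ≠ best (rest σ.labels) ∧ Fires ξ b δ t σ ω) ∨
        (arm t ω = best (rest σ.labels) ∧ ((ξ < μ (best (rest σ.labels)) ∧
          2 * (K : ℝ) / δ < ePlus ξ b σ.start (t + 1) (arm t ω) ω) ∨
        (μ (best (rest σ.labels)) < ξ ∧
          2 * (K : ℝ) / δ ≤ eMinus ξ b σ.start (t + 1) (arm t ω) ω)))) := by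
      intro h
      refine hw ⟨halive, hcard, ?_⟩
      rw [hm, hp, harm]
      exact h
    push Not at hw'
    have hab : arm t ω = best (rest σ.labels) := by
      by_contra h
      exact hw'.1 h h3
    have hw2 := hw'.2 hab
    rw [← hab] at hw2
    obtain ⟨hb1, hb2⟩ := hbest _ h1.2
    rw [← hab] at hb1 hb2
    -- The new arm has maximal mean among the remaining ones, strictly because the means are
    -- distinct; so labelled arms still dominate unlabelled ones, whichever set receives the arm.
    have hnew : ∀ g b' : Finset (Fin K), g ∪ b' = insert (arm t ω) (σ.labels.1 ∪ σ.labels.2) →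
        ∀ a ∈ g ∪ b', ∀ a' ∈ rest (g, b'), μ a' < μ a := by
      intro g b' hgb a ha a' ha'
      simp only [rest, hgb, Finset.mem_compl, Finset.mem_insert, not_or] at ha'
      rw [hgb, Finset.mem_insert] at ha
      have ha'' : a' ∈ rest σ.labels := Finset.mem_compl.2 ha'.2
      rcases ha with rfl | ha
      · exact lt_of_le_of_ne (hb2 a' ha'') (hinj _ _ ha'.1)
      · exact ih.2.2 a ha a' ha''
    have hgood : ξ < μ (arm t ω) → σ'.labels = (insert (arm t ω) σ.good, σ.bad) := by
      intro hξ
      have hb' : ¬ 2 * (K : ℝ) / δ < ePlus ξ b σ.start (t + 1) (arm t ω) ω :=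
        not_lt.2 (hw2.1 hξ)
      have hg' := h3.resolve_right hb'
      exact Prod.ext (h4.resolve_right fun h => h.1 hg').2 (h5.resolve_left fun h => hb' h.1).2
    have hbad : μ (arm t ω) < ξ → σ'.labels = (σ.good, insert (arm t ω) σ.bad) := by
      intro hξ
      have hg' : ¬ 2 * (K : ℝ) / δ ≤ eMinus ξ b σ.start (t + 1) (arm t ω) ω :=
        not_le.2 (hw2.2 hξ)
      have hb' := h3.resolve_left hg'
      exact Prod.ext (h4.resolve_left fun h => hg' h.1).2 (h5.resolve_right fun h => h.1 hb').2
    rcases lt_or_gt_of_ne (hμξ (arm t ω)) with h | h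
    · rw [hbad h]
      refine ⟨ih.1, Finset.insert_subset ?_ ih.2.1, hnew _ _ ?_⟩
      · simp [goodArms, h.le]
      · exact Finset.union_insert _ _ _
    · rw [hgood h]
      refine ⟨Finset.insert_subset ?_ ih.1, ih.2.1, hnew _ _ ?_⟩
      · simpa [goodArms] using h
      · exact Finset.insert_union _ _ _

/-! ### First times -/

theorem firstTime_le_tsum (p : ℕ → Prop) [DecidablePred p] :
    firstTime p ≤ ∑' t, if p t then (0 : ℝ≥0∞) else 1 := by
  by_cases h : ∃ t, p t
  · refine (iInf₂_le (Nat.find h) (Nat.find_spec h)).trans ?_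
    refine le_trans (le_of_eq ?_) (ENNReal.sum_le_tsum (Finset.range (Nat.find h)))
    rw [Finset.sum_congr rfl fun t ht => if_neg (Nat.find_min h (Finset.mem_range.1 ht))]
    simp
  · push Not at h
    have : ∑' t, (if p t then (0 : ℝ≥0∞) else 1) = ⊤ := by
      rw [tsum_congr fun t => if_neg (h t)]
      exact ENNReal.tsum_const_eq_top_of_ne_zero one_ne_zero
    rw [this]
    exact le_top

theorem min_firstTime_le (p q : ℕ → Prop) :
    min (firstTime p) (firstTime q) ≤ firstTime fun t => p t ∨ q t := by
  refine le_iInf₂ fun t ht => ?_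
  rcases ht with h | h
  · exact (min_le_left _ _).trans (iInf₂_le t h)
  · exact (min_le_right _ _).trans (iInf₂_le t h)

/-! ### Epochs of the resetting algorithm: laws -/

theorem measurable_shift' {K : ℕ} (s : ℕ) : Measurable (shift (K := K) s) :=
  measurable_pi_iff.2 fun i => measurable_pi_apply (s + i)

theorem measurableSet_state_eq {K : ℕ} (ξ b δ : ℝ) (m t : ℕ) (σ : State K) :
    MeasurableSet[past K t] {ω | state ξ b δ m t ω = σ} :=
  measurable_state ξ b δ m t (MeasurableSet.of_discrete (s := {σ}))

theorem measurableSet_shift {K s t : ℕ} {B : Set (Path K)} (hB : MeasurableSet[past K t] B) :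
    MeasurableSet[past K (s + t)] (shift s ⁻¹' B) := by
  have := measurable_shift (K := K) (Nat.le_add_right s t)
  rw [Nat.add_sub_cancel_left] at this
  exact this hB

theorem setLIntegral_map_cond {K s : ℕ} {P : Measure (Path K)} {H B : Set (Path K)}
    (hB : MeasurableSet B) {f : Path K → ℝ≥0∞} (hf : Measurable f) :
    ∫⁻ ω in B, f ω ∂((P[|H]).map (shift s)) =
      (P H)⁻¹ * ∫⁻ ω in H ∩ shift s ⁻¹' B, f (shift s ω) ∂P := by
  rw [setLIntegral_map hB hf (measurable_shift' s), ProbabilityTheory.cond,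
    Measure.restrict_smul, lintegral_smul_measure,
    Measure.restrict_restrict (measurable_shift' s hB), Set.inter_comm, smul_eq_mul]

theorem map_cond_apply {K s : ℕ} {P : Measure (Path K)} {H B : Set (Path K)}
    (hH : MeasurableSet H) (hB : MeasurableSet B) :
    (P[|H]).map (shift s) B = (P H)⁻¹ * P (H ∩ shift s ⁻¹' B) := by
  rw [Measure.map_apply (measurable_shift' s) hB, ProbabilityTheory.cond_apply hH]

/-- Within an epoch, the trajectory has the law of the initialized scheme interacting with a
bandit instance with the same means. -/
theorem exists_epoch_law {K : ℕ} [NeZero K] {π : Scheme K} {ξ b δ : ℝ} {m : ℕ}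
    {μ : Fin K → ℝ} (hμ : ∀ a, μ a ∈ Set.Icc (0 : ℝ) 1) {P : Measure (Path K)}
    (hP : IsBanditLaw (resetGAI π ξ b δ m).policy μ P) {s : ℕ}
    {c : Finset (Fin K) × Finset (Fin K)} (hc : Active m c)
    (h0 : P {ω | state ξ b δ m s ω = fresh s c} ≠ 0) :
    ∃ Q, IsBanditLaw (π.initialized (rest c)) μ Q ∧ ∀ u E, MeasurableSet[past K (u + 1)] E →
      E ⊆ alive ξ b (2 * K / δ) (rest c).card u →
      P ({ω | state ξ b δ m s ω = fresh s c} ∩ shift s ⁻¹' E) =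
        P {ω | state ξ b δ m s ω = fresh s c} * Q E := by
  have := hP.isProbabilityMeasure
  set H := {ω : Path K | state ξ b δ m s ω = fresh s c} with hHdef
  have hHp : MeasurableSet[past K s] H := measurableSet_state_eq ξ b δ m s _
  have hH : MeasurableSet H := past_le K s _ hHp
  have := ProbabilityTheory.cond_isProbabilityMeasure (μ := P) h0
  have : IsProbabilityMeasure ((P[|H]).map (shift s)) :=
    Measure.isProbabilityMeasure_map (measurable_shift' s).aemeasurable
  have hPl := hP.isLawOn (fun a => (hμ a).1) fun _ => Set.univ
  -- After conditioning on the start of the epoch and shifting, the algorithm samples from the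
  -- initialized scheme only while the epoch is alive. The law must then be continued, since the
  -- regret assumption concerns complete bandit laws.
  have hlaw : IsLawOn (alive ξ b (2 * K / δ) (rest c).card) (π.initialized (rest c)) μ
      ((P[|H]).map (shift s)) := by
    constructor
    · intro t a B hB hBV
      have hB' := past_le K t _ hB
      rw [map_cond_apply hH (hB'.inter (measurableSet_arm' t a)),
        setLIntegral_map_cond hB' ((Policy.measurable_prob _ t a).ennreal_ofReal)]
      congr 1
      have hm : MeasurableSet[past K (s + t)] (H ∩ shift s ⁻¹' B) :=
        (past_mono (Nat.le_add_right s t) _ hHp).inter (measurableSet_shift hB)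
      have h1 := hPl.arm_law (s + t) a (H ∩ shift s ⁻¹' B) hm (Set.subset_univ _)
      rw [Set.inter_assoc] at h1
      refine h1.trans (setLIntegral_congr_fun (past_le K _ _ hm) fun ω hω => ?_)
      have h2 : state ξ b δ m (s + t) ω = fresh s c :=
        (state_add_iff hc hω.1 t).2 (hBV hω.2)
      simp only [resetGAI, h2]
      change ENNReal.ofReal ((π.initialized (rest c)).prob (s + t - s) (shift s ω) a) = _
      rw [Nat.add_sub_cancel_left]
    · intro t a B hB _
      have hB' := past_le K t _ hB
      have hBa := hB'.inter (measurableSet_arm' t a)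
      rw [map_cond_apply hH hBa,
        setLIntegral_map_cond hBa (measurable_reward' t).ennreal_ofReal, mul_left_comm]
      congr 1
      have hm : MeasurableSet[past K (s + t)] (H ∩ shift s ⁻¹' B) :=
        (past_mono (Nat.le_add_right s t) _ hHp).inter (measurableSet_shift hB)
      have h1 := hPl.reward_mean (s + t) a (H ∩ shift s ⁻¹' B) hm (Set.subset_univ _)
      rw [Set.inter_assoc] at h1
      exact h1
  obtain ⟨Q, hQ, hQE⟩ := exists_isBanditLaw_eq_on hμ
    (fun t => measurableSet_alive ξ b (2 * K / δ) (rest c).card t)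
    (alive_antitone ξ b (2 * K / δ) (rest c).card) hlaw
  refine ⟨Q, hQ, fun u E hE hEV => ?_⟩
  rw [hQE u E hE hEV, map_cond_apply hH (past_le K _ _ hE), ← mul_assoc,
    ENNReal.mul_inv_cancel h0 (measure_ne_top P _), one_mul]

/-- A bound for the sum over an epoch. -/
theorem tsum_epoch_le {K : ℕ} [NeZero K] {π : Scheme K} {ξ b δ : ℝ} {m : ℕ}
    {μ : Fin K → ℝ} (hμ : ∀ a, μ a ∈ Set.Icc (0 : ℝ) 1) {P : Measure (Path K)}
    (hP : IsBanditLaw (resetGAI π ξ b δ m).policy μ P) {s : ℕ}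
    {c : Finset (Fin K) × Finset (Fin K)} (hc : Active m c) {E : ℕ → Set (Path K)}
    (hE : ∀ u, MeasurableSet[past K (u + 1)] (E u))
    (hEV : ∀ u, E u ⊆ alive ξ b (2 * K / δ) (rest c).card u) {X : ℝ≥0∞}
    (hX : ∀ Q, IsBanditLaw (π.initialized (rest c)) μ Q → ∑' u, Q (E u) ≤ X) :
    ∑' u, P ({ω | state ξ b δ m s ω = fresh s c} ∩ shift s ⁻¹' E u) ≤
      P {ω | state ξ b δ m s ω = fresh s c} * X := by
  by_cases h0 : P {ω | state ξ b δ m s ω = fresh s c} = 0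
  · have : ∀ u, P ({ω | state ξ b δ m s ω = fresh s c} ∩ shift s ⁻¹' E u) = 0 := fun u =>
      measure_mono_null Set.inter_subset_left h0
    simp [this]
  · obtain ⟨Q, hQ, hQE⟩ := exists_epoch_law hμ hP hc h0
    rw [tsum_congr fun u => hQE u (E u) (hE u) (hEV u), ENNReal.tsum_mul_left]
    exact mul_le_mul_right (hX Q hQ) _

theorem initialized_prob_eq_zero {K : ℕ} (π : Scheme K) {S : Finset (Fin K)} (hS : S.Nonempty)
    {a : Fin K} (ha : a ∉ S) (t : ℕ) (ω : Path K) : (π.initialized S).prob t ω a = 0 := by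
  simp only [Scheme.initialized]
  split_ifs with h
  · refine Pi.single_eq_of_ne ?_ 1
    rintro rfl
    exact ha (Finset.orderEmbOfFin_mem S rfl ⟨t, h⟩)
  · exact π.supported S hS t ω a ha

theorem ae_pullsRest {K : ℕ} {π : Scheme K} {ξ b δ : ℝ} {m : ℕ}
    {μ : Fin K → ℝ} (hμ : ∀ a, μ a ∈ Set.Icc (0 : ℝ) 1) {P : Measure (Path K)}
    (hP : IsBanditLaw (resetGAI π ξ b δ m).policy μ P) :
    ∀ᵐ ω ∂P, PullsRest ξ b δ m ω := by
  have hPl := hP.isLawOn (fun a => (hμ a).1) fun _ => Set.univ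
  have hnull : ∀ (t : ℕ) (σ : State K) (a : Fin K), ∀ᵐ ω ∂P, state ξ b δ m t ω = σ →
      Active m σ.labels → arm t ω = a → a ∈ rest σ.labels := by
    intro t σ a
    by_cases hσ : Active m σ.labels ∧ a ∉ rest σ.labels
    · have hm := measurableSet_state_eq ξ b δ m t σ
      have h1 := hPl.arm_law t a _ hm (Set.subset_univ _)
      rw [setLIntegral_congr_fun (g := fun _ => 0) (past_le K _ _ hm) fun ω hω => ?_,
        lintegral_zero] at h1
      · have h2 : ∀ᵐ ω ∂P, ω ∉ {ω | state ξ b δ m t ω = σ} ∩ {ω | arm t ω = a} :=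
          measure_eq_zero_iff_ae_notMem.1 h1
        filter_upwards [h2] with ω h h3 _ h4
        exact absurd ⟨h3, h4⟩ h
      · have hω' : state ξ b δ m t ω = σ := hω
        simp only [resetGAI, hω']
        change ENNReal.ofReal ((π.initialized (rest σ.labels)).prob _ _ a) = 0
        rw [initialized_prob_eq_zero π hσ.1.2 hσ.2, ENNReal.ofReal_zero]
    · refine Eventually.of_forall fun ω _ h _ => ?_
      by_contra h'
      exact hσ ⟨h, h'⟩
  filter_upwards [ae_all_iff.2 fun t => ae_all_iff.2 fun σ => ae_all_iff.2 fun a => hnull t σ a]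
    with ω h t ht
  exact h t _ _ rfl ht rfl

/-- For different starting times these events are almost surely disjoint, by
`PullsRest.fresh_unique`. -/
theorem tsum_fresh_le {K : ℕ} {π : Scheme K} {ξ b δ : ℝ} {m : ℕ}
    {μ : Fin K → ℝ} (hμ : ∀ a, μ a ∈ Set.Icc (0 : ℝ) 1) {P : Measure (Path K)}
    (hP : IsBanditLaw (resetGAI π ξ b δ m).policy μ P) (c : Finset (Fin K) × Finset (Fin K)) :
    ∑' s, P {ω | state ξ b δ m s ω = fresh s c} ≤
      P (⋃ s, {ω | state ξ b δ m s ω = fresh s c}) := by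
  refine (measure_iUnion₀ ?_ fun s =>
    (past_le K s _ (measurableSet_state_eq ξ b δ m s _)).nullMeasurableSet).symm.le
  have h : ∀ s s', s < s' → AEDisjoint P {ω | state ξ b δ m s ω = fresh s c}
      {ω | state ξ b δ m s' ω = fresh s' c} := by
    intro s s' hlt
    refine measure_eq_zero_iff_ae_notMem.2 ?_
    filter_upwards [ae_pullsRest hμ hP] with ω hω h
    exact hω.fresh_unique hlt h.1 h.2
  intro s s' hne
  rcases lt_or_gt_of_ne hne with hlt | hlt
  · exact h s s' hlt
  · exact (h s' s hlt).symm

/-- A round with labels `c` belongs to an epoch that started at some `s` and has lasted `u` rounds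
with `s + u = t`; summing over `t` becomes summing over all pairs `(s, u)`. -/
theorem tsum_labels_eq_le {K : ℕ} (ξ b δ : ℝ) (m : ℕ) {P : Measure (Path K)}
    {c : Finset (Fin K) × Finset (Fin K)} (hc : Active m c) :
    ∑' t, P {ω | (state ξ b δ m t ω).labels = c} ≤
      ∑' s, ∑' u, P ({ω | state ξ b δ m s ω = fresh s c} ∩
        shift s ⁻¹' alive ξ b (2 * K / δ) (rest c).card u) := by
  have h1 : ∀ t, P {ω | (state ξ b δ m t ω).labels = c} ≤
      ∑ x ∈ Finset.HasAntidiagonal.antidiagonal t, P ({ω | state ξ b δ m x.1 ω = fresh x.1 c} ∩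
        shift x.1 ⁻¹' alive ξ b (2 * K / δ) (rest c).card x.2) := by
    intro t
    refine (measure_mono fun ω hω => ?_).trans (measure_biUnion_finset_le _ _)
    have hle := state_start_le ξ b δ m t ω
    have hlab : (state ξ b δ m t ω).labels = c := hω
    have hst : state ξ b δ m t ω = fresh (state ξ b δ m t ω).start c := by
      rw [← hlab]
      rfl
    have hf := state_start ξ b δ m t ω
    rw [hst] at hf
    set s := (state ξ b δ m t ω).start
    have hf' : state ξ b δ m s ω = fresh s c := hf
    refine Set.mem_biUnion (x := (s, t - s)) (Finset.mem_coe.2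
      (Finset.HasAntidiagonal.mem_antidiagonal.2 (Nat.add_sub_cancel' hle))) ⟨hf', ?_⟩
    refine (state_add_iff hc hf' (t - s)).1 ?_
    rw [Nat.add_sub_cancel' hle]
    exact hst
  refine (ENNReal.tsum_le_tsum h1).trans (le_of_eq ?_)
  rw [← ENNReal.tsum_prod, ← (Finset.HasAntidiagonal.sigmaAntidiagonalEquivProd (A := ℕ)).tsum_eq,
    ENNReal.tsum_sigma']
  refine tsum_congr fun t => ?_
  rw [← Finset.tsum_subtype]
  rfl

/-- The expected number of rounds in which the labels satisfy a condition, provided that the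
expected duration of epochs and the probabilities of incorrect labels are bounded. -/
theorem lintegral_active_le {K : ℕ} [NeZero K] {π : Scheme K} {ξ b δ : ℝ} {m : ℕ}
    {μ : Fin K → ℝ} (hμ : ∀ a, μ a ∈ Set.Icc (0 : ℝ) 1) (hμξ : ∀ a, μ a ≠ ξ)
    (hinj : ∀ a a', a ≠ a' → μ a ≠ μ a') {best : Finset (Fin K) → Fin K}
    (hbest : ∀ S, S.Nonempty → best S ∈ S ∧ ∀ a ∈ S, μ a ≤ μ (best S))
    {X : Finset (Fin K) → ℝ≥0∞} {ε : ℝ≥0∞}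
    (hX : ∀ S : Finset (Fin K), S.Nonempty → ∀ Q, IsBanditLaw (π.initialized S) μ Q →
      ∑' u, Q (alive ξ b (2 * K / δ) S.card u) ≤ X S ∧
      ∑' u, Q (wrongLabel ξ b (2 * K / δ) μ (best S) S.card u) ≤ ε)
    {P : Measure (Path K)} (hP : IsBanditLaw (resetGAI π ξ b δ m).policy μ P)
    (act : Finset (Finset (Fin K) × Finset (Fin K))) (hact : ∀ c ∈ act, Active m c)
    [DecidablePred (Nominal ξ μ)] :
    ∑' t, P {ω | (state ξ b δ m t ω).labels ∈ act} ≤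
      ∑ c ∈ act.filter (Nominal ξ μ), X (rest c) +
        ∑ c ∈ act, Fintype.card (Finset (Fin K) × Finset (Fin K)) * ε * X (rest c) := by
  classical
  have := hP.isProbabilityMeasure
  set F : ℕ → Finset (Fin K) × Finset (Fin K) → Set (Path K) := fun s c =>
    {ω | state ξ b δ m s ω = fresh s c} with hF
  have hv1 : ∀ c, ∑' s, P (F s c) ≤ 1 := fun c =>
    (tsum_fresh_le hμ hP c).trans prob_le_one
  set bad : Set (Path K) := ⋃ c ∈ Finset.univ.filter (fun c => Nominal ξ μ c ∧ Active m c),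
    ⋃ s, ⋃ u, F s c ∩
      shift s ⁻¹' wrongLabel ξ b (2 * K / δ) μ (best (rest c)) (rest c).card u with hbad
  have hPbad : P bad ≤ Fintype.card (Finset (Fin K) × Finset (Fin K)) * ε := by
    calc P bad ≤ ∑ c ∈ Finset.univ.filter (fun c => Nominal ξ μ c ∧ Active m c), ε := by
          refine (measure_biUnion_finset_le _ _).trans (Finset.sum_le_sum fun c hc => ?_)
          have hca : Active m c := (Finset.mem_filter.1 hc).2.2
          calc P (⋃ s, ⋃ u, F s c ∩ shift s ⁻¹'
                wrongLabel ξ b (2 * K / δ) μ (best (rest c)) (rest c).card u)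
              ≤ ∑' s, ∑' u, P (F s c ∩ shift s ⁻¹'
                wrongLabel ξ b (2 * K / δ) μ (best (rest c)) (rest c).card u) :=
                (measure_iUnion_le _).trans (ENNReal.tsum_le_tsum fun s => measure_iUnion_le _)
            _ ≤ ∑' s, P (F s c) * ε := ENNReal.tsum_le_tsum fun s =>
                tsum_epoch_le hμ hP hca (fun u => measurableSet_wrongLabel ξ b _ μ _ _ u)
                  (fun u => Set.inter_subset_left) fun Q hQ => (hX _ hca.2 Q hQ).2
            _ = (∑' s, P (F s c)) * ε := ENNReal.tsum_mul_right
            _ ≤ 1 * ε := mul_le_mul_left (hv1 c) ε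
            _ = ε := one_mul ε
      _ ≤ ∑ c : Finset (Fin K) × Finset (Fin K), ε :=
          Finset.sum_le_sum_of_subset (Finset.filter_subset _ _)
      _ = _ := by rw [Finset.sum_const, Finset.card_univ, nsmul_eq_mul]
  -- Labels that are not nominal can only arise after a wrong label in an epoch started from nominal
  -- labels. Their epochs thus start with probability `O(ε)`, and their conditional duration is
  -- still at most `X`.
  have hv2 : ∀ c, ¬ Nominal ξ μ c → ∑' s, P (F s c) ≤ P bad := by
    intro c hc
    refine (tsum_fresh_le hμ hP c).trans (measure_mono fun ω hω => ?_)
    by_contra hnb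
    obtain ⟨s, hs⟩ := Set.mem_iUnion.1 hω
    have hs' : state ξ b δ m s ω = fresh s c := hs
    refine hc ?_
    have := nominal_of_not_wrongLabel (ξ := ξ) (b := b) (δ := δ) (m := m) (ω := ω) hμξ hinj hbest
      (fun c' h1 h2 s' u' h3 h4 => hnb (Set.mem_biUnion (x := c') (Finset.mem_coe.2
        (Finset.mem_filter.2 ⟨Finset.mem_univ _, h1, h2⟩))
        (Set.mem_iUnion.2 ⟨s', Set.mem_iUnion.2 ⟨u', h3, h4⟩⟩))) s
    rw [hs'] at this
    exact this
  have hc : ∀ c ∈ act, ∑' t, P {ω | (state ξ b δ m t ω).labels = c} ≤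
      (if Nominal ξ μ c then X (rest c) else 0) +
        Fintype.card (Finset (Fin K) × Finset (Fin K)) * ε * X (rest c) := by
    intro c hca
    have h1 : ∑' t, P {ω | (state ξ b δ m t ω).labels = c} ≤ (∑' s, P (F s c)) * X (rest c) := by
      rw [← ENNReal.tsum_mul_right]
      exact (tsum_labels_eq_le ξ b δ m (hact c hca)).trans (ENNReal.tsum_le_tsum fun s =>
        tsum_epoch_le hμ hP (hact c hca)
          (fun u => past_mono (Nat.le_succ u) _ (measurableSet_alive ξ b _ _ u))
          (fun u => subset_rfl) fun Q hQ => (hX _ (hact c hca).2 Q hQ).1)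
    refine h1.trans ?_
    by_cases hn : Nominal ξ μ c
    · rw [if_pos hn]
      exact le_add_right ((mul_le_mul_left (hv1 c) _).trans (one_mul _).le)
    · rw [if_neg hn, zero_add]
      exact mul_le_mul_left ((hv2 c hn).trans hPbad) _
  calc ∑' t, P {ω | (state ξ b δ m t ω).labels ∈ act}
      ≤ ∑' t, ∑ c ∈ act, P {ω | (state ξ b δ m t ω).labels = c} := by
        refine ENNReal.tsum_le_tsum fun t => (measure_mono fun ω hω => ?_).trans
          (measure_biUnion_finset_le act fun c => {ω | (state ξ b δ m t ω).labels = c})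
        exact Set.mem_biUnion (x := (state ξ b δ m t ω).labels) (Finset.mem_coe.2 hω) rfl
    _ = ∑ c ∈ act, ∑' t, P {ω | (state ξ b δ m t ω).labels = c} :=
        Summable.tsum_finsetSum fun _ _ => ENNReal.summable
    _ ≤ ∑ c ∈ act, ((if Nominal ξ μ c then X (rest c) else 0) +
        Fintype.card (Finset (Fin K) × Finset (Fin K)) * ε * X (rest c)) := Finset.sum_le_sum hc
    _ = _ := by rw [Finset.sum_add_distrib, ← Finset.sum_filter]

/-! ### The asymptotic performance of the resetting algorithm -/

theorem Nominal.mem_iff {K : ℕ} {ξ : ℝ} {μ : Fin K → ℝ}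
    {c : Finset (Fin K) × Finset (Fin K)} (hc : Nominal ξ μ c) {a : Fin K} (ha : a ∈ rest c)
    (hmax : ∀ a' ∈ rest c, μ a' ≤ μ a) (x : Fin K) :
    (x ∈ c.1 ↔ μ a < μ x ∧ ξ < μ x) ∧ (x ∈ c.2 ↔ μ a < μ x ∧ ¬ ξ < μ x) := by
  have h1 : x ∈ c.1 → ξ < μ x := fun h => mem_goodArms.1 (hc.1 h)
  have h2 : x ∈ c.2 → ¬ ξ < μ x := fun h h' =>
    Finset.mem_compl.1 (hc.2.1 h) (mem_goodArms.2 h')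
  have h3 : x ∈ c.1 ∪ c.2 ↔ μ a < μ x := by
    refine ⟨fun h => hc.2.2 x h a ha, fun h => ?_⟩
    by_contra h'
    exact absurd (hmax x (Finset.mem_compl.2 h')) (not_le.2 h)
  rw [← h3, Finset.mem_union]
  tauto

/-- In a nominal pair the labelled arms are exactly those above the best remaining arm, each on its
true side, so that arm determines the pair. -/
theorem nominal_injOn {K : ℕ} {ξ : ℝ} {μ : Fin K → ℝ} {best : Finset (Fin K) → Fin K}
    (hbest : ∀ S, S.Nonempty → best S ∈ S ∧ ∀ a ∈ S, μ a ≤ μ (best S)) :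
    Set.InjOn (fun c => best (rest c)) {c | Nominal ξ μ c ∧ (rest c).Nonempty} := by
  rintro c ⟨h1, h2⟩ c' ⟨h1', h2'⟩ heq
  have heq' : best (rest c) = best (rest c') := heq
  have hc := h1.mem_iff (hbest _ h2).1 (hbest _ h2).2
  have hc' := h1'.mem_iff (hbest _ h2').1 (hbest _ h2').2
  refine Prod.ext (Finset.ext fun x => ?_) (Finset.ext fun x => ?_)
  · rw [(hc x).1, (hc' x).1, heq']
  · rw [(hc x).2, (hc' x).2, heq']

/-- The common core of all upper bounds: `act` lists the labels under which the clock `τ` may still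
run, and `T` contains the best remaining arm of each nominal pair in `act`. Nominal pairs inject
into `T` and give the main term. -/
theorem limsup_worstCase_le {K : ℕ} [NeZero K] {ξ b : ℝ} (hξ : ξ ∈ Set.Ioo (0 : ℝ) 1)
    (hb : b ∈ Set.Ioo (0 : ℝ) 1) {μ : Fin K → ℝ}
    (hμ : ∀ a, μ a ∈ Set.Icc (ξ * (1 - b)) (b * (1 - ξ) + ξ)) (hμξ : ∀ a, μ a ≠ ξ)
    (hinj : ∀ a a', a ≠ a' → μ a ≠ μ a') {π : Scheme K} (hπ : IsRegretMinimizing π μ) {m : ℕ}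
    (act : Finset (Finset (Fin K) × Finset (Fin K))) (hact : ∀ c ∈ act, Active m c)
    {T : Finset (Fin K)} (hT : ∀ c ∈ act, Nominal ξ μ c → ∀ a ∈ rest c,
      (∀ a' ∈ rest c, μ a' ≤ μ a) → a ∈ T) {τ : ℝ → Path K → ℝ≥0∞}
    (hτ : ∀ δ ω, τ δ ω ≤
      ∑' t, {ω | (state ξ b δ m t ω).labels ∈ act}.indicator (fun _ => (1 : ℝ≥0∞)) ω) :
    limsup (fun δ : ℝ => worstCase (resetGAI π ξ b δ m).policy μ (τ δ) /
      ENNReal.ofReal (Real.log (1 / δ))) (𝓝[>] 0) ≤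
        ENNReal.ofReal (∑ a ∈ T, 1 / bernKL (μ a) ξ) := by
  classical
  have hμI : ∀ a, μ a ∈ Set.Ioo (0 : ℝ) 1 := fun a =>
    ⟨(mul_pos hξ.1 (sub_pos.2 hb.2)).trans_le (hμ a).1,
      (hμ a).2.trans_lt (by nlinarith [hξ.2, hb.2])⟩
  have hd : ∀ a, 0 < bernKL (μ a) ξ := fun a => bernKL_pos (hμI a) hξ (hμξ a)
  have hd' : ∀ a, 0 ≤ 1 / bernKL (μ a) ξ := fun a => (one_div_pos.2 (hd a)).le
  have hex : ∀ S : Finset (Fin K), ∃ a, S.Nonempty → a ∈ S ∧ ∀ a' ∈ S, μ a' ≤ μ a := by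
    intro S
    by_cases hS : S.Nonempty
    · obtain ⟨a, h1, h2⟩ := S.exists_max_image μ hS
      exact ⟨a, fun _ => ⟨h1, h2⟩⟩
    · exact ⟨0, fun h => absurd h hS⟩
  choose best hbest using hex
  set D := ∑ a, 1 / bernKL (μ a) ξ with hD
  have hDle : ∀ a, 1 / bernKL (μ a) ξ ≤ D := fun a =>
    Finset.single_le_sum (fun a _ => hd' a) (Finset.mem_univ a)
  have hD0 : 0 ≤ D := Finset.sum_nonneg fun a _ => hd' a
  set N : ℝ := ((Fintype.card (Finset (Fin K) × Finset (Fin K)) : ℕ) : ℝ) with hN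
  have hN0 : 0 ≤ N := Nat.cast_nonneg _
  -- The bound for tolerance `η`: the main term with a slack `η` per epoch, and for each pair in
  -- `act` an error of probability at most `N * η` times a duration of at most `D + η` in units of
  -- `log (1 / δ)`. It tends to the claimed constant as `η → 0`.
  set g : ℝ → ℝ := fun η => ∑ a ∈ T, (1 / bernKL (μ a) ξ + η) + act.card * (N * η * (D + η))
    with hg
  have hlim : Tendsto (fun η => ENNReal.ofReal (g η)) (𝓝[>] 0) (𝓝 (ENNReal.ofReal (g 0))) := by
    have : Continuous g := by fun_prop
    exact ((ENNReal.continuous_ofReal.comp this).tendsto 0).mono_left nhdsWithin_le_nhds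
  have hg0 : g 0 = ∑ a ∈ T, 1 / bernKL (μ a) ξ := by simp [hg]
  rw [← hg0]
  refine ge_of_tendsto hlim ?_
  filter_upwards [self_mem_nhdsWithin] with η hη
  have hη : 0 < η := hη
  refine limsup_le_of_le (h := ?_)
  have hev : ∀ᶠ δ : ℝ in 𝓝[>] 0, ∀ S : Finset (Fin K), S.Nonempty →
      ∀ Q, IsBanditLaw (π.initialized S) μ Q →
      ∑' u, Q (alive ξ b (2 * K / δ) S.card u) ≤
        ENNReal.ofReal ((1 / bernKL (μ (best S)) ξ + η) * Real.log (1 / δ)) ∧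
      ∑' u, Q (wrongLabel ξ b (2 * K / δ) μ (best S) S.card u) ≤ ENNReal.ofReal η := by
    refine eventually_all.2 fun S => ?_
    by_cases hS : S.Nonempty
    · filter_upwards [eventually_epoch_bound hξ hb hμ hμξ hπ (hbest S hS).1 (hbest S hS).2 hη]
        with δ h _ Q hQ
      exact h Q hQ
    · exact Eventually.of_forall fun δ h => absurd h hS
  filter_upwards [hev, tendsto_log_one_div.eventually_gt_atTop 0] with δ hδ hl
  refine ENNReal.div_le_of_le_mul ?_
  have hg' : 0 ≤ g η := add_nonneg (Finset.sum_nonneg fun a _ => add_nonneg (hd' a) hη.le)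
    (by positivity)
  rw [← ENNReal.ofReal_mul hg']
  refine iSup₂_le fun P hP => ?_
  have hm : ∀ t, MeasurableSet {ω : Path K | (state ξ b δ m t ω).labels ∈ act} := fun t =>
    past_le K t _ (measurable_state ξ b δ m t
      (MeasurableSet.of_discrete (s := {σ : State K | σ.labels ∈ act})))
  calc ∫⁻ ω, τ δ ω ∂P ≤ ∫⁻ ω, ∑' t, {ω | (state ξ b δ m t ω).labels ∈ act}.indicator
        (fun _ => (1 : ℝ≥0∞)) ω ∂P := lintegral_mono (hτ δ)
    _ = ∑' t, P {ω | (state ξ b δ m t ω).labels ∈ act} := by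
        rw [lintegral_tsum fun t => (measurable_const.indicator (hm t)).aemeasurable]
        exact tsum_congr fun t => lintegral_indicator_one (hm t)
    _ ≤ ∑ c ∈ act.filter (Nominal ξ μ),
          ENNReal.ofReal ((1 / bernKL (μ (best (rest c))) ξ + η) * Real.log (1 / δ)) +
        ∑ c ∈ act, Fintype.card (Finset (Fin K) × Finset (Fin K)) * ENNReal.ofReal η *
          ENNReal.ofReal ((1 / bernKL (μ (best (rest c))) ξ + η) * Real.log (1 / δ)) :=
        lintegral_active_le (fun a => Set.Ioo_subset_Icc_self (hμI a)) hμξ hinj hbest hδ hP act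
          hact
    _ ≤ ENNReal.ofReal ((∑ a ∈ T, (1 / bernKL (μ a) ξ + η)) * Real.log (1 / δ)) +
        ENNReal.ofReal (act.card * (N * η * (D + η)) * Real.log (1 / δ)) := by
        refine add_le_add ?_ ?_
        · rw [Finset.sum_mul, ENNReal.ofReal_sum_of_nonneg fun a _ =>
            mul_nonneg (add_nonneg (hd' a) hη.le) hl.le]
          have himg := Finset.sum_image (s := act.filter (Nominal ξ μ))
            (g := fun c => best (rest c))
            (f := fun a => ENNReal.ofReal ((1 / bernKL (μ a) ξ + η) * Real.log (1 / δ)))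
            ((nominal_injOn (ξ := ξ) hbest).mono fun c hc => by
              have hc' := Finset.mem_filter.1 (Finset.mem_coe.1 hc)
              exact ⟨hc'.2, (hact c hc'.1).2⟩)
          rw [← himg]
          refine Finset.sum_le_sum_of_subset fun a ha => ?_
          obtain ⟨c, hc, rfl⟩ := Finset.mem_image.1 ha
          have hc' := Finset.mem_filter.1 hc
          have hb' := hbest _ (hact c hc'.1).2
          exact hT c hc'.1 hc'.2 _ hb'.1 hb'.2
        · refine (Finset.sum_le_card_nsmul act _
            (ENNReal.ofReal (N * η * (D + η) * Real.log (1 / δ))) fun c _ => ?_).trans ?_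
          · rw [← ENNReal.ofReal_natCast, ← ENNReal.ofReal_mul hN0, ← ENNReal.ofReal_mul
              (by positivity)]
            refine ENNReal.ofReal_le_ofReal ?_
            rw [mul_assoc (N * η)]
            have := hDle (best (rest c))
            gcongr
          · rw [nsmul_eq_mul, ← ENNReal.ofReal_natCast, ← ENNReal.ofReal_mul (Nat.cast_nonneg _),
              ← mul_assoc]
    _ = ENNReal.ofReal (g η * Real.log (1 / δ)) := by
        rw [← ENNReal.ofReal_add (mul_nonneg (Finset.sum_nonneg fun a _ =>
          add_nonneg (hd' a) hη.le) hl.le) (by positivity), ← add_mul]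

theorem tsum_ite_le_tsum_indicator {K : ℕ} {ξ b δ : ℝ} {m : ℕ} {ω : Path K} {p : ℕ → Prop}
    [DecidablePred p] {act : Finset (Finset (Fin K) × Finset (Fin K))}
    (h : ∀ t, ¬ p t → (state ξ b δ m t ω).labels ∈ act) :
    ∑' t, (if p t then (0 : ℝ≥0∞) else 1) ≤
      ∑' t, {ω | (state ξ b δ m t ω).labels ∈ act}.indicator (fun _ => (1 : ℝ≥0∞)) ω := by
  refine ENNReal.tsum_le_tsum fun t => ?_
  by_cases hp : p t
  · rw [if_pos hp]
    exact zero_le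
  · rw [if_neg hp]
    exact (Set.indicator_of_mem (s := {ω | (state ξ b δ m t ω).labels ∈ act}) (h t hp)
      fun _ => (1 : ℝ≥0∞)).ge

theorem firstTime_le_of_active {K : ℕ} {ξ b δ : ℝ} {m : ℕ} {ω : Path K} {p : ℕ → Prop}
    {act : Finset (Finset (Fin K) × Finset (Fin K))}
    (h : ∀ t, ¬ p t → (state ξ b δ m t ω).labels ∈ act) :
    firstTime p ≤
      ∑' t, {ω | (state ξ b δ m t ω).labels ∈ act}.indicator (fun _ => (1 : ℝ≥0∞)) ω := by
  classical
  exact (firstTime_le_tsum p).trans (tsum_ite_le_tsum_indicator h)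

/-- With `m = K` the loop cannot end before all arms are labelled: `K` good labels already exhaust
the arms. -/
theorem limsup_stopTime_le {K : ℕ} [NeZero K] {ξ b : ℝ} (hξ : ξ ∈ Set.Ioo (0 : ℝ) 1)
    (hb : b ∈ Set.Ioo (0 : ℝ) 1) {μ : Fin K → ℝ}
    (hμ : ∀ a, μ a ∈ Set.Icc (ξ * (1 - b)) (b * (1 - ξ) + ξ)) (hμξ : ∀ a, μ a ≠ ξ)
    (hinj : ∀ a a', a ≠ a' → μ a ≠ μ a') {π : Scheme K} (hπ : IsRegretMinimizing π μ) :
    limsup (fun δ : ℝ => worstCase (resetGAI π ξ b δ K).policy μ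
      (stopTime (resetGAI π ξ b δ K)) / ENNReal.ofReal (Real.log (1 / δ))) (𝓝[>] 0) ≤
        ENNReal.ofReal (∑ a, 1 / bernKL (μ a) ξ) := by
  classical
  refine limsup_worstCase_le hξ hb hμ hμξ hinj hπ (Finset.univ.filter (Active K))
    (fun c hc => (Finset.mem_filter.1 hc).2) (fun _ _ _ _ _ _ => Finset.mem_univ _)
    (τ := fun δ => stopTime (resetGAI π ξ b δ K)) fun δ ω => firstTime_le_of_active fun t ht => ?_
  have ht' : (state ξ b δ K t ω).good ∪ (state ξ b δ K t ω).bad ≠ Finset.univ := ht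
  refine Finset.mem_filter.2 ⟨Finset.mem_univ _, ?_, ?_⟩
  · refine lt_of_le_of_ne ((Finset.card_le_univ _).trans (Fintype.card_fin K).le) fun h => ht' ?_
    have : (state ξ b δ K t ω).good = Finset.univ :=
      Finset.card_eq_iff_eq_univ _ |>.1 (h.trans (Fintype.card_fin K).symm)
    rw [this]
    exact top_sup_eq _
  · rw [Finset.nonempty_iff_ne_empty]
    exact fun h => ht' (Finset.compl_eq_empty_iff _ |>.1 h)

theorem limsup_min_stopTime_endTime_le {K : ℕ} [NeZero K] {ξ b : ℝ} (hξ : ξ ∈ Set.Ioo (0 : ℝ) 1)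
    (hb : b ∈ Set.Ioo (0 : ℝ) 1) {μ : Fin K → ℝ}
    (hμ : ∀ a, μ a ∈ Set.Icc (ξ * (1 - b)) (b * (1 - ξ) + ξ)) (hμξ : ∀ a, μ a ≠ ξ)
    (hinj : ∀ a a', a ≠ a' → μ a ≠ μ a') {π : Scheme K} (hπ : IsRegretMinimizing π μ)
    (m : ℕ) :
    limsup (fun δ : ℝ => worstCase (resetGAI π ξ b δ m).policy μ
      (fun ω => min (stopTime (resetGAI π ξ b δ m) ω) (endTime ξ b δ m ω)) /
        ENNReal.ofReal (Real.log (1 / δ))) (𝓝[>] 0) ≤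
        ENNReal.ofReal (∑ a, 1 / bernKL (μ a) ξ) := by
  classical
  refine limsup_worstCase_le hξ hb hμ hμξ hinj hπ (Finset.univ.filter (Active m))
    (fun c hc => (Finset.mem_filter.1 hc).2) (fun _ _ _ _ _ _ => Finset.mem_univ _)
    (τ := fun δ ω => min (stopTime (resetGAI π ξ b δ m) ω) (endTime ξ b δ m ω))
    fun δ ω => (min_le_right _ _).trans (firstTime_le_of_active fun t ht =>
      Finset.mem_filter.2 ⟨Finset.mem_univ _, (not_stopped_iff _).1 ht⟩)

/-- The clock runs while the loop is active and fewer than `top.card` arms are labelled good. In a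
nominal pair of this kind the best remaining arm must belong to `top`, for otherwise all of `top`
would already be labelled good. -/
theorem limsup_min_goodTime_endTime_le {K : ℕ} [NeZero K] {ξ b : ℝ} (hξ : ξ ∈ Set.Ioo (0 : ℝ) 1)
    (hb : b ∈ Set.Ioo (0 : ℝ) 1) {μ : Fin K → ℝ}
    (hμ : ∀ a, μ a ∈ Set.Icc (ξ * (1 - b)) (b * (1 - ξ) + ξ)) (hμξ : ∀ a, μ a ≠ ξ)
    (hinj : ∀ a a', a ≠ a' → μ a ≠ μ a') {π : Scheme K} (hπ : IsRegretMinimizing π μ)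
    (m : ℕ) {iStar : Fin K} (hstar : ξ < μ iStar) :
    limsup (fun δ : ℝ => worstCase (resetGAI π ξ b δ m).policy μ
      (fun ω => min (goodTime (resetGAI π ξ b δ m)
        (Finset.univ.filter fun a => μ iStar ≤ μ a).card ω) (endTime ξ b δ m ω)) /
        ENNReal.ofReal (Real.log (1 / δ))) (𝓝[>] 0) ≤
        ENNReal.ofReal (∑ a with μ iStar ≤ μ a, 1 / bernKL (μ a) ξ) := by
  classical
  set top := Finset.univ.filter fun a => μ iStar ≤ μ a with htop
  refine limsup_worstCase_le hξ hb hμ hμξ hinj hπ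
    (Finset.univ.filter fun c => Active m c ∧ c.1.card < top.card)
    (fun c hc => (Finset.mem_filter.1 hc).2.1) ?_
    (τ := fun δ ω => min (goodTime (resetGAI π ξ b δ m) top.card ω) (endTime ξ b δ m ω))
    fun δ ω => (min_firstTime_le _ _).trans (firstTime_le_of_active fun t ht => ?_)
  · intro c hc hn a ha hmax
    refine Finset.mem_filter.2 ⟨Finset.mem_univ _, ?_⟩
    by_contra h
    have hsub : top ⊆ c.1 := fun x hx => by
      have hx' := (Finset.mem_filter.1 hx).2
      exact ((hn.mem_iff ha hmax x).1).2 ⟨(not_le.1 h).trans_le hx', hstar.trans_le hx'⟩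
    exact absurd (Finset.card_le_card hsub) (not_le.2 (Finset.mem_filter.1 hc).2.2)
  · push Not at ht
    exact Finset.mem_filter.2 ⟨Finset.mem_univ _, (not_stopped_iff _).1 ht.2, ht.1⟩

theorem lt_of_card_le_goodArms {K : ℕ} {ξ : ℝ} {μ : Fin K → ℝ} {iStar : Fin K}
    (h : (Finset.univ.filter fun a => μ iStar ≤ μ a).card ≤ (goodArms ξ μ).card) :
    ξ < μ iStar := by
  by_contra hle
  refine absurd h (not_le.2 (Finset.card_lt_card ⟨fun a ha => ?_, fun hsub => ?_⟩))
  · exact Finset.mem_filter.2 ⟨Finset.mem_univ _,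
      (not_lt.1 hle).trans (mem_goodArms.1 ha).le⟩
  · exact hle (mem_goodArms.1 (hsub (Finset.mem_filter.2 ⟨Finset.mem_univ _, le_rfl⟩)))

end GAI

end

/-! ### The theorem. -/

theorem theorem5p2 (K : ℕ) (hK : 0 < K) (ξ b : ℝ)
    (hξ : ξ ∈ Set.Ioo (0 : ℝ) 1) (hb : b ∈ Set.Ioo (0 : ℝ) 1) (μ : Fin K → ℝ)
    (hμ : ∀ a, μ a ∈ Set.Icc (ξ * (1 - b)) (b * (1 - ξ) + ξ))
    (hμξ : ∀ a, μ a ≠ ξ) (hdistinct : ∀ a a', a ≠ a' → μ a ≠ μ a') :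
    -- lower bound for labelling all arms
    (ENNReal.ofReal (∑ a, 1 / GAI.bernKL (μ a) ξ) ≤
      liminf (fun δ : ℝ =>
        ⨅ (A : GAI.Algorithm K) (_ : GAI.IsDeltaCorrect ξ δ A),
          GAI.worstCase A.policy μ (GAI.stopTime A) / ENNReal.ofReal (Real.log (1 / δ)))
        (𝓝[>] 0)) ∧
    -- lower bound for the `i`-th good arm, `μ iStar` being the `i`-th largest mean
    (∀ (i : ℕ) (iStar : Fin K), i ≤ (GAI.goodArms ξ μ).card →
      (Finset.univ.filter fun a => μ iStar ≤ μ a).card = i →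
      ENNReal.ofReal (∑ a with μ iStar ≤ μ a, 1 / GAI.bernKL (μ a) ξ) ≤
        liminf (fun δ : ℝ =>
          ⨅ (A : GAI.Algorithm K) (_ : GAI.IsDeltaCorrect ξ δ A),
            GAI.worstCase A.policy μ (GAI.goodTime A i) / ENNReal.ofReal (Real.log (1 / δ)))
          (𝓝[>] 0)) ∧
    -- the resetting algorithm with a regret-minimizing scheme
    (∀ π : GAI.Scheme K, GAI.IsRegretMinimizing π μ →
      -- labelling all arms, no early termination
      (limsup (fun δ : ℝ =>
          GAI.worstCase (GAI.resetGAI π ξ b δ K).policy μ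
              (GAI.stopTime (GAI.resetGAI π ξ b δ K)) / ENNReal.ofReal (Real.log (1 / δ)))
          (𝓝[>] 0) ≤ ENNReal.ofReal (∑ a, 1 / GAI.bernKL (μ a) ξ)) ∧
      -- labelling all arms, with termination allowed after `m` arms are labelled good
      (∀ m : ℕ, 1 ≤ m → (GAI.goodArms ξ μ).card ≤ m → m ≤ K →
        limsup (fun δ : ℝ =>
          GAI.worstCase (GAI.resetGAI π ξ b δ m).policy μ
              (fun ω => min (GAI.stopTime (GAI.resetGAI π ξ b δ m) ω) (GAI.endTime ξ b δ m ω)) /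
            ENNReal.ofReal (Real.log (1 / δ)))
          (𝓝[>] 0) ≤ ENNReal.ofReal (∑ a, 1 / GAI.bernKL (μ a) ξ)) ∧
      -- the `i`-th good arm
      (∀ (m i : ℕ) (iStar : Fin K), 1 ≤ m → m ≤ K → i ≤ m → i ≤ (GAI.goodArms ξ μ).card →
        (Finset.univ.filter fun a => μ iStar ≤ μ a).card = i →
        limsup (fun δ : ℝ =>
          GAI.worstCase (GAI.resetGAI π ξ b δ m).policy μ
              (fun ω => min (GAI.goodTime (GAI.resetGAI π ξ b δ m) i ω)
                (GAI.endTime ξ b δ m ω)) /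
            ENNReal.ofReal (Real.log (1 / δ)))
          (𝓝[>] 0) ≤ ENNReal.ofReal (∑ a with μ iStar ≤ μ a, 1 / GAI.bernKL (μ a) ξ))) := by
  have : NeZero K := ⟨hK.ne'⟩
  have hμI : ∀ a, μ a ∈ Set.Ioo (0 : ℝ) 1 := fun a =>
    ⟨(mul_pos hξ.1 (sub_pos.2 hb.2)).trans_le (hμ a).1,
      (hμ a).2.trans_lt (by nlinarith [hξ.2, hb.2])⟩
  refine ⟨GAI.le_liminf_stopTime hξ hμI hμξ, ?_, fun π hπ => ⟨?_, ?_, ?_⟩⟩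
  · rintro i iStar hi rfl
    exact GAI.le_liminf_goodTime hξ hμI hμξ iStar (GAI.lt_of_card_le_goodArms hi)
  · exact GAI.limsup_stopTime_le hξ hb hμ hμξ hdistinct hπ
  · exact fun m _ _ _ => GAI.limsup_min_stopTime_endTime_le hξ hb hμ hμξ hdistinct hπ m
  · rintro m i iStar - - - hi rfl
    exact GAI.limsup_min_goodTime_endTime_le hξ hb hμ hμξ hdistinct hπ m
      (GAI.lt_of_card_le_goodArms hi)
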